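/- Let $S=\Gamma\backslash\mathbb H^2$ be a closed (compact, connected) orientable hyperbolic surface, where $\Gamma$ is the group of covering transformations, which acts on the hyperbolic plane $\mathbb H^2$ by orientation-preserving isometries. Let $d$ be the hyperbolic distance on $\mathbb H^2$, let $f:S\to S$ be a homeomorphism isotopic to the identity, and let $\tilde f:\mathbb H^2\to\mathbb H^2$ be its unique lift that commutes with every element of $\Gamma$. A point $x\in S$ has rotation speed $\vartheta(x)$ if for each lift $\tilde x$ of $x$ $$\vartheta(x)=\lim_{n\to+\infty}\tfrac1n\, d\big(\tilde x,\tilde f^{n}(\tilde x)\big)=\lim_{n\to+\infty}\tfrac1n\, d\big(\tilde f^{-n}(\tilde x),\tilde x\big).$$ A unit speed geodesic $\gamma:\mathbb R\to S$ is a tracking geodesic of $x$ if $\vartheta(x)$ exists, $\vartheta(x)>0$, and each lift $\tilde x$ of $x$ admits a lift $\tilde\gamma$ of $\gamma$ to $\mathbb H^2$ with $$\lim_{n\to+\infty}\tfrac1n\, d\big(\tilde f^{n}(\tilde x),\tilde\gamma(n\vartheta(x))\big)=\lim_{n\to+\infty}\tfrac1n\, d\big(\tilde f^{-n}(\tilde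 x),\tilde\gamma(-n\vartheta(x))\big)=0.$$ It is normalized if moreover, for some lifts $\tilde x,\tilde\gamma$ satisfying these limits, $d(\tilde x,\tilde\gamma(0))=d(\tilde x,\tilde\gamma(\mathbb R))$. Write $\dot\gamma:\mathbb R\to \mathrm T^1S$ for the velocity of $\gamma$ in the unit tangent bundle of $S$. **Theorem.** Let $\mu$ be an ergodic $f$-invariant Borel probability measure on $S$ with positive rotation speed, that is, there is a constant $\vartheta_\mu>0$ with $\vartheta(x)=\vartheta_\mu$ for $\mu$-a.e. $x$. Then there exists a Borel probability measure $\nu_\mu$ on $\mathrm T^1S$ such that: 1. for $\mu$-a.e. $x\in S$, the point $x$ has a normalized tracking geodesic, and every tracking geodesic $\gamma$ of $x$ equidistributes to $\nu_\mu$: for every continuous $\varphi:\mathrm T^1S\to\mathbb R$, $$\lim_{T\to+\infty}\frac1T\int_0^T\varphi(\dot\gamma(t))\,\mathrm dt=\lim_{T\to+\infty}\frac1T\int_{-T}^0\varphi(\dot\gamma(t))\,\mathrm dt=\int_{\mathrm T^1S}\varphi\,\mathrm d\nu_\mu;$$ 2. $\nu_\mu$ is invariant and ergodic for the geodesic flow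 on $\mathrm T^1S$ (every flow-invariant Borel set has $\nu_\mu$-measure $0$ or $1$); 3. for $\mu$-a.e. $x\in S$ and every tracking geodesic $\gamma$ of $x$, the support of $\nu_\mu$ is equal to $\overline{\dot\gamma(\mathbb R)}$, the closure being taken in $\mathrm T^1S$. -/

import Mathlib

open MeasureTheory Filter Topology
open scoped UpperHalfPlane MatrixGroups unitInterval

noncomputable section

namespace HypSurface

/-! ### The unit tangent bundle of the hyperbolic plane and its geodesic flow -/

/-- The unit tangent bundle `T¹ℍ` of the upper half-plane with the metric `|dz|² / (im z)²`:
pairs `(z, v)` of a point `z` and a tangent vector `v ∈ T_z ℍ = ℂ` of hyperbolic norm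
`|v| / im z = 1`. -/
def UnitTangentPlane : Type := {p : ℍ × ℂ // ‖p.2‖ = p.1.im}

namespace UnitTangentPlane

instance : TopologicalSpace UnitTangentPlane :=
  inferInstanceAs (TopologicalSpace {p : ℍ × ℂ // ‖p.2‖ = p.1.im})

/-- The base point of a unit tangent vector. -/
def base (p : UnitTangentPlane) : ℍ := p.1.1

/-- The tangent vector itself, as a complex number. -/
def vec (p : UnitTangentPlane) : ℂ := p.1.2

theorem norm_vec (p : UnitTangentPlane) : ‖p.vec‖ = p.base.im := p.2

@[ext] theorem ext {p q : UnitTangentPlane} (h₁ : p.base = q.base) (h₂ : p.vec = q.vec) :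
    p = q := Subtype.ext (Prod.ext h₁ h₂)

end UnitTangentPlane

open UnitTangentPlane

/-- The denominator `c z + d` of the Möbius transformation `z ↦ (a z + b) / (c z + d)`;
the complex derivative of this transformation at `z` is `1 / (c z + d)²`. -/
def mobDen (g : SL(2, ℝ)) (z : ℍ) : ℂ := (g 1 0 : ℂ) * z + (g 1 1 : ℂ)

theorem mobDen_eq (g : SL(2, ℝ)) (z : ℍ) :
    mobDen g z = UpperHalfPlane.denom (Matrix.SpecialLinearGroup.toGL g) z := rfl

theorem mobDen_ne_zero (g : SL(2, ℝ)) (z : ℍ) : mobDen g z ≠ 0 :=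
  UpperHalfPlane.denom_ne_zero (Matrix.SpecialLinearGroup.toGL g) z

theorem coe_smul_eq (g : SL(2, ℝ)) (z : ℍ) :
    ((g • z : ℍ) : ℂ) = ((g 0 0 : ℂ) * z + (g 0 1 : ℂ)) / mobDen g z := by
  simpa [mobDen] using UpperHalfPlane.coe_specialLinearGroup_apply g z

theorem im_smul_eq (g : SL(2, ℝ)) (z : ℍ) : (g • z).im = z.im / ‖mobDen g z‖ ^ 2 := by
  have h := UpperHalfPlane.moebius_im (Matrix.SpecialLinearGroup.toGL g) z
  rw [Complex.normSq_eq_norm_sq, ← mobDen_eq] at h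
  rw [← UpperHalfPlane.coe_im, coe_smul_eq]
  refine h.trans ?_
  simp

theorem mobDen_mul (g h : SL(2, ℝ)) (z : ℍ) :
    mobDen (g * h) z = mobDen g (h • z) * mobDen h z := by
  have hne := mobDen_ne_zero h z
  conv_rhs => rw [mobDen, coe_smul_eq]
  field_simp
  simp only [mobDen, Matrix.SpecialLinearGroup.coe_mul, Matrix.mul_apply, Fin.sum_univ_two]
  push_cast
  ring

/-- `SL(2, ℝ)` acts on `T¹ℍ` by the differentials of its Möbius transformations. -/
instance : MulAction SL(2, ℝ) UnitTangentPlane where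
  smul g p := ⟨(g • p.base, p.vec / mobDen g p.base ^ 2), by
    simp [norm_vec, im_smul_eq]⟩
  one_smul p := by
    refine UnitTangentPlane.ext (one_smul _ p.base) ?_
    change p.vec / mobDen 1 p.base ^ 2 = p.vec
    simp [mobDen]
  mul_smul g h p := by
    refine UnitTangentPlane.ext (mul_smul g h p.base) ?_
    change p.vec / mobDen (g * h) p.base ^ 2 =
      p.vec / mobDen h p.base ^ 2 / mobDen g (h • p.base) ^ 2
    rw [mobDen_mul, mul_pow, div_div, mul_comm]

theorem base_smul (g : SL(2, ℝ)) (p : UnitTangentPlane) : (g • p).base = g • p.base := rfl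

theorem vec_smul (g : SL(2, ℝ)) (p : UnitTangentPlane) :
    (g • p).vec = p.vec / mobDen g p.base ^ 2 := rfl

/-- The auxiliary factor `cosh (t/2) + i (v / im z) sinh (t/2)`. -/
def flowDen (t : ℝ) (p : UnitTangentPlane) : ℂ :=
  (Real.cosh (t / 2) : ℂ) + Complex.I * (p.vec / (p.base.im : ℂ)) * (Real.sinh (t / 2) : ℂ)

theorem normSq_vec (p : UnitTangentPlane) : p.vec.re ^ 2 + p.vec.im ^ 2 = p.base.im ^ 2 := by
  rw [← p.norm_vec, ← Complex.normSq_eq_norm_sq, Complex.normSq_apply]; ring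

theorem flowDen_re (t : ℝ) (p : UnitTangentPlane) : (flowDen t p).re =
    Real.cosh (t / 2) - p.vec.im / p.base.im * Real.sinh (t / 2) := by
  simp [flowDen, Complex.div_ofReal_re, Complex.div_ofReal_im, -Complex.ofReal_cosh, -Complex.ofReal_sinh]
  ring

theorem flowDen_im (t : ℝ) (p : UnitTangentPlane) : (flowDen t p).im =
    p.vec.re / p.base.im * Real.sinh (t / 2) := by
  simp [flowDen, Complex.div_ofReal_re, Complex.div_ofReal_im, -Complex.ofReal_cosh,
    -Complex.ofReal_sinh]

theorem norm_flowDen_sq (t : ℝ) (p : UnitTangentPlane) : ‖flowDen t p‖ ^ 2 =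
    Real.cosh (t / 2) ^ 2 + Real.sinh (t / 2) ^ 2
      - 2 * (p.vec.im / p.base.im) * Real.cosh (t / 2) * Real.sinh (t / 2) := by
  rw [← Complex.normSq_eq_norm_sq, Complex.normSq_apply, flowDen_re, flowDen_im]
  have hy := p.base.im_pos.ne'
  have h := normSq_vec p
  field_simp
  linear_combination Real.sinh (t / 2) ^ 2 * h

theorem flowDen_ne_zero (t : ℝ) (p : UnitTangentPlane) : flowDen t p ≠ 0 := by
  intro h
  have h1 : (Real.cosh (t / 2) : ℂ) =
      -(Complex.I * (p.vec / (p.base.im : ℂ)) * (Real.sinh (t / 2) : ℂ)) :=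
    eq_neg_of_add_eq_zero_left h
  have hy := p.base.im_pos
  have h2 := congrArg norm h1
  rw [norm_neg, norm_mul, norm_mul, norm_div, Complex.norm_I, p.norm_vec, Complex.norm_real,
    Complex.norm_real, Complex.norm_real, Real.norm_eq_abs, Real.norm_eq_abs, Real.norm_eq_abs,
    abs_of_pos hy, div_self hy.ne', one_mul, one_mul] at h2
  have h3 := Real.cosh_sq (t / 2)
  rw [← sq_abs, h2, sq_abs] at h3
  linarith

theorem flow_im (t : ℝ) (p : UnitTangentPlane) :
    ((p.base : ℂ) + 2 * p.vec * (Real.sinh (t / 2) : ℂ) / flowDen t p).im =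
      p.base.im / ‖flowDen t p‖ ^ 2 := by
  have hD : ‖flowDen t p‖ ^ 2 ≠ 0 := pow_ne_zero 2 (norm_ne_zero_iff.2 (flowDen_ne_zero t p))
  have hy := p.base.im_pos.ne'
  have h := normSq_vec p
  have hc := Real.cosh_sq (t / 2)
  rw [Complex.add_im, Complex.div_im, Complex.normSq_eq_norm_sq, Complex.mul_im, Complex.mul_re,
    Complex.ofReal_re, Complex.ofReal_im, flowDen_re, flowDen_im, Complex.mul_re, Complex.mul_im]
  have e1 : ((Real.sinh (t / 2) : ℝ) : ℂ).im = 0 := Complex.ofReal_im _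
  have e2 : ((2 : ℂ) * p.vec).re = 2 * p.vec.re := by simp
  simp only [Complex.re_ofNat, Complex.im_ofNat, UpperHalfPlane.coe_im, e1, e2]
  have hN : ‖flowDen t p‖ ^ 2 * p.base.im =
      (Real.cosh (t / 2) ^ 2 + Real.sinh (t / 2) ^ 2) * p.base.im
      - 2 * p.vec.im * Real.cosh (t / 2) * Real.sinh (t / 2) := by
    rw [norm_flowDen_sq]; field_simp
  generalize ‖flowDen t p‖ ^ 2 = N at hD hN
  field_simp
  linear_combination p.base.im * hN - 2 * Real.sinh (t / 2) ^ 2 * h + p.base.im ^ 2 * hc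

/-- The geodesic flow of `ℍ`, in closed form: the vector `(z, v)` is moved along the unit speed
geodesic with initial point `z` and initial velocity `v`, see `hasDerivAt_geodesicLine` and
`isometry_geodesicLine` below. -/
def planeFlow (t : ℝ) (p : UnitTangentPlane) : UnitTangentPlane :=
  ⟨(⟨(p.base : ℂ) + 2 * p.vec * (Real.sinh (t / 2) : ℂ) / flowDen t p, by
      rw [flow_im]
      exact div_pos p.base.im_pos (pow_pos (norm_pos_iff.2 (flowDen_ne_zero t p)) 2)⟩,
    p.vec / flowDen t p ^ 2), by
    rw [norm_div, norm_pow, norm_vec]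
    exact (flow_im t p).symm⟩

theorem coe_base_planeFlow (t : ℝ) (p : UnitTangentPlane) : ((planeFlow t p).base : ℂ) =
    (p.base : ℂ) + 2 * p.vec * (Real.sinh (t / 2) : ℂ) / flowDen t p := rfl

theorem vec_planeFlow (t : ℝ) (p : UnitTangentPlane) :
    (planeFlow t p).vec = p.vec / flowDen t p ^ 2 := rfl

theorem im_planeFlow (t : ℝ) (p : UnitTangentPlane) :
    (planeFlow t p).base.im = p.base.im / ‖flowDen t p‖ ^ 2 := flow_im t p

/-- The geodesic `ℝ → ℍ` with initial velocity `p`. -/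
def geodesicLine (p : UnitTangentPlane) (t : ℝ) : ℍ := (planeFlow t p).base

theorem planeFlow_zero (p : UnitTangentPlane) : planeFlow 0 p = p := by
  refine UnitTangentPlane.ext (UpperHalfPlane.ext ?_) ?_
  · rw [coe_base_planeFlow]; simp
  · rw [vec_planeFlow]; simp [flowDen]

/-- `planeFlow t p` is the velocity vector at time `t` of the geodesic with initial
velocity `p`. -/
theorem hasDerivAt_geodesicLine (p : UnitTangentPlane) (t : ℝ) :
    HasDerivAt (fun s => (geodesicLine p s : ℂ)) (planeFlow t p).vec t := by
  have hD := flowDen_ne_zero t p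
  have hs : HasDerivAt (fun s : ℝ => ((Real.sinh (s / 2) : ℝ) : ℂ))
      ((Real.cosh (t / 2) * (1 / 2) : ℝ) : ℂ) t :=
    HasDerivAt.ofReal_comp (f := fun s : ℝ => Real.sinh (s / 2))
      (HasDerivAt.comp (h₂ := Real.sinh) (h := fun s : ℝ => s / 2) t
        (Real.hasDerivAt_sinh (t / 2)) ((hasDerivAt_id t).div_const 2))
  have hc : HasDerivAt (fun s : ℝ => ((Real.cosh (s / 2) : ℝ) : ℂ))
      ((Real.sinh (t / 2) * (1 / 2) : ℝ) : ℂ) t :=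
    HasDerivAt.ofReal_comp (f := fun s : ℝ => Real.cosh (s / 2))
      (HasDerivAt.comp (h₂ := Real.cosh) (h := fun s : ℝ => s / 2) t
        (Real.hasDerivAt_cosh (t / 2)) ((hasDerivAt_id t).div_const 2))
  have h1 := (((hs.const_mul (2 * p.vec)).div
    (hc.add (hs.const_mul (Complex.I * (p.vec / (p.base.im : ℂ))))) hD)).const_add (p.base : ℂ)
  refine h1.congr_deriv ?_
  change _ = p.vec / flowDen t p ^ 2
  change (_ * flowDen t p - _) / flowDen t p ^ 2 = _
  congr 1
  have hcs : (Real.cosh (t / 2) : ℂ) ^ 2 = (Real.sinh (t / 2) : ℂ) ^ 2 + 1 := by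
    exact_mod_cast Real.cosh_sq (t / 2)
  rw [flowDen]
  push_cast only [Complex.ofReal_mul, Complex.ofReal_div, Complex.ofReal_one, Complex.ofReal_ofNat]
  linear_combination p.vec * hcs

/-- The flow lines are parametrised by arc length and minimise length globally. -/
theorem isometry_geodesicLine (p : UnitTangentPlane) : Isometry (geodesicLine p) := by
  refine Isometry.of_dist_eq fun s t => ?_
  have hs := flowDen_ne_zero s p
  have ht := flowDen_ne_zero t p
  have hy := p.base.im_pos
  have hsub : (geodesicLine p s : ℂ) - geodesicLine p t =
      2 * p.vec * (Real.sinh ((s - t) / 2) : ℂ) / (flowDen s p * flowDen t p) := by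
    change ((planeFlow s p).base : ℂ) - ((planeFlow t p).base : ℂ) = _
    rw [coe_base_planeFlow, coe_base_planeFlow]
    field_simp
    have : (Real.sinh ((s - t) / 2) : ℂ) = Real.sinh (s / 2) * Real.cosh (t / 2)
        - Real.cosh (s / 2) * Real.sinh (t / 2) := by
      rw [sub_div, Real.sinh_sub]; push_cast only [Complex.ofReal_mul, Complex.ofReal_sub]
    rw [this, flowDen, flowDen]
    ring
  have hcosh : Real.cosh (dist (geodesicLine p s) (geodesicLine p t)) = Real.cosh (s - t) := by
    rw [UpperHalfPlane.cosh_dist, dist_eq_norm, hsub]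
    change 1 + _ / (2 * (planeFlow s p).base.im * (planeFlow t p).base.im) = _
    rw [im_planeFlow, im_planeFlow, norm_div, norm_mul, norm_mul, norm_mul, norm_vec,
      Complex.norm_real, Real.norm_eq_abs, Complex.norm_ofNat, div_pow, mul_pow, mul_pow, sq_abs]
    have hs' : ‖flowDen s p‖ ≠ 0 := norm_ne_zero_iff.2 hs
    have ht' : ‖flowDen t p‖ ≠ 0 := norm_ne_zero_iff.2 ht
    have h2 : Real.cosh (s - t) = 1 + 2 * Real.sinh ((s - t) / 2) ^ 2 := by
      have h3 := Real.cosh_two_mul ((s - t) / 2)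
      rw [Real.cosh_sq, mul_div_cancel₀ _ two_ne_zero] at h3
      rw [h3]; ring
    rw [h2]
    field_simp
  rw [Real.dist_eq, ← abs_of_nonneg (dist_nonneg (x := geodesicLine p s) (y := geodesicLine p t))]
  exact le_antisymm (Real.cosh_le_cosh.1 hcosh.le) (Real.cosh_le_cosh.1 hcosh.ge)

/-- The geodesic flow commutes with isometries. -/
theorem planeFlow_smul (t : ℝ) (g : SL(2, ℝ)) (p : UnitTangentPlane) :
    planeFlow t (g • p) = g • planeFlow t p := by
  have hj := mobDen_ne_zero g p.base
  have hj' : (starRingEnd ℂ) (mobDen g p.base) ≠ 0 := (map_ne_zero _).2 hj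
  have hD := flowDen_ne_zero t p
  have hD' := flowDen_ne_zero t (g • p)
  have hy : (p.base.im : ℂ) ≠ 0 := by exact_mod_cast p.base.im_pos.ne'
  have hconj : (starRingEnd ℂ) (mobDen g p.base) =
      mobDen g p.base - 2 * Complex.I * (g 1 0 : ℂ) * p.base.im := by
    apply Complex.ext
    · simp [mobDen]
    · simp [mobDen]; ring
  have hdet : (g 0 0 : ℂ) * (g 1 1 : ℂ) - (g 0 1 : ℂ) * (g 1 0 : ℂ) = 1 := by
    have := g.det_coe
    rw [Matrix.det_fin_two] at this
    exact_mod_cast this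
  -- the factor of the image vector
  have hflow : flowDen t (g • p) * mobDen g p.base =
      mobDen g (planeFlow t p).base * flowDen t p := by
    have h1 : ((g • p).base.im : ℂ) =
        p.base.im / (mobDen g p.base * (starRingEnd ℂ) (mobDen g p.base)) := by
      rw [Complex.mul_conj, Complex.normSq_eq_norm_sq, base_smul, im_smul_eq]
      push_cast; rfl
    have h2 : mobDen g (planeFlow t p).base = mobDen g p.base
        + (g 1 0 : ℂ) * (2 * p.vec * (Real.sinh (t / 2) : ℂ) / flowDen t p) := by
      simp only [mobDen, coe_base_planeFlow]; ring
    have h3 : flowDen t (g • p) * mobDen g p.base = Real.cosh (t / 2) * mobDen g p.base +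
        Complex.I * p.vec / p.base.im * (starRingEnd ℂ) (mobDen g p.base) *
          Real.sinh (t / 2) := by
      rw [flowDen, vec_smul, h1]
      field_simp
    rw [h2, h3, add_mul, mul_assoc (g 1 0 : ℂ), div_mul_cancel₀ _ hD, hconj, flowDen]
    field_simp
    linear_combination (-2 * p.vec * p.base.im * (g 1 0 : ℂ) * Real.sinh (t / 2)) * Complex.I_sq
  have hjt := mobDen_ne_zero g (planeFlow t p).base
  refine UnitTangentPlane.ext (UpperHalfPlane.ext ?_) ?_
  · rw [base_smul, coe_smul_eq, coe_base_planeFlow, base_smul, coe_smul_eq, vec_smul]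
    have hD'' : flowDen t (g • p) =
        mobDen g (planeFlow t p).base * flowDen t p / mobDen g p.base := by
      rw [← hflow, mul_div_cancel_right₀ _ hj]
    have h4 : ((planeFlow t p).base : ℂ) - p.base =
        2 * p.vec * (Real.sinh (t / 2) : ℂ) / flowDen t p := by
      rw [coe_base_planeFlow]; ring
    have h5 : 2 * (p.vec / mobDen g p.base ^ 2) * (Real.sinh (t / 2) : ℂ) / flowDen t (g • p) =
        (((planeFlow t p).base : ℂ) - p.base) /
          (mobDen g p.base * mobDen g (planeFlow t p).base) := by
      rw [h4, hD'']
      field_simp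
    rw [h5]
    field_simp
    simp only [mobDen]
    linear_combination (((p.base : ℂ)) - (planeFlow t p).base) * hdet
  · rw [vec_smul, vec_planeFlow, vec_smul, vec_planeFlow, div_div, div_div, ← mul_pow, ← mul_pow,
      mul_comm, hflow, mul_comm (flowDen t p)]

/-! ### Closed hyperbolic surfaces -/

/-- `Γ` acts on `ℍ` as the group of covering transformations of a closed orientable hyperbolic
surface: the action is properly discontinuous, free (an element of `Γ` with a fixed point acts
trivially, so that `-1 ∈ Γ` is allowed) and cocompact. Every such surface is `Γ \ ℍ` for such a
group `Γ` of orientation preserving isometries of `ℍ`. -/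
structure IsClosedSurfaceGroup (Γ : Subgroup SL(2, ℝ)) : Prop where
  properlyDiscontinuous : ProperlyDiscontinuousSMul Γ ℍ
  free : ∀ (g : Γ) (z : ℍ), g • z = z → ∀ w : ℍ, g • w = w
  cocompact : CompactSpace (Quotient (MulAction.orbitRel Γ ℍ))

/-- The surface `S = Γ \ ℍ`, with the quotient topology and its Borel `σ`-algebra. -/
def Surface (Γ : Subgroup SL(2, ℝ)) : Type := Quotient (MulAction.orbitRel Γ ℍ)

instance (Γ : Subgroup SL(2, ℝ)) : TopologicalSpace (Surface Γ) :=
  inferInstanceAs (TopologicalSpace (Quotient (MulAction.orbitRel Γ ℍ)))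

instance (Γ : Subgroup SL(2, ℝ)) : MeasurableSpace (Surface Γ) := borel _

instance (Γ : Subgroup SL(2, ℝ)) : BorelSpace (Surface Γ) := ⟨rfl⟩

/-- The covering projection `ℍ → S`. -/
def proj (Γ : Subgroup SL(2, ℝ)) (z : ℍ) : Surface Γ := Quotient.mk (MulAction.orbitRel Γ ℍ) z

/-- The unit tangent bundle `T¹S = Γ \ T¹ℍ`, with the quotient topology and its Borel
`σ`-algebra. -/
def UnitTangent (Γ : Subgroup SL(2, ℝ)) : Type :=
  Quotient (MulAction.orbitRel Γ UnitTangentPlane)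

instance (Γ : Subgroup SL(2, ℝ)) : TopologicalSpace (UnitTangent Γ) :=
  inferInstanceAs (TopologicalSpace (Quotient (MulAction.orbitRel Γ UnitTangentPlane)))

instance (Γ : Subgroup SL(2, ℝ)) : MeasurableSpace (UnitTangent Γ) := borel _

instance (Γ : Subgroup SL(2, ℝ)) : BorelSpace (UnitTangent Γ) := ⟨rfl⟩

/-- The projection `T¹ℍ → T¹S`, that is, the differential of `proj Γ`. -/
def tproj (Γ : Subgroup SL(2, ℝ)) (p : UnitTangentPlane) : UnitTangent Γ :=
  Quotient.mk (MulAction.orbitRel Γ UnitTangentPlane) p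

/-- The geodesic flow on `T¹S`. The geodesic `γ : ℝ → S` with `γ'(0) = v` has the velocity
`γ'(t) = geodesicFlow Γ t v` at time `t`. -/
def geodesicFlow (Γ : Subgroup SL(2, ℝ)) (t : ℝ) : UnitTangent Γ → UnitTangent Γ :=
  Quotient.map (sa := MulAction.orbitRel Γ UnitTangentPlane)
    (sb := MulAction.orbitRel Γ UnitTangentPlane) (planeFlow t) (by
      rintro _ q ⟨g, rfl⟩
      exact ⟨g, (planeFlow_smul t g q).symm⟩)

theorem geodesicFlow_tproj (Γ : Subgroup SL(2, ℝ)) (t : ℝ) (p : UnitTangentPlane) :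
    geodesicFlow Γ t (tproj Γ p) = tproj Γ (planeFlow t p) := rfl

/-! ### The preferred lift of a homeomorphism isotopic to the identity -/

/-- `f` is isotopic to the identity, i.e. `f ∈ Homeo₀(S)`. -/
def IsIsotopicToId {X : Type*} [TopologicalSpace X] (f : X ≃ₜ X) : Prop :=
  ∃ H : I → (X ≃ₜ X), Continuous (fun p : I × X => H p.1 p.2) ∧ H 0 = Homeomorph.refl X ∧ H 1 = f

/-- `F` is a lift of `f` to `ℍ` which commutes with all covering transformations. -/
def IsPreferredLift (Γ : Subgroup SL(2, ℝ)) (f : Surface Γ ≃ₜ Surface Γ) (F : ℍ ≃ₜ ℍ) : Prop :=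
  (∀ z, proj Γ (F z) = f (proj Γ z)) ∧ ∀ (g : Γ) (z : ℍ), F (g • z) = g • F z

theorem isCoveringMap_proj {Γ : Subgroup SL(2, ℝ)} (hΓ : IsClosedSurfaceGroup Γ) :
    IsCoveringMap (proj Γ) := by
  have := hΓ.properlyDiscontinuous
  let D : Subgroup (Equiv.Perm ℍ) := (MulAction.toPermHom Γ ℍ).range
  have hD : ∀ d : D, ∃ g : Γ, ∀ z : ℍ, d • z = g • z := by
    rintro ⟨_, g, rfl⟩
    exact ⟨g, fun z => rfl⟩
  have hg : ∀ g : Γ, ∃ d : D, ∀ z : ℍ, d • z = g • z := fun g => ⟨⟨_, g, rfl⟩, fun z => rfl⟩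
  have : ContinuousConstSMul Γ ℍ := ⟨fun g => continuous_const_smul (g : SL(2, ℝ))⟩
  have : ContinuousConstSMul D ℍ := ⟨fun d => by
    obtain ⟨g, h⟩ := hD d
    simpa only [h] using continuous_const_smul g⟩
  have : IsCancelSMul D ℍ := isCancelSMul_iff_eq_one_of_smul_eq.mpr fun d z hz => by
    obtain ⟨g, h⟩ := hD d
    rw [h] at hz
    refine Subtype.ext (Equiv.ext fun w => ?_)
    exact (h w).trans (hΓ.free g z hz w)
  have : ProperlyDiscontinuousSMul D ℍ := ⟨fun {K L} hK hL => by
    refine ((finite_disjoint_inter_image (Γ := Γ) hK hL).image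
      (fun g => (⟨_, g, rfl⟩ : D))).subset ?_
    rintro ⟨_, g, rfl⟩ hd
    exact ⟨g, hd, rfl⟩⟩
  have hq : IsQuotientMap (proj Γ) := isQuotientMap_quotient_mk'
  refine (hq.isQuotientCoveringMap_of_properlyDiscontinuousSMul (G := D) ?_).isCoveringMap
  intro z w
  refine (Quotient.eq'' (s₁ := MulAction.orbitRel Γ ℍ)).trans ?_
  constructor
  · rintro ⟨g, rfl⟩
    obtain ⟨d, h⟩ := hg g
    exact ⟨d, h w⟩
  · rintro ⟨d, rfl⟩
    obtain ⟨g, h⟩ := hD d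
    exact ⟨g, (h w).symm⟩

theorem proj_smul (Γ : Subgroup SL(2, ℝ)) (g : Γ) (z : ℍ) : proj Γ (g • z) = proj Γ z :=
  Quotient.sound' (s₁ := MulAction.orbitRel Γ ℍ) ⟨g, rfl⟩

/-- Homeomorphisms isotopic to the identity have a preferred lift: the time one map of the lift,
starting at the identity of `ℍ`, of the isotopy. -/
theorem exists_isPreferredLift {Γ : Subgroup SL(2, ℝ)} (hΓ : IsClosedSurfaceGroup Γ)
    {f : Surface Γ ≃ₜ Surface Γ} (hf : IsIsotopicToId f) : ∃ F, IsPreferredLift Γ f F := by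
  have cov := isCoveringMap_proj hΓ
  have := hΓ.properlyDiscontinuous
  have : CompactSpace (Surface Γ) := hΓ.cocompact
  have : ContinuousConstSMul Γ ℍ := ⟨fun g => continuous_const_smul (g : SL(2, ℝ))⟩
  have : T2Space (Surface Γ) := inferInstanceAs (T2Space (Quotient (MulAction.orbitRel Γ ℍ)))
  obtain ⟨H, hH, H0, H1⟩ := hf
  -- the inverse isotopy is continuous
  have hH' : Continuous (fun p : I × Surface Γ => (H p.1).symm p.2) := by
    let e : I × Surface Γ ≃ I × Surface Γ :=
      { toFun := fun p => (p.1, H p.1 p.2)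
        invFun := fun p => (p.1, (H p.1).symm p.2)
        left_inv := fun p => by simp
        right_inv := fun p => by simp }
    have he : Continuous e := continuous_fst.prodMk hH
    exact continuous_snd.comp (he.homeoOfEquivCompactToT2 (f := e)).symm.continuous
  let A : C(I × ℍ, Surface Γ) :=
    ⟨fun p => H p.1 (proj Γ p.2), hH.comp (continuous_fst.prodMk (cov.continuous.comp continuous_snd))⟩
  let B : C(I × ℍ, Surface Γ) :=
    ⟨fun p => (H p.1).symm (proj Γ p.2),
      hH'.comp (continuous_fst.prodMk (cov.continuous.comp continuous_snd))⟩
  have hA0 : ∀ z, A (0, z) = proj Γ (ContinuousMap.id ℍ z) := fun z => by simp [A, H0]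
  have hB0 : ∀ z, B (0, z) = proj Γ (ContinuousMap.id ℍ z) := fun z => by simp [B, H0]
  let a := cov.liftHomotopy A (.id ℍ) hA0
  let b := cov.liftHomotopy B (.id ℍ) hB0
  have ha : ∀ t z, proj Γ (a (t, z)) = H t (proj Γ z) := fun t z =>
    congrFun (cov.liftHomotopy_lifts A (.id ℍ) hA0) (t, z)
  have hb : ∀ t z, proj Γ (b (t, z)) = (H t).symm (proj Γ z) := fun t z =>
    congrFun (cov.liftHomotopy_lifts B (.id ℍ) hB0) (t, z)
  have ha0 : ∀ z, a (0, z) = z := fun z => cov.liftHomotopy_zero A (.id ℍ) hA0 z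
  have hb0 : ∀ z, b (0, z) = z := fun z => cov.liftHomotopy_zero B (.id ℍ) hB0 z
  -- paths with the same projection and the same starting point coincide
  have uniq : ∀ u v : I → ℍ, Continuous u → Continuous v →
      (∀ t, proj Γ (u t) = proj Γ (v t)) → u 0 = v 0 → u 1 = v 1 := by
    intro u v hu hv h h0
    exact congrFun (cov.eq_of_comp_eq hu hv (funext h) 0 h0) 1
  have cont : ∀ (c : C(I × ℍ, ℍ)) (u : I → ℍ), Continuous u → Continuous fun t => c (t, u t) :=
    fun c u hu => c.continuous.comp (continuous_id.prodMk hu)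
  let F : ℍ ≃ₜ ℍ :=
    { toFun := fun z => a (1, z)
      invFun := fun z => b (1, z)
      left_inv := fun z => uniq (fun t => b (t, a (t, z))) (fun _ => z)
        (cont b _ (cont a _ continuous_const)) continuous_const
        (fun t => by rw [hb, ha, Homeomorph.symm_apply_apply]) (by simp only [ha0, hb0])
      right_inv := fun z => uniq (fun t => a (t, b (t, z))) (fun _ => z)
        (cont a _ (cont b _ continuous_const)) continuous_const
        (fun t => by rw [ha, hb, Homeomorph.apply_symm_apply]) (by simp only [ha0, hb0])
      continuous_toFun := a.continuous.comp (continuous_const.prodMk continuous_id)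
      continuous_invFun := b.continuous.comp (continuous_const.prodMk continuous_id) }
  refine ⟨F, fun z => ?_, fun g z => ?_⟩
  · change proj Γ (a (1, z)) = _
    rw [ha, H1]
  · exact uniq (fun t => a (t, g • z)) (fun t => g • a (t, z)) (cont a _ continuous_const)
      ((continuous_const_smul g).comp (cont a _ continuous_const))
      (fun t => by rw [proj_smul, ha, ha, proj_smul]) (by simp only [ha0])

/-- The preferred lift `F` of `f ∈ Homeo₀(S)` to `ℍ`: the (unique) lift which commutes with all
covering transformations. -/
def preferredLift {Γ : Subgroup SL(2, ℝ)} (hΓ : IsClosedSurfaceGroup Γ)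
    {f : Surface Γ ≃ₜ Surface Γ} (hf : IsIsotopicToId f) : ℍ ≃ₜ ℍ :=
  (exists_isPreferredLift hΓ hf).choose

theorem isPreferredLift_preferredLift {Γ : Subgroup SL(2, ℝ)} (hΓ : IsClosedSurfaceGroup Γ)
    {f : Surface Γ ≃ₜ Surface Γ} (hf : IsIsotopicToId f) :
    IsPreferredLift Γ f (preferredLift hΓ hf) :=
  (exists_isPreferredLift hΓ hf).choose_spec

/-! ### Rotation speed and tracking geodesics

In this section `F` stands for the preferred lift of a homeomorphism `f` of `S`. -/

/-- The rotation distance `L_n(x)`, expressed through a lift `z` of `x`. -/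
def rotationDist (F : ℍ ≃ₜ ℍ) (n : ℕ) (z : ℍ) : ℝ := dist z (F^[n] z)

/-- The point `x` has rotation speed `s`: both `L_n(x) / n` and `L_n(f⁻ⁿ(x)) / n` tend to `s`. -/
def HasRotationSpeed (Γ : Subgroup SL(2, ℝ)) (F : ℍ ≃ₜ ℍ) (x : Surface Γ) (s : ℝ) : Prop :=
  ∀ z : ℍ, proj Γ z = x →
    Tendsto (fun n : ℕ => rotationDist F n z / n) atTop (𝓝 s) ∧
    Tendsto (fun n : ℕ => rotationDist F n (F.symm^[n] z) / n) atTop (𝓝 s)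

/-- The geodesic of `ℍ` with initial velocity `p`, run at speed `s`, tracks the orbit of `z`. -/
def Tracks (F : ℍ ≃ₜ ℍ) (s : ℝ) (z : ℍ) (p : UnitTangentPlane) : Prop :=
  Tendsto (fun n : ℕ => dist (F^[n] z) (geodesicLine p (n * s)) / n) atTop (𝓝 0) ∧
  Tendsto (fun n : ℕ => dist (F.symm^[n] z) (geodesicLine p (-(n * s))) / n) atTop (𝓝 0)

/-- The geodesic of `S` with initial velocity `v` is a tracking geodesic of the point `x`: the
rotation speed `s` of `x` exists and is positive, and for every lift `z` of `x` there is a lift of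
the geodesic which tracks the orbit of `z`. The lifts of the geodesic are the geodesics of `ℍ`
whose initial velocity projects to `v`. -/
def IsTrackingGeodesic (Γ : Subgroup SL(2, ℝ)) (F : ℍ ≃ₜ ℍ) (x : Surface Γ)
    (v : UnitTangent Γ) : Prop :=
  ∃ s : ℝ, 0 < s ∧ HasRotationSpeed Γ F x s ∧
    ∀ z : ℍ, proj Γ z = x → ∃ p : UnitTangentPlane, tproj Γ p = v ∧ Tracks F s z p

/-- A tracking geodesic is normalized if its time `0` point is, for suitable lifts as in the
tracking condition, the point of the lifted geodesic which is closest to the lift of `x`. -/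
def IsNormalizedTrackingGeodesic (Γ : Subgroup SL(2, ℝ)) (F : ℍ ≃ₜ ℍ) (x : Surface Γ)
    (v : UnitTangent Γ) : Prop :=
  IsTrackingGeodesic Γ F x v ∧
    ∃ (s : ℝ) (z : ℍ) (p : UnitTangentPlane), HasRotationSpeed Γ F x s ∧
      proj Γ z = x ∧ tproj Γ p = v ∧ Tracks F s z p ∧
      dist z (geodesicLine p 0) = Metric.infDist z (Set.range (geodesicLine p))

/-- `μ` is an ergodic `f`-invariant Borel probability measure with positive rotation speed, where
`F` is the preferred lift of `f`. -/
def IsErgodicWithPositiveSpeed (Γ : Subgroup SL(2, ℝ)) (f : Surface Γ ≃ₜ Surface Γ) (F : ℍ ≃ₜ ℍ)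
    (μ : Measure (Surface Γ)) : Prop :=
  IsProbabilityMeasure μ ∧ Ergodic f μ ∧ ∃ s : ℝ, 0 < s ∧ ∀ᵐ x ∂μ, HasRotationSpeed Γ F x s

/-! ### Equidistribution and ergodicity for the geodesic flow -/

/-- The geodesic with initial velocity `v` equidistributes to `ν`, forward and backward. -/
def Equidistributes (Γ : Subgroup SL(2, ℝ)) (v : UnitTangent Γ) (ν : Measure (UnitTangent Γ)) :
    Prop :=
  ∀ φ : C(UnitTangent Γ, ℝ),
    Tendsto (fun T : ℝ => T⁻¹ * ∫ t in (0 : ℝ)..T, φ (geodesicFlow Γ t v)) atTop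
      (𝓝 (∫ w, φ w ∂ν)) ∧
    Tendsto (fun T : ℝ => T⁻¹ * ∫ t in (-T)..(0 : ℝ), φ (geodesicFlow Γ t v)) atTop
      (𝓝 (∫ w, φ w ∂ν))

/-- `ν` is invariant under the geodesic flow. -/
def IsFlowInvariant (Γ : Subgroup SL(2, ℝ)) (ν : Measure (UnitTangent Γ)) : Prop :=
  ∀ t : ℝ, MeasurePreserving (geodesicFlow Γ t) ν ν

/-- Borel sets invariant under the geodesic flow are null or conull for `ν`. -/
def IsFlowErgodic (Γ : Subgroup SL(2, ℝ)) (ν : Measure (UnitTangent Γ)) : Prop :=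
  ∀ A : Set (UnitTangent Γ), MeasurableSet A → (∀ t : ℝ, geodesicFlow Γ t ⁻¹' A = A) →
    ν A = 0 ∨ ν Aᶜ = 0

end HypSurface

end

open HypSurface

/-! Geometry. The preferred lift `F` commutes with the cocompact group `Γ`, so it moves points by at
most a constant `C`, and for almost every point the orbit of a lift `z` has bounded jumps and
distance from `z` growing like `s * n`, with `s > 0`. The hyperbolic law of cosines
(`cosh_dist_geodesicLine`) then makes the directions from `z` to the orbit points converge
exponentially fast, and the limiting ray stays at distance `o(n)` from the orbit
(`tendsto_dist_geodesicLine_div`). The same holds backward. Almost surely the two rays differ: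
otherwise the points at times `n` and `-n` would be `o(n)` apart, whereas by invariance of `μ` their
mean distance is about `2 * s * n` (`ae_ne_of_tendsto`). The geodesic joining the two end points
then tracks the whole orbit. Two geodesics sublinearly close in both directions agree up to a time
shift (`exists_eq_planeFlow`), so the tracking geodesic is unique up to parametrization.

Dynamics. Normalization selects measurably a unit vector `v x` in `T¹S`. Uniqueness gives `v (f x) =
g (τ x) (v x)`, where `g` is the geodesic flow and `τ` is the displacement along the geodesic, a
bounded function with mean `s`. The flow orbit of `v x` is thus sampled at the Birkhoff sums of `τ`,
and Birkhoff's theorem for `τ` and for the integrals of `φ` over the segments from `v x` to `v (f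
x)` yields almost sure time averages, whose limit is a positive functional of `φ`; Riesz
representation gives `ν` (`Flow.exists_measure_of_cocycle`).

Invariance holds because time averages do not see a shift of the starting point. For ergodicity, `ν`
is dominated by a multiple of the distribution of flow segments of bounded length issued from `v x`;
a flow-invariant set pulls back under `v` to an `f`-invariant set modulo null sets, so it has
measure 0 or 1. The support of `ν` is closed and invariant, hence contains the orbit closure of `v
x` for almost every `x`; conversely, an orbit that equidistributes to `ν` is dense in the support.
-/

/-! ### The pointwise ergodic theorem for bounded functions -/

section Birkhoff

variable {X : Type*} {f : X → X}

/-- The maximum of `S₁ψ, …, Sₙ₊₁ψ`. -/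
noncomputable def maxBirkhoffSum (f : X → X) (ψ : X → ℝ) : ℕ → X → ℝ
  | 0 => ψ
  | n + 1 => fun x => ψ x + max 0 (maxBirkhoffSum f ψ n (f x))

theorem maxBirkhoffSum_mono (f : X → X) (ψ : X → ℝ) (n : ℕ) (x : X) :
    maxBirkhoffSum f ψ n x ≤ maxBirkhoffSum f ψ (n + 1) x := by
  induction n generalizing x with
  | zero => simp [maxBirkhoffSum]
  | succ n ih =>
    simp only [maxBirkhoffSum]
    gcongr
    exact ih (f x)

theorem birkhoffSum_le_maxBirkhoffSum (f : X → X) (ψ : X → ℝ) (n : ℕ) (x : X) :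
    birkhoffSum f ψ (n + 1) x ≤ maxBirkhoffSum f ψ n x := by
  induction n generalizing x with
  | zero => simp [maxBirkhoffSum]
  | succ n ih =>
    rw [birkhoffSum_succ']
    simp only [maxBirkhoffSum]
    gcongr
    exact (ih (f x)).trans (le_max_right _ _)

theorem abs_maxBirkhoffSum_le {ψ : X → ℝ} {B : ℝ} (hB : ∀ x, |ψ x| ≤ B) (n : ℕ) (x : X) :
    |maxBirkhoffSum f ψ n x| ≤ (n + 1) * B := by
  have hB0 : 0 ≤ B := (abs_nonneg _).trans (hB x)
  induction n generalizing x with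
  | zero => simpa [maxBirkhoffSum] using hB x
  | succ n ih =>
    have h1 := abs_le.1 (hB x)
    have h2 := abs_le.1 (ih (f x))
    have h3 : 0 ≤ (n + 1 : ℝ) * B := by positivity
    simp only [maxBirkhoffSum]
    push_cast
    rw [abs_le]
    constructor
    · nlinarith [le_max_left 0 (maxBirkhoffSum f ψ n (f x))]
    · nlinarith [max_le h3 h2.2]

variable [MeasurableSpace X] {μ : Measure X}

theorem Measurable.birkhoffSum {ψ : X → ℝ} (hψ : Measurable ψ) (hf : Measurable f) (n : ℕ) :
    Measurable (birkhoffSum f ψ n) := by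
  unfold _root_.birkhoffSum
  exact Finset.measurable_sum _ fun k _ => hψ.comp (hf.iterate k)

theorem measurable_maxBirkhoffSum {ψ : X → ℝ} (hψ : Measurable ψ) (hf : Measurable f) (n : ℕ) :
    Measurable (maxBirkhoffSum f ψ n) := by
  induction n with
  | zero => exact hψ
  | succ n ih => exact hψ.add (measurable_const.max (ih.comp hf))

/-- If `ψ` has negative mean, its Birkhoff sums are almost everywhere bounded above. -/
theorem Ergodic.ae_exists_birkhoffSum_le [IsProbabilityMeasure μ] (hf : Ergodic f μ) {ψ : X → ℝ}
    (hψ : Measurable ψ) {B : ℝ} (hB : ∀ x, |ψ x| ≤ B) (hneg : ∫ x, ψ x ∂μ < 0) :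
    ∀ᵐ x ∂μ, ∃ K : ℕ, ∀ n, birkhoffSum f ψ n x ≤ K := by
  have hfm := hf.measurable
  set E : Set X := {x | ∀ K : ℕ, ∃ n, (K : ℝ) < birkhoffSum f ψ n x} with hE
  have hEm : MeasurableSet E := by
    have : E = ⋂ K : ℕ, ⋃ n, {x | (K : ℝ) < birkhoffSum f ψ n x} := by
      ext x; simp [hE]
    rw [this]
    exact .iInter fun K => .iUnion fun n =>
      measurableSet_lt measurable_const (hψ.birkhoffSum hfm n)
  have hinv : f ⁻¹' E = E := by
    -- The Birkhoff sums at `x` and at `f x` differ by an index shift and one value of `ψ`; raising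
    -- the threshold by `b ≥ B` absorbs that value.
    obtain ⟨b, hb⟩ := exists_nat_ge B
    ext x
    constructor
    · intro h K
      obtain ⟨n, hn⟩ := h (K + b)
      refine ⟨n + 1, ?_⟩
      rw [birkhoffSum_succ']
      push_cast at hn
      linarith [(abs_le.1 (hB x)).1]
    · intro h K
      obtain ⟨n, hn⟩ := h (K + b)
      rcases n with _ | n
      · have : (0 : ℝ) ≤ K + b := by positivity
        simp at hn
        linarith
      refine ⟨n, ?_⟩
      rw [birkhoffSum_succ'] at hn
      push_cast at hn
      linarith [(abs_le.1 (hB x)).2]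
  rcases hf.toPreErgodic.ae_empty_or_univ hEm hinv with h | h
  · filter_upwards [measure_eq_zero_iff_ae_notMem.1 (ae_eq_empty.1 h)] with x hx
    simpa [hE] using hx
  exfalso
  have hint : ∀ n, Integrable (maxBirkhoffSum f ψ n) μ := fun n =>
    .of_bound (measurable_maxBirkhoffSum hψ hfm n).aestronglyMeasurable ((n + 1) * B)
      (.of_forall fun x => abs_maxBirkhoffSum_le hB n x)
  -- By invariance and monotonicity in `n`, `D n` has nonnegative integral. If the sums were almost
  -- surely unbounded, the maximum at `f x` would eventually be nonnegative, so `D n` would converge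
  -- to `ψ`, whose mean is negative.
  let D : ℕ → X → ℝ := fun n x => maxBirkhoffSum f ψ (n + 1) x - maxBirkhoffSum f ψ n (f x)
  have hD : ∀ n x, D n x = ψ x - min 0 (maxBirkhoffSum f ψ n (f x)) := fun n x => by
    simp only [D, maxBirkhoffSum]
    linarith [min_add_max 0 (maxBirkhoffSum f ψ n (f x))]
  have hpos : ∀ n, 0 ≤ ∫ x, D n x ∂μ := fun n => by
    have h1 : ∫ x, maxBirkhoffSum f ψ n (f x) ∂μ = ∫ x, maxBirkhoffSum f ψ n x ∂μ := by
      have h2 := hf.toMeasurePreserving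
      rw [← integral_map (φ := f) (f := maxBirkhoffSum f ψ n) hfm.aemeasurable
        (measurable_maxBirkhoffSum hψ hfm n).aestronglyMeasurable, h2.map_eq]
    have h3 : Integrable (fun x => maxBirkhoffSum f ψ n (f x)) μ :=
      (hf.toMeasurePreserving.integrable_comp (hint n).aestronglyMeasurable).2 (hint n)
    rw [integral_sub (hint _) h3, h1, sub_nonneg]
    exact integral_mono (hint _) (hint _) fun x => maxBirkhoffSum_mono f ψ n x
  have hlim : Tendsto (fun n => ∫ x, D n x ∂μ) atTop (𝓝 (∫ x, ψ x ∂μ)) := by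
    refine tendsto_integral_of_dominated_convergence (fun _ => 2 * B) (fun n => ?_)
      (integrable_const _) (fun n => .of_forall fun x => ?_) ?_
    · exact ((measurable_maxBirkhoffSum hψ hfm _).sub
        ((measurable_maxBirkhoffSum hψ hfm _).comp hfm)).aestronglyMeasurable
    · rw [hD, Real.norm_eq_abs]
      have h1 := abs_le.1 (hB x)
      -- Domination needs only a lower bound uniform in `n`, and the maxima increase from their
      -- initial value `ψ ≥ -B`.
      have h2 : -B ≤ maxBirkhoffSum f ψ n (f x) :=
        (abs_le.1 (hB (f x))).1.trans (monotone_nat_of_le_succ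
          (f := fun n => maxBirkhoffSum f ψ n (f x))
          (fun n => maxBirkhoffSum_mono f ψ n (f x)) (Nat.zero_le n))
      have h3 : -B ≤ min 0 (maxBirkhoffSum f ψ n (f x)) :=
        le_min (by linarith [(abs_nonneg _).trans (hB x)]) h2
      have h4 := min_le_left 0 (maxBirkhoffSum f ψ n (f x))
      rw [abs_le]
      constructor <;> linarith
    · filter_upwards [eventuallyEq_univ.1 h] with x hx'
      rw [← hinv] at hx'
      obtain ⟨n, hn⟩ := hx' 0
      rcases n with _ | n
      · simp at hn
      refine tendsto_const_nhds.congr' ?_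
      filter_upwards [eventually_ge_atTop n] with m hm
      rw [hD, min_eq_left, sub_zero]
      have h1 := birkhoffSum_le_maxBirkhoffSum f ψ n (f x)
      have h2 := monotone_nat_of_le_succ (f := fun n => maxBirkhoffSum f ψ n (f x))
          (fun n => maxBirkhoffSum_mono f ψ n (f x)) hm
      simp only at h2
      push_cast at hn
      linarith
  exact absurd (ge_of_tendsto' hlim hpos) (not_le.2 hneg)

/-- Subtracting `m + 1 / (j + 1)` from `ψ` makes the mean negative, so the corrected sums are
bounded above and contribute nothing after division by `n`. Countably many `j` suffice for all `ε`.
-/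
theorem Ergodic.ae_eventually_birkhoffSum_le [IsProbabilityMeasure μ] (hf : Ergodic f μ)
    {ψ : X → ℝ} (hψ : Measurable ψ) {B : ℝ} (hB : ∀ x, |ψ x| ≤ B) :
    ∀ᵐ x ∂μ, ∀ ε > 0, ∀ᶠ n : ℕ in atTop, birkhoffSum f ψ n x / n ≤ ∫ x, ψ x ∂μ + ε := by
  set m := ∫ x, ψ x ∂μ
  have hi : Integrable ψ μ := .of_bound hψ.aestronglyMeasurable B (.of_forall hB)
  have key : ∀ j : ℕ, ∀ᵐ x ∂μ, ∃ K : ℕ, ∀ n,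
      birkhoffSum f (fun x => ψ x - (m + 1 / ((j : ℝ) + 1))) n x ≤ K := fun j => by
    refine hf.ae_exists_birkhoffSum_le (hψ.sub_const _) (B := B + |m + 1 / ((j : ℝ) + 1)|)
      (fun x => (abs_sub _ _).trans (by gcongr; exact hB x)) ?_
    rw [integral_sub hi (integrable_const _)]
    simp only [integral_const, probReal_univ, one_smul]
    change m - _ < 0
    have : 0 < 1 / ((j : ℝ) + 1) := Nat.one_div_pos_of_nat
    linarith
  filter_upwards [ae_all_iff.2 key] with x hx ε hε
  obtain ⟨j, hj⟩ := exists_nat_one_div_lt (half_pos hε)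
  obtain ⟨K, hK⟩ := hx j
  obtain ⟨N, hN⟩ := exists_nat_gt (K / (ε / 2))
  filter_upwards [eventually_ge_atTop (N + 1)] with n hn
  have hn0 : (0 : ℝ) < n := by exact_mod_cast (Nat.succ_pos N).trans_le hn
  have h1 := hK n
  rw [birkhoffSum, Finset.sum_sub_distrib, Finset.sum_const, Finset.card_range, nsmul_eq_mul] at h1
  rw [div_lt_iff₀ (half_pos hε)] at hN
  have h2 : (N : ℝ) ≤ n := by exact_mod_cast (Nat.le_succ N).trans hn
  rw [div_le_iff₀ hn0, birkhoffSum]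
  nlinarith

/-- **Birkhoff's ergodic theorem** for bounded functions. -/
theorem Ergodic.ae_tendsto_birkhoffSum_div [IsProbabilityMeasure μ] (hf : Ergodic f μ) {ψ : X → ℝ}
    (hψ : Measurable ψ) {B : ℝ} (hB : ∀ x, |ψ x| ≤ B) :
    ∀ᵐ x ∂μ, Tendsto (fun n : ℕ => birkhoffSum f ψ n x / n) atTop (𝓝 (∫ x, ψ x ∂μ)) := by
  filter_upwards [hf.ae_eventually_birkhoffSum_le hψ hB,
    hf.ae_eventually_birkhoffSum_le hψ.neg (B := B) (fun x => by simpa using hB x)] with x h1 h2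
  rw [Metric.tendsto_nhds]
  intro ε hε
  filter_upwards [h1 (ε / 2) (half_pos hε), h2 (ε / 2) (half_pos hε)] with n h3 h4
  have h5 : birkhoffSum f (-ψ) n x = - birkhoffSum f ψ n x := by
    simp [birkhoffSum]
  change birkhoffSum f (-ψ) n x / n ≤ ∫ x, -ψ x ∂μ + ε / 2 at h4
  rw [h5, integral_neg, neg_div] at h4
  rw [Real.dist_eq, abs_lt]
  constructor <;> linarith

end Birkhoff

noncomputable section

namespace HypSurface

open UnitTangentPlane

/-! ### Geodesics with a common initial point -/

/-- The hyperbolic law of cosines: the factor of `sinh s * sinh t` is `1 - cos α`, where `α` is the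
angle between the two vectors. It bounds angles by distances and distances by angles. -/
theorem cosh_dist_geodesicLine {p q : UnitTangentPlane} (h : p.base = q.base) (s t : ℝ) :
    Real.cosh (dist (geodesicLine p s) (geodesicLine q t)) =
      Real.cosh (s - t) +
        ‖p.vec - q.vec‖ ^ 2 / (2 * p.base.im ^ 2) * (Real.sinh s * Real.sinh t) := by
  have hs := flowDen_ne_zero s p
  have ht := flowDen_ne_zero t q
  have hy := p.base.im_pos
  have hsub : (geodesicLine p s : ℂ) - geodesicLine q t =
      2 * ((Real.sinh (s / 2) * Real.cosh (t / 2) : ℝ) * p.vec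
        - (Real.cosh (s / 2) * Real.sinh (t / 2) : ℝ) * q.vec) /
        (flowDen s p * flowDen t q) := by
    change ((planeFlow s p).base : ℂ) - ((planeFlow t q).base : ℂ) = _
    rw [coe_base_planeFlow, coe_base_planeFlow, h]
    field_simp
    rw [flowDen, flowDen, h]
    push_cast only [Complex.ofReal_mul]
    ring
  have hn : ∀ a b : ℝ, ‖(a : ℂ) * p.vec - (b : ℂ) * q.vec‖ ^ 2 =
      (a - b) ^ 2 * p.base.im ^ 2 + a * b * ‖p.vec - q.vec‖ ^ 2 := by
    intro a b
    have h1 := normSq_vec p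
    have h2 := normSq_vec q
    rw [← h] at h2
    rw [← Complex.normSq_eq_norm_sq, ← Complex.normSq_eq_norm_sq, Complex.normSq_apply,
      Complex.normSq_apply]
    simp only [Complex.sub_re, Complex.sub_im, Complex.re_ofReal_mul, Complex.im_ofReal_mul]
    linear_combination (a ^ 2 - a * b) * h1 + (b ^ 2 - a * b) * h2
  rw [UpperHalfPlane.cosh_dist, dist_eq_norm, hsub]
  change 1 + _ / (2 * (planeFlow s p).base.im * (planeFlow t q).base.im) = _
  rw [im_planeFlow, im_planeFlow, norm_div, norm_mul, norm_mul, Complex.norm_ofNat, div_pow,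
    mul_pow, mul_pow, hn, ← h]
  have hs' : ‖flowDen s p‖ ≠ 0 := norm_ne_zero_iff.2 hs
  have ht' : ‖flowDen t q‖ ≠ 0 := norm_ne_zero_iff.2 ht
  have h2 : Real.cosh (s - t) = 1 + 2 * (Real.sinh (s / 2) * Real.cosh (t / 2)
      - Real.cosh (s / 2) * Real.sinh (t / 2)) ^ 2 := by
    have h3 := Real.cosh_two_mul ((s - t) / 2)
    rw [Real.cosh_sq, mul_div_cancel₀ _ two_ne_zero, sub_div, Real.sinh_sub] at h3
    rw [h3]; ring
  have e1 : Real.sinh s = 2 * Real.sinh (s / 2) * Real.cosh (s / 2) := by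
    rw [← Real.sinh_two_mul, mul_div_cancel₀ _ two_ne_zero]
  have e2 : Real.sinh t = 2 * Real.sinh (t / 2) * Real.cosh (t / 2) := by
    rw [← Real.sinh_two_mul, mul_div_cancel₀ _ two_ne_zero]
  rw [h2, e1, e2]
  generalize ‖p.vec - q.vec‖ ^ 2 = N
  generalize p.base.im = y at hy
  field_simp
  ring

theorem base_geodesicLine_zero (p : UnitTangentPlane) : geodesicLine p 0 = p.base := by
  rw [geodesicLine, planeFlow_zero]

open Classical in
/-- The unit tangent vector at `z` in the direction of `w`, as a complex number. -/
def dirVec (z w : ℍ) : ℂ :=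
  if w = z then Complex.I * z.im else
  Complex.I * z.im * (((w : ℂ) - z) / ((w : ℂ) - (starRingEnd ℂ) (z : ℂ))) /
    (Real.tanh (dist z w / 2) : ℂ)

theorem coe_sub_conj_ne_zero (z w : ℍ) : (w : ℂ) - (starRingEnd ℂ) (z : ℂ) ≠ 0 := by
  intro h
  have := congrArg Complex.im h
  simp at this
  linarith [z.im_pos, w.im_pos]

/-- The quotient in `dirVec` is the Cayley transform centred at `z`, whose modulus at `w` is `tanh
(dist z w / 2)`; division by this number leaves a vector of hyperbolic length one. -/
theorem norm_dirVec (z w : ℍ) : ‖dirVec z w‖ = z.im := by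
  rw [dirVec]
  split_ifs with h
  · simp [abs_of_pos z.im_pos]
  have h1 := UpperHalfPlane.tanh_half_dist w z
  have h2 : 0 < Real.tanh (dist z w / 2) := by
    rw [Real.tanh_eq_sinh_div_cosh]
    exact div_pos (Real.sinh_pos_iff.2 (half_pos (dist_pos.2 (Ne.symm h)))) (Real.cosh_pos _)
  rw [dist_comm w z, dist_eq_norm, dist_eq_norm, ← norm_div] at h1
  rw [norm_div, norm_mul, ← h1, norm_mul, Complex.norm_I, Complex.norm_real, Complex.norm_real,
    Real.norm_of_nonneg h2.le, Real.norm_of_nonneg z.im_pos.le, one_mul,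
    mul_div_cancel_right₀ _ h2.ne']

/-- The unit tangent vector at `z` pointing to `w`. -/
def dirTo (z w : ℍ) : UnitTangentPlane := ⟨(z, dirVec z w), norm_dirVec z w⟩

theorem base_dirTo (z w : ℍ) : (dirTo z w).base = z := rfl

theorem vec_dirTo (z w : ℍ) : (dirTo z w).vec = dirVec z w := rfl

/-- This gives polar coordinates around `z`, through which the law of cosines applies to arbitrary
points. -/
theorem geodesicLine_dirTo (z w : ℍ) : geodesicLine (dirTo z w) (dist z w) = w := by
  by_cases h : w = z
  · subst h; rw [dist_self, base_geodesicLine_zero, base_dirTo]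
  refine UpperHalfPlane.ext ?_
  change ((planeFlow _ _).base : ℂ) = _
  have hD := flowDen_ne_zero (dist z w) (dirTo z w)
  rw [coe_base_planeFlow, base_dirTo, vec_dirTo, add_comm, ← eq_sub_iff_add_eq, div_eq_iff hD,
    flowDen, vec_dirTo, base_dirTo, dirVec, if_neg h]
  have h1 := coe_sub_conj_ne_zero z w
  have h2 : (Real.sinh (dist z w / 2) : ℂ) ≠ 0 := by
    have := Real.sinh_pos_iff.2 (half_pos (dist_pos.2 (Ne.symm h)))
    exact_mod_cast this.ne'
  have h3 : (Real.cosh (dist z w / 2) : ℂ) ≠ 0 := by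
    exact_mod_cast (Real.cosh_pos _).ne'
  have h4 : (z.im : ℂ) ≠ 0 := by exact_mod_cast z.im_pos.ne'
  rw [Real.tanh_eq_sinh_div_cosh, Complex.ofReal_div]
  have h5 : (starRingEnd ℂ) (z : ℂ) = z - 2 * Complex.I * z.im := by
    apply Complex.ext <;> simp
    ring
  rw [h5] at h1 ⊢
  field_simp
  linear_combination (-((w : ℂ) - z) ^ 2) * Complex.I_sq

end HypSurface
end

noncomputable section

namespace HypSurface

open UnitTangentPlane

/-! ### The topology of the unit tangent bundle of the plane -/

theorem isInducing_base_vec :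
    IsInducing (fun p : UnitTangentPlane => (p.base, p.vec)) := IsInducing.subtypeVal

theorem continuous_base : Continuous UnitTangentPlane.base :=
  continuous_fst.comp isInducing_base_vec.continuous

theorem continuous_vec : Continuous UnitTangentPlane.vec :=
  continuous_snd.comp isInducing_base_vec.continuous

instance : TopologicalSpace.MetrizableSpace UnitTangentPlane :=
  inferInstanceAs (TopologicalSpace.MetrizableSpace {p : ℍ × ℂ // ‖p.2‖ = p.1.im})

instance : SecondCountableTopology UnitTangentPlane :=
  inferInstanceAs (SecondCountableTopology {p : ℍ × ℂ // ‖p.2‖ = p.1.im})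

theorem isClosedEmbedding_base_vec :
    IsClosedEmbedding (fun p : UnitTangentPlane => (p.base, p.vec)) :=
  IsClosed.isClosedEmbedding_subtypeVal (s := {p : ℍ × ℂ | ‖p.2‖ = p.1.im})
    (isClosed_eq continuous_snd.norm (UpperHalfPlane.continuous_im.comp continuous_fst))

instance : LocallyCompactSpace UnitTangentPlane :=
  isClosedEmbedding_base_vec.locallyCompactSpace

/-! ### Sequences of bounded jumps and linear growth -/

section Geometric

variable {E : Type*} [MetricSpace E] {α : ℕ → E} {K r : ℝ}

theorem exists_tendsto_of_eventually_dist_le_geometric [CompleteSpace E] (hr : r < 1)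
    (h : ∀ᶠ n in atTop, dist (α n) (α (n + 1)) ≤ K * r ^ n) : ∃ a, Tendsto α atTop (𝓝 a) := by
  obtain ⟨N, hN⟩ := eventually_atTop.1 h
  have hc : CauchySeq (fun k => α (k + N)) := by
    refine cauchySeq_of_le_geometric r (K * r ^ N) hr fun k => ?_
    have := hN (k + N) (Nat.le_add_left _ _)
    rw [show k + 1 + N = k + N + 1 by ring]
    exact this.trans_eq (by ring)
  obtain ⟨a, ha⟩ := cauchySeq_tendsto_of_complete hc
  exact ⟨a, (tendsto_add_atTop_iff_nat N).1 ha⟩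

theorem eventually_dist_le_geometric_of_tendsto (hr : r < 1)
    (h : ∀ᶠ n in atTop, dist (α n) (α (n + 1)) ≤ K * r ^ n) {a : E} (ha : Tendsto α atTop (𝓝 a)) :
    ∀ᶠ n in atTop, dist (α n) a ≤ K / (1 - r) * r ^ n := by
  obtain ⟨N, hN⟩ := eventually_atTop.1 h
  filter_upwards [eventually_ge_atTop N] with n hn
  have h1 := dist_le_of_le_geometric_of_tendsto₀ r (K * r ^ n) hr (f := fun k => α (k + n))
    (fun k => by
      have := hN (k + n) (hn.trans (Nat.le_add_left _ _))
      rw [show k + 1 + n = k + n + 1 by ring]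
      exact this.trans_eq (by ring)) ((tendsto_add_atTop_iff_nat n).2 ha)
  simp only [zero_add] at h1
  exact h1.trans_eq (by ring)

end Geometric

theorem exp_div_four_le_sinh {a : ℝ} (ha : 1 ≤ a) : Real.exp a / 4 ≤ Real.sinh a := by
  have h1 : 2 ≤ Real.exp a := by linarith [Real.add_one_le_exp a]
  have h2 : Real.exp (-a) ≤ 1 := Real.exp_le_one_iff.2 (by linarith)
  rw [Real.sinh_eq]
  linarith

theorem dist_le_of_cosh_dist_le {z w : ℍ} {M a : ℝ} (hM : 0 < M)
    (h : Real.cosh (dist z w) ≤ M * Real.exp a) : dist z w ≤ Real.log (2 * M) + a := by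
  have h1 : Real.exp (dist z w) ≤ 2 * M * Real.exp a := by
    have := Real.exp_pos (-dist z w)
    rw [Real.cosh_eq] at h
    linarith
  rw [← Real.log_exp (dist z w), ← Real.log_exp a, ← Real.log_mul (by positivity) (by positivity)]
  exact Real.log_le_log (Real.exp_pos _) (by simpa using h1)

/-! ### Convergence of directions and sublinear tracking by a ray -/

section Regular

variable {x : ℕ → ℍ} {C θ : ℝ}

/-- In the law of cosines for `x 0`, `x n`, `x (n + 1)` the left side is at most `cosh C`, while
both `sinh` factors are at least `exp ((θ - ε) * n) / 4`; this forces the angle to be exponentially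
small. The constant 32 is `2 * 4 * 4`. -/
theorem eventually_dist_dirVec_le (hC : ∀ n, dist (x n) (x (n + 1)) ≤ C)
    (hlim : Tendsto (fun n : ℕ => dist (x 0) (x n) / n) atTop (𝓝 θ)) {ε : ℝ}
    (hεθ : ε < θ) (hε : 0 < ε) :
    ∀ᶠ n in atTop, dist (dirVec (x 0) (x n)) (dirVec (x 0) (x (n + 1))) ≤
      √(32 * (x 0).im ^ 2 * Real.cosh C) * Real.exp (-(θ - ε)) ^ n := by
  have h1 : ∀ᶠ n : ℕ in atTop, (θ - ε) * n ≤ dist (x 0) (x n) ∧ 1 ≤ dist (x 0) (x n) := by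
    obtain ⟨N, hN⟩ := exists_nat_gt (1 / (θ - ε))
    filter_upwards [hlim.eventually (lt_mem_nhds (show θ - ε < θ by linarith)),
      eventually_ge_atTop (N + 1)] with n hn hnN
    have hn0 : (0 : ℝ) < n := by exact_mod_cast (Nat.succ_pos N).trans_le hnN
    have h2 : (N : ℝ) ≤ n := by exact_mod_cast (Nat.le_succ N).trans hnN
    rw [lt_div_iff₀ hn0] at hn
    rw [div_lt_iff₀ (by linarith)] at hN
    exact ⟨hn.le, by nlinarith⟩
  filter_upwards [h1, (tendsto_add_atTop_nat 1).eventually h1] with n hn hn1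
  set a := dist (x 0) (x n)
  set b := dist (x 0) (x (n + 1))
  have hy := (x 0).im_pos
  have key := cosh_dist_geodesicLine (p := dirTo (x 0) (x n)) (q := dirTo (x 0) (x (n + 1))) rfl a b
  rw [geodesicLine_dirTo, geodesicLine_dirTo] at key
  simp only [base_dirTo, vec_dirTo] at key
  rw [← dist_eq_norm] at key
  set δ := dist (dirVec (x 0) (x n)) (dirVec (x 0) (x (n + 1)))
  have hcC : Real.cosh (dist (x n) (x (n + 1))) ≤ Real.cosh C := by
    rw [Real.cosh_le_cosh, abs_of_nonneg dist_nonneg]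
    exact (hC n).trans (le_abs_self _)
  have h2 : δ ^ 2 / (2 * (x 0).im ^ 2) * (Real.sinh a * Real.sinh b) ≤ Real.cosh C := by
    linarith [Real.cosh_pos (a - b)]
  have ha : Real.exp ((θ - ε) * n) / 4 ≤ Real.sinh a :=
    (by gcongr; exact hn.1 : _ ≤ Real.exp a / 4).trans (exp_div_four_le_sinh hn.2)
  have hb : Real.exp ((θ - ε) * n) / 4 ≤ Real.sinh b := by
    refine le_trans ?_ (exp_div_four_le_sinh hn1.2)
    gcongr
    refine le_trans ?_ hn1.1
    push_cast
    nlinarith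
  have h3 : Real.exp ((θ - ε) * n) / 4 * (Real.exp ((θ - ε) * n) / 4) ≤ Real.sinh a * Real.sinh b :=
    mul_le_mul ha hb (by positivity) (le_trans (by positivity) ha)
  have h4 : δ ^ 2 / (2 * (x 0).im ^ 2) *
      (Real.exp ((θ - ε) * n) / 4 * (Real.exp ((θ - ε) * n) / 4)) ≤ Real.cosh C :=
    le_trans (by gcongr) h2
  have h5 : Real.exp (-(θ - ε)) ^ n = (Real.exp ((θ - ε) * n))⁻¹ := by
    rw [← Real.exp_nat_mul, ← Real.exp_neg]; ring_nf
  rw [h5]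
  set e := Real.exp ((θ - ε) * n)
  have he : 0 < e := Real.exp_pos _
  have hδ : 0 ≤ δ := dist_nonneg
  rw [← div_eq_mul_inv, le_div_iff₀ he]
  refine Real.le_sqrt_of_sq_le ?_
  rw [div_mul_eq_mul_div, div_le_iff₀ (by positivity)] at h4
  linarith

theorem exists_tendsto_dirTo (hC : ∀ n, dist (x n) (x (n + 1)) ≤ C) (hθ : 0 < θ)
    (hlim : Tendsto (fun n : ℕ => dist (x 0) (x n) / n) atTop (𝓝 θ)) :
    ∃ p : UnitTangentPlane, p.base = x 0 ∧ Tendsto (fun n => dirTo (x 0) (x n)) atTop (𝓝 p) := by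
  obtain ⟨u, hu⟩ := exists_tendsto_of_eventually_dist_le_geometric
    (Real.exp_lt_one_iff.2 (by linarith : -(θ - θ / 2) < 0))
    (eventually_dist_dirVec_le hC hlim (half_lt_self hθ) (half_pos hθ))
  have hn : ‖u‖ = (x 0).im :=
    tendsto_nhds_unique hu.norm (by simpa only [norm_dirVec] using tendsto_const_nhds)
  let p : UnitTangentPlane := ⟨(x 0, u), hn⟩
  refine ⟨p, rfl, ?_⟩
  rw [isInducing_base_vec.tendsto_nhds_iff]
  exact (tendsto_const_nhds (x := x 0)).prodMk_nhds hu

/-- The directions converge at rate `exp (-(θ - ε) * n)`, while rays from `x 0` spread at most like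
`exp ((θ + ε) * n)` at the distance of `x n`. The rates nearly cancel, leaving an error linear in
`n` with slope of order `ε`. -/
theorem tendsto_dist_geodesicLine_div (hC : ∀ n, dist (x n) (x (n + 1)) ≤ C) (hθ : 0 < θ)
    (hlim : Tendsto (fun n : ℕ => dist (x 0) (x n) / n) atTop (𝓝 θ)) {p : UnitTangentPlane}
    (hp : Tendsto (fun n => dirTo (x 0) (x n)) atTop (𝓝 p)) :
    Tendsto (fun n : ℕ => dist (x n) (geodesicLine p (n * θ)) / n) atTop (𝓝 0) := by
  have hb : p.base = x 0 := tendsto_nhds_unique ((continuous_base.tendsto p).comp hp)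
    (tendsto_const_nhds.congr fun n => (base_dirTo _ _).symm)
  have hv : Tendsto (fun n => dirVec (x 0) (x n)) atTop (𝓝 p.vec) := (continuous_vec.tendsto p).comp hp
  have hy := (x 0).im_pos
  have main : ∀ ε, 0 < ε → ε < θ →
      -- Of the six, four come from the spreading of the rays, one absorbs `Real.log (2 * M)`, and
      -- one bounds the difference between `dist (x 0) (x n)` and `n * θ`.
      ∀ᶠ n : ℕ in atTop, dist (x n) (geodesicLine p (n * θ)) / n ≤ 6 * ε := by
    intro ε hε hεθ
    have hr : Real.exp (-(θ - ε)) < 1 := Real.exp_lt_one_iff.2 (by linarith)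
    have hd := eventually_dist_le_geometric_of_tendsto hr
      (eventually_dist_dirVec_le hC hlim hεθ hε) hv
    set K := √(32 * (x 0).im ^ 2 * Real.cosh C) / (1 - Real.exp (-(θ - ε)))
    have hK : 0 ≤ K := div_nonneg (Real.sqrt_nonneg _) (by linarith)
    set M := 1 + K ^ 2 / (2 * (x 0).im ^ 2)
    have hM : 0 < M := by positivity
    obtain ⟨N, hN⟩ := exists_nat_gt (Real.log (2 * M) / ε)
    filter_upwards [hd, hlim.eventually (lt_mem_nhds (show θ - ε < θ by linarith)),
      hlim.eventually (gt_mem_nhds (show θ < θ + ε by linarith)),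
      eventually_ge_atTop (N + 1)] with n h1 h2 h3 hnN
    have hn0 : (0 : ℝ) < n := by exact_mod_cast (Nat.succ_pos N).trans_le hnN
    have hNn : (N : ℝ) ≤ n := by exact_mod_cast (Nat.le_succ N).trans hnN
    rw [lt_div_iff₀ hn0] at h2
    rw [div_lt_iff₀ hn0] at h3
    rw [div_lt_iff₀ hε] at hN
    set a := dist (x 0) (x n)
    have ha : 0 ≤ a := dist_nonneg
    have key := cosh_dist_geodesicLine (p := dirTo (x 0) (x n)) (q := p) hb.symm a a
    rw [geodesicLine_dirTo, sub_self, Real.cosh_zero] at key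
    simp only [base_dirTo, vec_dirTo] at key
    rw [← dist_eq_norm] at key
    have hs : Real.sinh a * Real.sinh a ≤ Real.exp ((θ + ε) * n) * Real.exp ((θ + ε) * n) := by
      have h4 : Real.sinh a ≤ Real.exp ((θ + ε) * n) := by
        refine le_trans ?_ (Real.exp_le_exp.2 h3.le)
        rw [Real.sinh_eq]
        linarith [Real.exp_pos a, Real.exp_pos (-a)]
      have h5 : 0 ≤ Real.sinh a := Real.sinh_nonneg_iff.2 ha
      exact mul_le_mul h4 h4 h5 (Real.exp_pos _).le
    have hc : Real.cosh (dist (x n) (geodesicLine p a)) ≤ M * Real.exp (4 * ε * n) := by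
      have h5 : Real.exp (-(θ - ε)) ^ n = Real.exp (-(θ - ε) * n) := by
        rw [← Real.exp_nat_mul]; ring_nf
      rw [h5] at h1
      rw [key]
      have h6 : (1 : ℝ) ≤ Real.exp (4 * ε * n) := Real.one_le_exp (by positivity)
      calc _ ≤ 1 + (K * Real.exp (-(θ - ε) * n)) ^ 2 / (2 * (x 0).im ^ 2) *
            (Real.exp ((θ + ε) * n) * Real.exp ((θ + ε) * n)) := by gcongr
        _ = 1 + K ^ 2 / (2 * (x 0).im ^ 2) * Real.exp (4 * ε * n) := by
            rw [mul_pow, mul_div_right_comm, mul_assoc]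
            congr 2
            rw [pow_two, ← Real.exp_add, ← Real.exp_add, ← Real.exp_add]
            ring_nf
        _ ≤ _ := by
            simp only [M]
            rw [add_mul, one_mul]
            gcongr
    have h7 := dist_le_of_cosh_dist_le hM hc
    have h8 : dist (geodesicLine p a) (geodesicLine p (n * θ)) ≤ ε * n := by
      rw [(isometry_geodesicLine p).dist_eq, Real.dist_eq, abs_le]
      constructor <;> nlinarith
    rw [div_le_iff₀ hn0]
    nlinarith [dist_triangle (x n) (geodesicLine p a) (geodesicLine p (n * θ))]
  rw [Metric.tendsto_nhds]
  intro η hη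
  filter_upwards [main (min (η / 7) (θ / 2)) (by positivity)
    ((min_le_right _ _).trans_lt (half_lt_self hθ))] with n hn
  rw [Real.dist_0_eq_abs, abs_of_nonneg (by positivity)]
  linarith [min_le_left (η / 7) (θ / 2)]

end Regular

end HypSurface
end

noncomputable section

namespace HypSurface

open UnitTangentPlane

/-! ### Frames -/

/-- The vertical unit vector at `i`. -/
def stdVec : UnitTangentPlane := ⟨(UpperHalfPlane.I, Complex.I), by simp⟩

theorem base_stdVec : stdVec.base = UpperHalfPlane.I := rfl

theorem vec_stdVec : stdVec.vec = Complex.I := rfl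

theorem flowDen_stdVec (t : ℝ) : flowDen t stdVec = (Real.exp (-(t / 2)) : ℂ) := by
  rw [flowDen, vec_stdVec, base_stdVec, UpperHalfPlane.I_im, ← Real.cosh_sub_sinh]
  push_cast only [Complex.ofReal_sub, Complex.ofReal_one]
  linear_combination (Real.sinh (t / 2) : ℂ) * Complex.I_sq

theorem coe_geodesicLine_stdVec (t : ℝ) :
    (geodesicLine stdVec t : ℂ) = Complex.I * (Real.exp t : ℂ) := by
  change ((planeFlow t stdVec).base : ℂ) = _
  have h : (Real.exp (-(t / 2)) : ℂ) ≠ 0 := by exact_mod_cast (Real.exp_pos _).ne'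
  rw [coe_base_planeFlow, flowDen_stdVec, vec_stdVec, base_stdVec]
  change Complex.I + _ = _
  have h1 : Real.exp t = 1 + 2 * Real.sinh (t / 2) / Real.exp (-(t / 2)) := by
    rw [Real.sinh_eq, Real.exp_neg]
    have := (Real.exp_pos (t / 2)).ne'
    have h2 : Real.exp t = Real.exp (t / 2) * Real.exp (t / 2) := by rw [← Real.exp_add]; ring_nf
    rw [h2]
    field_simp
    ring
  rw [h1]
  push_cast only [Complex.ofReal_add, Complex.ofReal_mul, Complex.ofReal_div, Complex.ofReal_one,
    Complex.ofReal_ofNat]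
  ring

theorem im_geodesicLine_stdVec (t : ℝ) : (geodesicLine stdVec t).im = Real.exp t := by
  rw [← UpperHalfPlane.coe_im, coe_geodesicLine_stdVec]
  simp [-Complex.ofReal_exp]

theorem vec_planeFlow_stdVec (t : ℝ) :
    (planeFlow t stdVec).vec = Complex.I * (Real.exp t : ℂ) := by
  rw [vec_planeFlow, flowDen_stdVec, vec_stdVec, ← Complex.ofReal_pow, ← Real.exp_nat_mul]
  push_cast only [Nat.cast_ofNat]
  rw [show 2 * -(t / 2) = -t by ring, Real.exp_neg, Complex.ofReal_inv, div_inv_eq_mul]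

theorem geodesicLine_smul (g : SL(2, ℝ)) (p : UnitTangentPlane) (t : ℝ) :
    geodesicLine (g • p) t = g • geodesicLine p t := by
  rw [geodesicLine, planeFlow_smul, base_smul, geodesicLine]

theorem smul_stdVec_eq (g : SL(2, ℝ)) (p : UnitTangentPlane)
    (h1 : (g 0 0 : ℂ) * Complex.I + g 0 1 = p.base * (g 1 0 * Complex.I + g 1 1))
    (h2 : (g 1 0 * Complex.I + g 1 1) ^ 2 = Complex.I / p.vec) : g • stdVec = p := by
  have hm := mobDen_ne_zero g stdVec.base
  refine UnitTangentPlane.ext (UpperHalfPlane.ext ?_) ?_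
  · rw [base_smul, coe_smul_eq, div_eq_iff hm]
    exact h1
  · rw [vec_smul]
    change Complex.I / (g 1 0 * Complex.I + g 1 1) ^ 2 = _
    rw [h2, div_div_cancel₀ Complex.I_ne_zero]

theorem vec_ne_zero (p : UnitTangentPlane) : p.vec ≠ 0 := by
  rw [← norm_ne_zero_iff, norm_vec]; exact p.base.im_pos.ne'

/-- A square root of `i / v`, where `v` is the given vector. -/
def frameDen (p : UnitTangentPlane) : ℂ := (Complex.I / p.vec) ^ ((2 : ℕ) : ℂ)⁻¹

theorem frameDen_sq (p : UnitTangentPlane) : frameDen p ^ 2 = Complex.I / p.vec :=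
  Complex.cpow_nat_inv_pow _ two_ne_zero

theorem norm_frameDen_sq (p : UnitTangentPlane) : ‖frameDen p‖ ^ 2 = p.base.im⁻¹ := by
  rw [← norm_pow, frameDen_sq, norm_div, norm_vec, Complex.norm_I, one_div]

/-- An isometry which maps `stdVec` to `p`. -/
def frame (p : UnitTangentPlane) : SL(2, ℝ) :=
  -- The rows are chosen so that `c * i + d = frameDen p` and `a * i + b = p.base * frameDen p`; the
  -- determinant is `im * ‖frameDen p‖ ^ 2 = 1`.
  ⟨!![(p.base * frameDen p).im, (p.base * frameDen p).re; (frameDen p).im, (frameDen p).re], by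
    have h := norm_frameDen_sq p
    have hy := p.base.im_pos.ne'
    rw [← Complex.normSq_eq_norm_sq, Complex.normSq_apply] at h
    have h := congrArg (p.base.im * ·) h
    simp only [mul_inv_cancel₀ hy] at h
    rw [Matrix.det_fin_two_of, Complex.mul_im, Complex.mul_re, UpperHalfPlane.coe_im]
    linear_combination h⟩

theorem frame_smul_stdVec (p : UnitTangentPlane) : frame p • stdVec = p := by
  have h : ((frame p) 1 0 * Complex.I + (frame p) 1 1 : ℂ) = frameDen p := by
    rw [add_comm]; exact Complex.re_add_im _
  refine smul_stdVec_eq _ _ ?_ ?_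
  · rw [h, add_comm]; exact Complex.re_add_im _
  · rw [h, frameDen_sq]

/-- Along the imaginary axis, flowing `stdVec` for time `t` is the action of the diagonal isometry
`a`, and the flow commutes with isometries. The general case is transported by `frame p`. -/
theorem planeFlow_add (s t : ℝ) (p : UnitTangentPlane) :
    planeFlow (s + t) p = planeFlow s (planeFlow t p) := by
  let a : SL(2, ℝ) := ⟨!![Real.exp (t / 2), 0; 0, Real.exp (-(t / 2))], by
    rw [Matrix.det_fin_two_of, ← Real.exp_add]; simp⟩
  have e (t : ℝ) : Real.exp t = Real.exp (t / 2) * Real.exp (t / 2) := by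
    rw [← Real.exp_add]; ring_nf
  have ha : a • stdVec = planeFlow t stdVec := by
    refine smul_stdVec_eq _ _ ?_ ?_
    · change ((Real.exp (t / 2) : ℝ) : ℂ) * Complex.I + ((0 : ℝ) : ℂ) =
        (geodesicLine stdVec t : ℂ) *
          (((0 : ℝ) : ℂ) * Complex.I + ((Real.exp (-(t / 2)) : ℝ) : ℂ))
      rw [coe_geodesicLine_stdVec, e t, Real.exp_neg]
      have : (Real.exp (t / 2) : ℂ) ≠ 0 := by exact_mod_cast (Real.exp_pos _).ne'
      push_cast only [Complex.ofReal_mul, Complex.ofReal_inv, Complex.ofReal_zero]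
      field_simp
      ring
    · change (((0 : ℝ) : ℂ) * Complex.I + ((Real.exp (-(t / 2)) : ℝ) : ℂ)) ^ 2 = _
      rw [vec_planeFlow_stdVec, e t, Real.exp_neg]
      have : (Real.exp (t / 2) : ℂ) ≠ 0 := by exact_mod_cast (Real.exp_pos _).ne'
      push_cast only [Complex.ofReal_mul, Complex.ofReal_inv, Complex.ofReal_zero]
      have := Complex.I_ne_zero
      field_simp
      ring
  have hstd : planeFlow (s + t) stdVec = planeFlow s (planeFlow t stdVec) := by
    rw [← ha, planeFlow_smul]
    refine UnitTangentPlane.ext (UpperHalfPlane.ext ?_) ?_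
    · rw [base_smul, coe_smul_eq]
      change (geodesicLine stdVec (s + t) : ℂ) =
        (((Real.exp (t / 2) : ℝ) : ℂ) * (geodesicLine stdVec s : ℂ) + ((0 : ℝ) : ℂ)) /
          (((0 : ℝ) : ℂ) * (geodesicLine stdVec s : ℂ) + ((Real.exp (-(t / 2)) : ℝ) : ℂ))
      rw [coe_geodesicLine_stdVec, coe_geodesicLine_stdVec, Real.exp_add, e t, Real.exp_neg]
      have : (Real.exp (t / 2) : ℂ) ≠ 0 := by exact_mod_cast (Real.exp_pos _).ne'
      push_cast only [Complex.ofReal_mul, Complex.ofReal_inv, Complex.ofReal_zero]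
      field_simp
      ring
    · rw [vec_smul, vec_planeFlow_stdVec, vec_planeFlow_stdVec]
      change _ = _ / (((0 : ℝ) : ℂ) * (geodesicLine stdVec s : ℂ) +
        ((Real.exp (-(t / 2)) : ℝ) : ℂ)) ^ 2
      rw [Real.exp_add, e t, Real.exp_neg]
      have : (Real.exp (t / 2) : ℂ) ≠ 0 := by exact_mod_cast (Real.exp_pos _).ne'
      push_cast only [Complex.ofReal_mul, Complex.ofReal_inv, Complex.ofReal_zero]
      field_simp
      ring
  rw [← frame_smul_stdVec p, planeFlow_smul, planeFlow_smul, planeFlow_smul, hstd]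

theorem geodesicLine_planeFlow (p : UnitTangentPlane) (s t : ℝ) :
    geodesicLine (planeFlow t p) s = geodesicLine p (s + t) := by
  rw [geodesicLine, ← planeFlow_add, geodesicLine]

/-! ### The position of a point along a geodesic -/

/-- The parameter of the point of the geodesic with initial velocity `p` which is closest
to `z`. -/
def linePos (p : UnitTangentPlane) (z : ℍ) : ℝ :=
  Real.log ((Real.exp 1 * Real.cosh (dist z (geodesicLine p (-1))) -
      Real.exp (-1) * Real.cosh (dist z (geodesicLine p 1))) /
    (Real.exp 1 * Real.cosh (dist z (geodesicLine p 1)) -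
      Real.exp (-1) * Real.cosh (dist z (geodesicLine p (-1))))) / 2

/-- Since `linePos` is written through distances alone, its equivariance is immediate. -/
theorem linePos_smul (g : SL(2, ℝ)) (p : UnitTangentPlane) (z : ℍ) :
    linePos (g • p) (g • z) = linePos p z := by
  simp only [linePos, geodesicLine_smul, dist_smul]

/-- The values at `t = -1` and `t = 1` determine `τ`: the two combinations in `linePos` equal `A *
sinh 2 * exp τ` and `A * sinh 2 * exp (-τ)`, so the unknown `A` cancels in their quotient `exp (2 *
τ)`. -/
theorem linePos_eq {p : UnitTangentPlane} {z : ℍ} {A τ : ℝ} (hA : A ≠ 0)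
    (h : ∀ t, Real.cosh (dist z (geodesicLine p t)) = A * Real.cosh (t - τ)) :
    linePos p z = τ := by
  have h2 : Real.sinh 2 ≠ 0 := (Real.sinh_pos_iff.2 two_pos).ne'
  have e1 : Real.exp 1 * (A * Real.cosh (-1 - τ)) - Real.exp (-1) * (A * Real.cosh (1 - τ)) =
      A * Real.sinh 2 * Real.exp τ := by
    rw [Real.cosh_eq, Real.cosh_eq, Real.sinh_eq, show (2 : ℝ) = 1 + 1 by norm_num]
    simp only [Real.exp_add, sub_eq_add_neg, Real.exp_neg, neg_add]
    have := Real.exp_pos τ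
    have := Real.exp_pos 1
    field_simp
    ring
  have e2 : Real.exp 1 * (A * Real.cosh (1 - τ)) - Real.exp (-1) * (A * Real.cosh (-1 - τ)) =
      A * Real.sinh 2 * Real.exp (-τ) := by
    rw [Real.cosh_eq, Real.cosh_eq, Real.sinh_eq, show (2 : ℝ) = 1 + 1 by norm_num]
    simp only [Real.exp_add, sub_eq_add_neg, Real.exp_neg, neg_add]
    have := Real.exp_pos τ
    have := Real.exp_pos 1
    field_simp
    ring
  rw [linePos, h, h, e1, e2, mul_div_mul_left _ _ (mul_ne_zero hA h2), ← Real.exp_sub, Real.log_exp]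
  ring

theorem norm_coe_pos (z : ℍ) : 0 < ‖(z : ℂ)‖ := norm_pos_iff.2 z.ne_zero

theorem cosh_dist_geodesicLine_stdVec (z : ℍ) (t : ℝ) :
    Real.cosh (dist z (geodesicLine stdVec t)) =
      ‖(z : ℂ)‖ / z.im * Real.cosh (t - Real.log ‖(z : ℂ)‖) := by
  have hz := norm_coe_pos z
  have hy := z.im_pos
  have he := Real.exp_pos t
  have h1 : ‖(z : ℂ) - Complex.I * (Real.exp t : ℂ)‖ ^ 2 =
      ‖(z : ℂ)‖ ^ 2 - 2 * z.im * Real.exp t + Real.exp t ^ 2 := by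
    rw [← Complex.normSq_eq_norm_sq, ← Complex.normSq_eq_norm_sq, Complex.normSq_apply,
      Complex.normSq_apply, Complex.sub_re, Complex.sub_im, Complex.re_mul_ofReal,
      Complex.im_mul_ofReal, Complex.I_re, Complex.I_im, UpperHalfPlane.coe_im]
    ring
  rw [UpperHalfPlane.cosh_dist, dist_eq_norm, coe_geodesicLine_stdVec, im_geodesicLine_stdVec, h1,
    Real.cosh_eq, neg_sub, Real.exp_sub, Real.exp_sub, Real.exp_log hz]
  field_simp
  ring

theorem linePos_stdVec (z : ℍ) : linePos stdVec z = Real.log ‖(z : ℂ)‖ :=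
  linePos_eq (div_pos (norm_coe_pos z) z.im_pos).ne' (cosh_dist_geodesicLine_stdVec z)

/-- Hyperbolic Pythagoras, obtained by moving the geodesic to the imaginary axis; `A` is the `cosh`
of the distance from `z` to the geodesic. -/
theorem cosh_dist_geodesicLine_eq (p : UnitTangentPlane) (z : ℍ) :
    ∃ A, 1 ≤ A ∧ ∀ t, Real.cosh (dist z (geodesicLine p t)) = A * Real.cosh (t - linePos p z) := by
  obtain ⟨w, rfl⟩ : ∃ w, z = frame p • w := ⟨(frame p)⁻¹ • z, (smul_inv_smul _ _).symm⟩
  refine ⟨‖(w : ℂ)‖ / w.im, ?_, fun t => ?_⟩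
  · rw [one_le_div w.im_pos, ← UpperHalfPlane.coe_im]
    exact (le_abs_self _).trans (Complex.abs_im_le_norm _)
  · have h := linePos_smul (frame p) stdVec w
    rw [frame_smul_stdVec] at h
    rw [h, linePos_stdVec, ← cosh_dist_geodesicLine_stdVec, ← dist_smul (frame p) w,
      ← geodesicLine_smul, frame_smul_stdVec]

theorem linePos_planeFlow (p : UnitTangentPlane) (t : ℝ) (z : ℍ) :
    linePos (planeFlow t p) z = linePos p z - t := by
  obtain ⟨A, hA, h⟩ := cosh_dist_geodesicLine_eq p z
  refine linePos_eq (A := A) (by positivity) fun s => ?_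
  rw [geodesicLine_planeFlow, h]
  ring_nf

theorem linePos_geodesicLine (p : UnitTangentPlane) (t : ℝ) : linePos p (geodesicLine p t) = t := by
  refine linePos_eq one_ne_zero fun s => ?_
  rw [(isometry_geodesicLine p).dist_eq, Real.dist_eq, Real.cosh_abs, one_mul, ← Real.cosh_neg]
  ring_nf

theorem dist_geodesicLine_linePos (p : UnitTangentPlane) (z : ℍ) :
    dist z (geodesicLine p (linePos p z)) = Metric.infDist z (Set.range (geodesicLine p)) := by
  obtain ⟨A, hA, h⟩ := cosh_dist_geodesicLine_eq p z
  refine le_antisymm ?_ (Metric.infDist_le_dist_of_mem ⟨_, rfl⟩)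
  refine (Metric.le_infDist (Set.range_nonempty _)).2 ?_
  rintro _ ⟨t, rfl⟩
  have h1 := h t
  have h2 := h (linePos p z)
  rw [sub_self, Real.cosh_zero, mul_one] at h2
  have h3 : Real.cosh (dist z (geodesicLine p (linePos p z))) ≤
      Real.cosh (dist z (geodesicLine p t)) := by
    rw [h1, h2]
    nlinarith [Real.one_le_cosh (t - linePos p z)]
  rwa [Real.cosh_le_cosh, abs_of_nonneg dist_nonneg, abs_of_nonneg dist_nonneg] at h3

/-- Nearest point projection to the imaginary axis sends `z` to height `‖z‖` and is 1-Lipschitz.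
After taking `cosh`, the difference of the two sides is a sum of two terms, nonnegative because `im
≤ ‖·‖` and by Cauchy-Schwarz. -/
theorem log_norm_sub_le_dist (z w : ℍ) :
    |Real.log ‖(z : ℂ)‖ - Real.log ‖(w : ℂ)‖| ≤ dist z w := by
  have hz := norm_coe_pos z
  have hw := norm_coe_pos w
  have hzi := z.im_pos
  have hwi := w.im_pos
  rw [← abs_of_nonneg (dist_nonneg (x := z) (y := w)), ← Real.cosh_le_cosh,
    UpperHalfPlane.cosh_dist, dist_eq_norm, Real.cosh_eq, neg_sub, Real.exp_sub, Real.exp_sub,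
    Real.exp_log hz, Real.exp_log hw]
  have h1 : ‖(z : ℂ)‖ ^ 2 = z.re ^ 2 + z.im ^ 2 := by
    rw [← Complex.normSq_eq_norm_sq, Complex.normSq_apply, UpperHalfPlane.coe_re,
      UpperHalfPlane.coe_im]; ring
  have h2 : ‖(w : ℂ)‖ ^ 2 = w.re ^ 2 + w.im ^ 2 := by
    rw [← Complex.normSq_eq_norm_sq, Complex.normSq_apply, UpperHalfPlane.coe_re,
      UpperHalfPlane.coe_im]; ring
  have h3 : ‖(z : ℂ) - w‖ ^ 2 = ‖(z : ℂ)‖ ^ 2 + ‖(w : ℂ)‖ ^ 2 - 2 * (z.re * w.re + z.im * w.im) := by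
    rw [h1, h2, ← Complex.normSq_eq_norm_sq, Complex.normSq_apply, Complex.sub_re, Complex.sub_im,
      UpperHalfPlane.coe_re, UpperHalfPlane.coe_im, UpperHalfPlane.coe_re, UpperHalfPlane.coe_im]
    ring
  rw [h3]
  set a := ‖(z : ℂ)‖
  set b := ‖(w : ℂ)‖
  have h4 : z.re * w.re + z.im * w.im ≤ a * b := by
    refine abs_le_of_sq_le_sq' ?_ (by positivity) |>.2
    rw [mul_pow, h1, h2]
    nlinarith [sq_nonneg (z.re * w.im - z.im * w.re)]
  have h5 : z.im * w.im ≤ a * b := by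
    have e1 : z.im ≤ a := (le_abs_self _).trans (Complex.abs_im_le_norm z)
    have e2 : w.im ≤ b := (le_abs_self _).trans (Complex.abs_im_le_norm w)
    exact mul_le_mul e1 e2 hwi.le hz.le
  have e : (a / b + b / a) / 2 = (a ^ 2 + b ^ 2) / (2 * (a * b)) := by field_simp
  rw [e, div_le_iff₀ (by positivity), ← sub_nonneg]
  have e' : (1 + (a ^ 2 + b ^ 2 - 2 * (z.re * w.re + z.im * w.im)) / (2 * z.im * w.im)) *
      (2 * (a * b)) - (a ^ 2 + b ^ 2) = ((a - b) ^ 2 * (a * b - z.im * w.im) +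
        2 * (a * b) * (a * b - (z.re * w.re + z.im * w.im))) / (z.im * w.im) := by
    field_simp
    ring
  rw [e']
  refine div_nonneg ?_ (by positivity)
  have := mul_nonneg (sq_nonneg (a - b)) (sub_nonneg.2 h5)
  have := mul_nonneg (by positivity : 0 ≤ 2 * (a * b)) (sub_nonneg.2 h4)
  linarith

theorem abs_linePos_sub_le (p : UnitTangentPlane) (z w : ℍ) :
    |linePos p z - linePos p w| ≤ dist z w := by
  have h (z : ℍ) : linePos p z = Real.log ‖(((frame p)⁻¹ • z : ℍ) : ℂ)‖ := by
    have := linePos_smul (frame p) stdVec ((frame p)⁻¹ • z)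
    rwa [smul_inv_smul, frame_smul_stdVec, linePos_stdVec] at this
  rw [h, h, ← dist_smul (frame p)⁻¹ z w]
  exact log_norm_sub_le_dist _ _

end HypSurface
end

noncomputable section

namespace HypSurface

open UnitTangentPlane

/-! ### The geodesic with given end points -/

/-- Such a `g` fixes the end point `∞`: it acts by `z ↦ a ^ 2 * z + a * b`, and at height `exp t`
the hyperbolic size of the translation only decreases with `t`. -/
theorem geodesicLine_stdVec_smul_bounded (g : SL(2, ℝ)) (hg : g 1 0 = 0) :
    ∃ K, ∀ t, 0 ≤ t → dist (geodesicLine stdVec t) (g • geodesicLine stdVec t) ≤ K := by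
  have hdet : g 0 0 * g 1 1 = 1 := by
    have := g.det_coe
    rwa [Matrix.det_fin_two, hg, mul_zero, sub_zero] at this
  set a := g 0 0
  set b := g 0 1
  have ha : a ≠ 0 := left_ne_zero_of_mul_eq_one hdet
  have hd : g 1 1 = a⁻¹ := eq_inv_of_mul_eq_one_right hdet
  have ha2 : 0 < a ^ 2 := by positivity
  refine ⟨Real.log (2 * (1 + ((1 - a ^ 2) ^ 2 + (a * b) ^ 2) / (2 * a ^ 2))) + 0, fun t ht => ?_⟩
  refine dist_le_of_cosh_dist_le (by positivity) ?_
  rw [Real.exp_zero, mul_one]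
  have hmob : mobDen g (geodesicLine stdVec t) = ((a⁻¹ : ℝ) : ℂ) := by
    rw [mobDen, hg, hd]; simp
  have hc : ((g • geodesicLine stdVec t : ℍ) : ℂ) =
      Complex.I * ((a ^ 2 * Real.exp t : ℝ) : ℂ) + ((a * b : ℝ) : ℂ) := by
    rw [coe_smul_eq, hmob, coe_geodesicLine_stdVec]
    have : (a : ℂ) ≠ 0 := by exact_mod_cast ha
    push_cast only [Complex.ofReal_mul, Complex.ofReal_inv, Complex.ofReal_pow]
    field_simp
    ring
  have hi : (g • geodesicLine stdVec t : ℍ).im = a ^ 2 * Real.exp t := by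
    rw [im_smul_eq, hmob, im_geodesicLine_stdVec, Complex.norm_real, Real.norm_eq_abs, sq_abs]
    field_simp
  have hn : dist (geodesicLine stdVec t : ℂ) ((g • geodesicLine stdVec t : ℍ) : ℂ) ^ 2 =
      (1 - a ^ 2) ^ 2 * Real.exp t ^ 2 + (a * b) ^ 2 := by
    rw [dist_eq_norm, hc, coe_geodesicLine_stdVec, ← Complex.normSq_eq_norm_sq,
      Complex.normSq_apply, Complex.sub_re, Complex.sub_im, Complex.add_re, Complex.add_im,
      Complex.re_mul_ofReal, Complex.im_mul_ofReal, Complex.re_mul_ofReal, Complex.im_mul_ofReal,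
      Complex.I_re, Complex.I_im, Complex.ofReal_re, Complex.ofReal_im]
    ring
  rw [UpperHalfPlane.cosh_dist, hn, hi, im_geodesicLine_stdVec]
  have he : 1 ≤ Real.exp t := Real.one_le_exp ht
  have he2 : 1 ≤ Real.exp t ^ 2 := one_le_pow₀ he
  gcongr 1 + ?_
  rw [div_le_div_iff₀ (by positivity) (by positivity)]
  have : 0 ≤ (a * b) ^ 2 * (Real.exp t ^ 2 - 1) := mul_nonneg (sq_nonneg _) (by linarith)
  nlinarith

/-- Two geodesics whose frames have proportional first columns are asymptotic. -/
theorem exists_dist_geodesicLine_le (g h : SL(2, ℝ)) (hgh : g 0 0 * h 1 0 = g 1 0 * h 0 0) :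
    ∃ K, ∀ t, 0 ≤ t →
      dist (geodesicLine (g • stdVec) t) (geodesicLine (h • stdVec) t) ≤ K := by
  -- The first column of a frame represents the forward end point, the image of `∞`; proportional
  -- columns mean that `g⁻¹ * h` fixes `∞`.
  obtain ⟨K, hK⟩ := geodesicLine_stdVec_smul_bounded (g⁻¹ * h) (by
    rw [Matrix.SpecialLinearGroup.coe_mul, Matrix.SpecialLinearGroup.coe_inv,
      Matrix.adjugate_fin_two, Matrix.mul_apply, Fin.sum_univ_two]
    simp
    linarith)
  refine ⟨K, fun t ht => ?_⟩
  rw [geodesicLine_smul, geodesicLine_smul, ← dist_smul g⁻¹, inv_smul_smul, smul_smul]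
  exact hK t ht

/-- The rotation by `π` about `i`. -/
def flip : SL(2, ℝ) := ⟨!![0, -1; 1, 0], by simp [Matrix.det_fin_two_of]⟩

theorem flip_smul_geodesicLine_stdVec (t : ℝ) :
    flip • geodesicLine stdVec t = geodesicLine stdVec (-t) := by
  refine UpperHalfPlane.ext ?_
  rw [coe_smul_eq]
  change (((0 : ℝ) : ℂ) * (geodesicLine stdVec t : ℂ) + ((-1 : ℝ) : ℂ)) /
    (((1 : ℝ) : ℂ) * (geodesicLine stdVec t : ℂ) + ((0 : ℝ) : ℂ)) = _
  rw [coe_geodesicLine_stdVec, coe_geodesicLine_stdVec, Real.exp_neg]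
  have : (Real.exp t : ℂ) ≠ 0 := by exact_mod_cast (Real.exp_pos _).ne'
  have := Complex.I_ne_zero
  push_cast only [Complex.ofReal_inv, Complex.ofReal_zero, Complex.ofReal_neg, Complex.ofReal_one]
  rw [div_eq_iff (by simp [this]), zero_mul, zero_add, one_mul, add_zero]
  field_simp
  exact Complex.I_sq.symm

/-- A determinant which vanishes when the geodesics with initial velocities `p` and `q` have the
same forward end point. -/
def endDet (p q : UnitTangentPlane) : ℝ :=
  frame p 0 0 * frame q 1 0 - frame p 1 0 * frame q 0 0

/-- A unit vector is determined by its base point and forward end point. Here `frameDen p` and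
`frameDen q` have equal modulus and are real multiples of each other, so their squares agree, and
these determine the vectors. -/
theorem eq_of_endDet_eq_zero {p q : UnitTangentPlane} (hb : p.base = q.base)
    (h : endDet p q = 0) : p = q := by
  have hy := p.base.im_pos
  change ((p.base * frameDen p).im) * (frameDen q).im -
    (frameDen p).im * (q.base * frameDen q).im = 0 at h
  rw [← hb, Complex.mul_im, Complex.mul_im, UpperHalfPlane.coe_im] at h
  have h1 : (frameDen p).re * (frameDen q).im = (frameDen p).im * (frameDen q).re := by
    have : p.base.im * ((frameDen p).re * (frameDen q).im - (frameDen p).im * (frameDen q).re) = 0 := by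
      linear_combination h
    have := (mul_eq_zero.1 this).resolve_left hy.ne'
    linarith
  have h2 : ‖frameDen p‖ ^ 2 = ‖frameDen q‖ ^ 2 := by
    rw [norm_frameDen_sq, norm_frameDen_sq, hb]
  have h3 : frameDen p ^ 2 = frameDen q ^ 2 := by
    have e : frameDen p * (starRingEnd ℂ) (frameDen q) = (starRingEnd ℂ) (frameDen p) * frameDen q := by
      apply Complex.ext
      · simp
      · simp; linarith
    have e2 : (starRingEnd ℂ) (frameDen p) * frameDen p = (starRingEnd ℂ) (frameDen q) * frameDen q := by
      rw [← Complex.normSq_eq_conj_mul_self, ← Complex.normSq_eq_conj_mul_self,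
        Complex.normSq_eq_norm_sq, Complex.normSq_eq_norm_sq, h2]
    have e3 : (starRingEnd ℂ) (frameDen q) ≠ 0 := by
      refine (map_ne_zero _).2 fun h0 => ?_
      have := norm_frameDen_sq q
      rw [h0] at this
      simp at this
      exact q.base.im_pos.ne' this.symm
    refine mul_left_cancel₀ e3 ?_
    linear_combination (frameDen p) * e + frameDen q * e2
  rw [frameDen_sq, frameDen_sq] at h3
  refine UnitTangentPlane.ext hb ?_
  exact ((div_eq_div_iff (vec_ne_zero p) (vec_ne_zero q)).1 h3 |> mul_left_cancel₀
    Complex.I_ne_zero).symm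

/-- The frame of the geodesic from the end point of `q` to the end point of `p`. -/
def joinFrame (p q : UnitTangentPlane) (h : endDet p q ≠ 0) : SL(2, ℝ) :=
  -- The columns represent the images of `∞` and `0`. Rescaling leaves these end points alone; the
  -- scalars make the determinant one, and taking them of equal modulus fixes the parametrization as
  -- in `linePos_joinLine`.
  ⟨!![(√|endDet p q|)⁻¹ * frame p 0 0, (√|endDet p q|)⁻¹ * SignType.sign (endDet p q) * frame q 0 0;
      (√|endDet p q|)⁻¹ * frame p 1 0, (√|endDet p q|)⁻¹ * SignType.sign (endDet p q) * frame q 1 0],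
    by
      have h1 : √|endDet p q| ^ 2 = |endDet p q| := Real.sq_sqrt (abs_nonneg _)
      have h2 : √|endDet p q| ≠ 0 := (Real.sqrt_pos.2 (abs_pos.2 h)).ne'
      have h3 := sign_mul_self (endDet p q)
      rw [Matrix.det_fin_two_of]
      have h4 : frame p 0 0 * frame q 1 0 - frame p 1 0 * frame q 0 0 = endDet p q := rfl
      field_simp
      rw [h1, ← h3, ← h4]
      ring⟩

open Classical in
/-- The initial velocity of the geodesic joining the forward end points of the geodesics
with initial velocities `q` and `p`. -/
def joinLine (p q : UnitTangentPlane) : UnitTangentPlane :=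
  if h : endDet p q ≠ 0 then joinFrame p q h • stdVec else p

theorem exists_dist_joinLine_le {p q : UnitTangentPlane} (h : endDet p q ≠ 0) :
    ∃ K, ∀ t, 0 ≤ t → dist (geodesicLine p t) (geodesicLine (joinLine p q) t) ≤ K ∧
      dist (geodesicLine q t) (geodesicLine (joinLine p q) (-t)) ≤ K := by
  obtain ⟨K₁, h1⟩ := exists_dist_geodesicLine_le (frame p) (joinFrame p q h) (by
    change frame p 0 0 * ((√|endDet p q|)⁻¹ * frame p 1 0) =
      frame p 1 0 * ((√|endDet p q|)⁻¹ * frame p 0 0)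
    ring)
  obtain ⟨K₂, h2⟩ := exists_dist_geodesicLine_le (frame q) (joinFrame p q h * flip) (by
    have e (i : Fin 2) : (joinFrame p q h * flip) i 0 =
        (√|endDet p q|)⁻¹ * SignType.sign (endDet p q) * frame q i 0 := by
      rw [Matrix.SpecialLinearGroup.coe_mul, Matrix.mul_apply, Fin.sum_univ_two]
      fin_cases i <;> simp [flip, joinFrame]
    rw [e, e]
    ring)
  refine ⟨max K₁ K₂, fun t ht => ?_⟩
  have h1 := h1 t ht
  have h2 := h2 t ht
  rw [frame_smul_stdVec] at h1 h2
  rw [mul_smul, geodesicLine_smul, geodesicLine_smul, flip_smul_geodesicLine_stdVec,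
    ← geodesicLine_smul] at h2
  rw [joinLine, dif_pos h]
  exact ⟨h1.trans (le_max_left _ _), h2.trans (le_max_right _ _)⟩

/-- For a frame `r` based at `z`, the quantity `‖r₁₀ * z - r₀₀‖` is `√z.im` whatever the direction.
Hence `z`, read in the frame of the joining geodesic, has modulus one and projects to parameter `log
1 = 0`. -/
theorem linePos_joinLine {p q : UnitTangentPlane} (hb : p.base = q.base) (h : endDet p q ≠ 0) :
    linePos (joinLine p q) p.base = 0 := by
  set z := p.base
  have hcol (r : UnitTangentPlane) (hr : r.base = z) :
      ‖(frame r 1 0 : ℂ) * z - frame r 0 0‖ = √z.im := by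
    have e : (frame r 1 0 : ℂ) * z - frame r 0 0 = -(z.im * (starRingEnd ℂ) (frameDen r)) := by
      change (((frameDen r).im : ℝ) : ℂ) * z - (((r.base * frameDen r).im : ℝ) : ℂ) = _
      rw [hr]
      apply Complex.ext <;> simp <;> ring
    have hz := z.im_pos
    rw [e, norm_neg, norm_mul, Complex.norm_real, Real.norm_of_nonneg hz.le, RCLike.norm_conj,
      eq_comm, Real.sqrt_eq_iff_mul_self_eq hz.le (by positivity)]
    have := norm_frameDen_sq r
    rw [hr] at this
    rw [show z.im * ‖frameDen r‖ * (z.im * ‖frameDen r‖) = z.im * z.im * ‖frameDen r‖ ^ 2 by ring,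
      this]
    field_simp
  rw [joinLine, dif_pos h]
  obtain ⟨w, hw⟩ : ∃ w, z = joinFrame p q h • w :=
    ⟨(joinFrame p q h)⁻¹ • z, (smul_inv_smul _ _).symm⟩
  rw [hw, linePos_smul, linePos_stdVec]
  suffices ‖(w : ℂ)‖ = 1 by rw [this, Real.log_one]
  have hwz : w = (joinFrame p q h)⁻¹ • z := by rw [hw, inv_smul_smul]
  have hc := hcol p rfl
  have hc' := hcol q hb.symm
  have hzpos : √z.im ≠ 0 := (Real.sqrt_pos.2 z.im_pos).ne'
  have hl : √|endDet p q| ≠ 0 := (Real.sqrt_pos.2 (abs_pos.2 h)).ne'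
  have hs : ‖((SignType.sign (endDet p q) : ℝ) : ℂ)‖ = 1 := by
    rcases lt_or_gt_of_ne h with h' | h' <;> simp [sign_neg, sign_pos, h']
  rw [hwz, coe_smul_eq, mobDen, Matrix.SpecialLinearGroup.coe_inv, Matrix.adjugate_fin_two]
  simp only [Matrix.of_apply, Matrix.cons_val', Matrix.cons_val_zero, Matrix.cons_val_one,
    Matrix.cons_val_fin_one]
  have e0 : joinFrame p q h 0 0 = (√|endDet p q|)⁻¹ * frame p 0 0 := rfl
  have e1 : joinFrame p q h 0 1 =
    (√|endDet p q|)⁻¹ * SignType.sign (endDet p q) * frame q 0 0 := rfl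
  have e2 : joinFrame p q h 1 0 = (√|endDet p q|)⁻¹ * frame p 1 0 := rfl
  have e3 : joinFrame p q h 1 1 =
    (√|endDet p q|)⁻¹ * SignType.sign (endDet p q) * frame q 1 0 := rfl
  rw [e0, e1, e2, e3, norm_div]
  push_cast only [Complex.ofReal_mul, Complex.ofReal_neg, Complex.ofReal_inv]
  have f1 : ((√|endDet p q| : ℝ) : ℂ)⁻¹ * ((SignType.sign (endDet p q) : ℝ) : ℂ) * (frame q 1 0 : ℂ) * z +
      -(((√|endDet p q| : ℝ) : ℂ)⁻¹ * ((SignType.sign (endDet p q) : ℝ) : ℂ) * (frame q 0 0 : ℂ)) =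
      ((√|endDet p q| : ℝ) : ℂ)⁻¹ * ((SignType.sign (endDet p q) : ℝ) : ℂ) *
        ((frame q 1 0 : ℂ) * z - frame q 0 0) := by ring
  have f2 : -(((√|endDet p q| : ℝ) : ℂ)⁻¹ * (frame p 1 0 : ℂ)) * z +
      ((√|endDet p q| : ℝ) : ℂ)⁻¹ * (frame p 0 0 : ℂ) =
      -(((√|endDet p q| : ℝ) : ℂ)⁻¹ * ((frame p 1 0 : ℂ) * z - frame p 0 0)) := by ring
  rw [f1, f2, norm_neg, norm_mul, norm_mul, norm_mul, hs, hc, hc', mul_one, div_self]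
  rw [norm_inv, Complex.norm_real, Real.norm_of_nonneg (Real.sqrt_nonneg _)]
  exact mul_ne_zero (inv_ne_zero hl) hzpos

/-! ### Uniqueness of tracking geodesics -/

/-- If the entry `c` were nonzero, `g` would send the point of height `exp t` to height at most `exp
(-t) / c ^ 2`, and the distance would grow at least like `2 * t`. -/
theorem smul_stdVec_entry_eq_zero {g : SL(2, ℝ)} {s : ℝ} (hs : 0 < s)
    (h : Tendsto (fun n : ℕ => dist (geodesicLine stdVec (n * s))
      (g • geodesicLine stdVec (n * s)) / n) atTop (𝓝 0)) : g 1 0 = 0 := by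
  by_contra hc
  have hc2 : 0 < g 1 0 ^ 2 := by positivity
  have h1 : ∀ᶠ n : ℕ in atTop, 2 * s + Real.log (g 1 0 ^ 2) / n ≤
      dist (geodesicLine stdVec (n * s)) (g • geodesicLine stdVec (n * s)) / n := by
    filter_upwards [eventually_gt_atTop 0] with n hn
    have hn0 : (0 : ℝ) < n := by exact_mod_cast hn
    have h2 := (le_abs_self _).trans (UpperHalfPlane.dist_log_im_le
      (geodesicLine stdVec (n * s)) (g • geodesicLine stdVec (n * s)))
    rw [im_geodesicLine_stdVec, im_smul_eq, im_geodesicLine_stdVec, Real.log_exp] at h2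
    have h3 : g 1 0 ^ 2 * Real.exp (n * s) ^ 2 ≤ ‖mobDen g (geodesicLine stdVec (n * s))‖ ^ 2 := by
      rw [mobDen, coe_geodesicLine_stdVec, ← Complex.normSq_eq_norm_sq, Complex.normSq_apply]
      simp [-Complex.ofReal_exp]
      nlinarith [sq_nonneg (g 1 1)]
    have h4 : Real.log (Real.exp (n * s) / ‖mobDen g (geodesicLine stdVec (n * s))‖ ^ 2) ≤
        -(n * s) - Real.log (g 1 0 ^ 2) := by
      rw [Real.log_le_iff_le_exp (div_pos (Real.exp_pos _)
        (pow_pos (norm_pos_iff.2 (mobDen_ne_zero _ _)) 2)), Real.exp_sub, Real.exp_log hc2,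
        Real.exp_neg]
      have he := Real.exp_pos (n * s)
      calc _ ≤ Real.exp (n * s) / (g 1 0 ^ 2 * Real.exp (n * s) ^ 2) := by gcongr
        _ = _ := by field_simp
    rw [le_div_iff₀ hn0, add_mul, div_mul_cancel₀ _ hn0.ne']
    linarith
  have h2 : Tendsto (fun n : ℕ => 2 * s + Real.log (g 1 0 ^ 2) / n) atTop (𝓝 (2 * s + 0)) :=
    tendsto_const_nhds.add (tendsto_const_div_atTop_nhds_zero_nat _)
  have := le_of_tendsto_of_tendsto h2 h h1
  linarith

/-- In the frame of `p`, forward closeness makes the isometry carrying `p` to `q` fix `∞`, and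
backward closeness, conjugated by `flip`, makes it fix `0`. A diagonal matrix translates along the
axis. -/
theorem exists_eq_planeFlow {p q : UnitTangentPlane} {s : ℝ} (hs : 0 < s)
    (h₁ : Tendsto (fun n : ℕ => dist (geodesicLine p (n * s)) (geodesicLine q (n * s)) / n)
      atTop (𝓝 0))
    (h₂ : Tendsto (fun n : ℕ => dist (geodesicLine p (-(n * s))) (geodesicLine q (-(n * s))) / n)
      atTop (𝓝 0)) : ∃ t, q = planeFlow t p := by
  obtain ⟨g, hg⟩ : ∃ g : SL(2, ℝ), g = (frame p)⁻¹ * frame q := ⟨_, rfl⟩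
  have hq : q = frame p • g • stdVec := by
    rw [hg, mul_smul, smul_inv_smul, frame_smul_stdVec]
  have hd (t : ℝ) : dist (geodesicLine p t) (geodesicLine q t) =
      dist (geodesicLine stdVec t) (g • geodesicLine stdVec t) := by
    rw [hq, geodesicLine_smul, geodesicLine_smul]
    conv_lhs => rw [← frame_smul_stdVec p, geodesicLine_smul, frame_smul_stdVec, dist_smul]
  simp only [hd] at h₁ h₂
  have hc := smul_stdVec_entry_eq_zero hs h₁
  have hb := smul_stdVec_entry_eq_zero (g := flip⁻¹ * g * flip) hs (by
    refine h₂.congr fun n => ?_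
    rw [mul_smul, mul_smul, flip_smul_geodesicLine_stdVec,
      ← dist_smul flip (geodesicLine stdVec (n * s)), smul_inv_smul,
      flip_smul_geodesicLine_stdVec])
  have hb' : g 0 1 = 0 := by
    rw [Matrix.SpecialLinearGroup.coe_mul, Matrix.SpecialLinearGroup.coe_mul,
      Matrix.SpecialLinearGroup.coe_inv, Matrix.adjugate_fin_two, Matrix.mul_apply,
      Fin.sum_univ_two, Matrix.mul_apply, Fin.sum_univ_two, Matrix.mul_apply,
      Fin.sum_univ_two] at hb
    simpa [flip] using hb
  have hdet : g 0 0 * g 1 1 = 1 := by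
    have := g.det_coe
    rwa [Matrix.det_fin_two, hc, mul_zero, sub_zero] at this
  have ha : g 0 0 ≠ 0 := left_ne_zero_of_mul_eq_one hdet
  have hdd : g 1 1 = (g 0 0)⁻¹ := eq_inv_of_mul_eq_one_right hdet
  have he : Real.exp (Real.log (g 0 0 ^ 2)) = g 0 0 ^ 2 := Real.exp_log (by positivity)
  have haC : (g 0 0 : ℂ) ≠ 0 := by exact_mod_cast ha
  have key : g • stdVec = planeFlow (Real.log (g 0 0 ^ 2)) stdVec := by
    refine smul_stdVec_eq _ _ ?_ ?_
    · change _ = (geodesicLine stdVec _ : ℂ) * _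
      rw [coe_geodesicLine_stdVec, he, hb', hc, hdd]
      push_cast
      field_simp
      ring
    · rw [vec_planeFlow_stdVec, he, hc, hdd]
      have := Complex.I_ne_zero
      push_cast
      field_simp
      ring
  exact ⟨_, by rw [hq, key, ← planeFlow_smul, frame_smul_stdVec]⟩

end HypSurface
end

noncomputable section

namespace HypSurface

open UnitTangentPlane

/-! ### Topology of the surface and of its unit tangent bundle -/

instance (Γ : Subgroup SL(2, ℝ)) : ContinuousConstSMul Γ ℍ :=
  ⟨fun g => continuous_const_smul (g : SL(2, ℝ))⟩

theorem continuous_mobDen (g : SL(2, ℝ)) : Continuous (mobDen g) :=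
  (continuous_const.mul UpperHalfPlane.continuous_coe).add continuous_const

instance : ContinuousConstSMul SL(2, ℝ) UnitTangentPlane := ⟨fun g => by
  refine isInducing_base_vec.continuous_iff.2
    (Continuous.prodMk (f := fun p : UnitTangentPlane => (g • p).base) ?_ ?_)
  · simp only [base_smul]
    exact continuous_base.const_smul g
  · simp only [vec_smul]
    exact continuous_vec.div (((continuous_mobDen g).comp continuous_base).pow 2)
      fun p => pow_ne_zero 2 (mobDen_ne_zero g p.base)⟩

instance (Γ : Subgroup SL(2, ℝ)) : ContinuousConstSMul Γ UnitTangentPlane :=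
  ⟨fun g => continuous_const_smul (g : SL(2, ℝ))⟩

theorem continuous_flowDen : Continuous fun x : ℝ × UnitTangentPlane => flowDen x.1 x.2 := by
  have h : Continuous fun x : ℝ × UnitTangentPlane => (x.2.base.im : ℂ) :=
    Complex.continuous_ofReal.comp
      (UpperHalfPlane.continuous_im.comp (continuous_base.comp continuous_snd))
  have h2 : Continuous fun x : ℝ × UnitTangentPlane => x.2.vec / (x.2.base.im : ℂ) :=
    (continuous_vec.comp continuous_snd).div h fun x => by
      exact_mod_cast x.2.base.im_pos.ne'
  unfold flowDen
  fun_prop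

theorem continuous_planeFlow :
    Continuous fun x : ℝ × UnitTangentPlane => planeFlow x.1 x.2 := by
  refine isInducing_base_vec.continuous_iff.2
    (Continuous.prodMk (f := fun x : ℝ × UnitTangentPlane => (planeFlow x.1 x.2).base) ?_ ?_)
  · refine UpperHalfPlane.isEmbedding_coe.continuous_iff.2 ?_
    change Continuous fun x : ℝ × UnitTangentPlane => ((planeFlow x.1 x.2).base : ℂ)
    simp only [coe_base_planeFlow]
    refine Continuous.add ?_ (Continuous.div ?_ continuous_flowDen fun x => flowDen_ne_zero _ _)
    · exact UpperHalfPlane.continuous_coe.comp (continuous_base.comp continuous_snd)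
    · have := continuous_vec.comp (continuous_snd (X := ℝ) (Y := UnitTangentPlane))
      have h : Continuous fun x : ℝ × UnitTangentPlane => x.2.vec := this
      fun_prop
  · simp only [vec_planeFlow]
    exact (continuous_vec.comp continuous_snd).div (continuous_flowDen.pow 2)
      fun x => pow_ne_zero 2 (flowDen_ne_zero _ _)

theorem continuous_geodesicLine :
    Continuous fun x : UnitTangentPlane × ℝ => geodesicLine x.1 x.2 :=
  continuous_base.comp (continuous_planeFlow.comp continuous_swap)

variable {Γ : Subgroup SL(2, ℝ)}

theorem isOpenQuotientMap_proj : IsOpenQuotientMap (proj Γ) :=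
  MulAction.isOpenQuotientMap_quotientMk

theorem isOpenQuotientMap_tproj : IsOpenQuotientMap (tproj Γ) :=
  MulAction.isOpenQuotientMap_quotientMk

theorem tproj_smul (g : Γ) (p : UnitTangentPlane) : tproj Γ (g • p) = tproj Γ p :=
  Quotient.sound' (s₁ := MulAction.orbitRel Γ UnitTangentPlane) ⟨g, rfl⟩

theorem exists_smul_eq_of_proj_eq {z w : ℍ} (h : proj Γ z = proj Γ w) : ∃ g : Γ, z = g • w := by
  obtain ⟨g, hg⟩ := (Quotient.eq'' (s₁ := MulAction.orbitRel Γ ℍ)).1 h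
  exact ⟨g, hg.symm⟩

instance : SecondCountableTopology (Surface Γ) :=
  ContinuousConstSMul.secondCountableTopology

instance : SecondCountableTopology (UnitTangent Γ) :=
  ContinuousConstSMul.secondCountableTopology

theorem continuous_geodesicFlow :
    Continuous fun x : ℝ × UnitTangent Γ => geodesicFlow Γ x.1 x.2 := by
  refine (IsOpenQuotientMap.prodMap (IsOpenQuotientMap.id (X := ℝ))
    (isOpenQuotientMap_tproj (Γ := Γ))).continuous_comp_iff.1 ?_
  exact isOpenQuotientMap_tproj.continuous.comp continuous_planeFlow

theorem geodesicFlow_add (s t : ℝ) (v : UnitTangent Γ) :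
    geodesicFlow Γ (s + t) v = geodesicFlow Γ s (geodesicFlow Γ t v) := by
  obtain ⟨p, rfl⟩ := isOpenQuotientMap_tproj.surjective v
  simp only [geodesicFlow_tproj, planeFlow_add]

theorem geodesicFlow_zero (v : UnitTangent Γ) : geodesicFlow Γ 0 v = v := by
  obtain ⟨p, rfl⟩ := isOpenQuotientMap_tproj.surjective v
  simp only [geodesicFlow_tproj, planeFlow_zero]

/-! ### Consequences of proper discontinuity and cocompactness -/

namespace IsClosedSurfaceGroup

theorem properlyDiscontinuousSMul_unitTangentPlane (hΓ : IsClosedSurfaceGroup Γ) :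
    ProperlyDiscontinuousSMul Γ UnitTangentPlane := ⟨fun {K L} hK hL => by
  refine (hΓ.properlyDiscontinuous.finite_disjoint_inter_image (hK.image continuous_base)
    (hL.image continuous_base)).subset ?_
  rintro g ⟨_, ⟨p, hp, rfl⟩, hL⟩
  exact ⟨_, ⟨_, ⟨p, hp, rfl⟩, rfl⟩, ⟨_, hL, rfl⟩⟩⟩

theorem t2Space_unitTangent (hΓ : IsClosedSurfaceGroup Γ) : T2Space (UnitTangent Γ) :=
  have := hΓ.properlyDiscontinuousSMul_unitTangentPlane
  inferInstanceAs (T2Space (Quotient (MulAction.orbitRel Γ UnitTangentPlane)))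

theorem exists_closedBall_covers (hΓ : IsClosedSurfaceGroup Γ) :
    ∃ R : ℝ, ∀ z : ℍ, ∃ g : Γ, g • z ∈ Metric.closedBall UpperHalfPlane.I R := by
  have : CompactSpace (Surface Γ) := hΓ.cocompact
  obtain ⟨n, hn⟩ := isCompact_univ.elim_directed_cover
    (fun n : ℕ => proj Γ '' Metric.ball UpperHalfPlane.I n)
    (fun n => isOpenQuotientMap_proj.isOpenMap _ Metric.isOpen_ball)
    (fun x _ => by
      obtain ⟨z, rfl⟩ := isOpenQuotientMap_proj.surjective x
      obtain ⟨n, hn⟩ := exists_nat_gt (dist z UpperHalfPlane.I)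
      exact Set.mem_iUnion.2 ⟨n, z, hn, rfl⟩)
    (Monotone.directed_le fun m n h => Set.image_mono (Metric.ball_subset_ball (by exact_mod_cast h)))
  refine ⟨n, fun z => ?_⟩
  obtain ⟨w, hw, h⟩ := hn (Set.mem_univ (proj Γ z))
  obtain ⟨g, rfl⟩ := exists_smul_eq_of_proj_eq h
  exact ⟨g, Metric.ball_subset_closedBall hw⟩

theorem compactSpace_unitTangent (hΓ : IsClosedSurfaceGroup Γ) : CompactSpace (UnitTangent Γ) := by
  obtain ⟨R, hR⟩ := hΓ.exists_closedBall_covers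
  have hK := isCompact_closedBall UpperHalfPlane.I R
  obtain ⟨B, hB⟩ := (hK.image UpperHalfPlane.continuous_im).isBounded.bddAbove
  have hc : IsCompact ((fun p : UnitTangentPlane => (p.base, p.vec)) ⁻¹'
      (Metric.closedBall UpperHalfPlane.I R ×ˢ Metric.closedBall 0 B)) :=
    isClosedEmbedding_base_vec.isCompact_preimage (hK.prod (isCompact_closedBall _ _))
  refine ⟨?_⟩
  convert hc.image (isOpenQuotientMap_tproj (Γ := Γ)).continuous
  refine (Set.eq_univ_of_forall fun v => ?_).symm
  obtain ⟨p, rfl⟩ := isOpenQuotientMap_tproj.surjective v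
  obtain ⟨g, hg⟩ := hR p.base
  refine ⟨g • p, ⟨hg, ?_⟩, tproj_smul g p⟩
  rw [mem_closedBall_zero_iff]
  change ‖(g • p).vec‖ ≤ B
  rw [norm_vec]
  exact hB ⟨_, hg, rfl⟩

/-- A continuous displacement function which commutes with `Γ` is bounded. -/
theorem exists_dist_le (hΓ : IsClosedSurfaceGroup Γ) {F : ℍ → ℍ} (hF : Continuous F)
    (hFΓ : ∀ (g : Γ) (z : ℍ), F (g • z) = g • F z) : ∃ C, ∀ z, dist z (F z) ≤ C := by
  obtain ⟨R, hR⟩ := hΓ.exists_closedBall_covers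
  obtain ⟨C, hC⟩ := ((isCompact_closedBall UpperHalfPlane.I R).image
    (continuous_id.dist hF)).isBounded.bddAbove
  refine ⟨C, fun z => ?_⟩
  obtain ⟨g, hg⟩ := hR z
  have := hC ⟨_, hg, rfl⟩
  simp only [id, hFΓ] at this
  exact (dist_smul (g : SL(2, ℝ)) z (F z)).symm.trans_le this

/-- The covering projection has a Borel section. -/
theorem exists_measurable_section (hΓ : IsClosedSurfaceGroup Γ) :
    ∃ sec : Surface Γ → ℍ, Measurable sec ∧ ∀ x, proj Γ (sec x) = x := by
  have hloc := (isCoveringMap_proj hΓ).isLocalHomeomorph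
  choose e he heq using hloc
  -- By second countability, countably many local inverses of the covering suffice; they are glued
  -- along a disjointed version of their domains.
  obtain ⟨T, hT, hcov⟩ := TopologicalSpace.isOpen_iUnion_countable
    (fun z => (e z).target) (fun z => (e z).open_target)
  have hun : ⋃ z ∈ T, (e z).target = Set.univ := by
    rw [hcov]
    refine Set.eq_univ_of_forall fun x => ?_
    obtain ⟨z, rfl⟩ := isOpenQuotientMap_proj.surjective x
    refine Set.mem_iUnion.2 ⟨z, ?_⟩
    rw [heq z]
    exact (e z).map_source (he z)
  have hTne : T.Nonempty := by
    by_contra h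
    rw [Set.not_nonempty_iff_eq_empty.1 h] at hun
    simp only [Set.mem_empty_iff_false, Set.iUnion_of_empty, Set.iUnion_empty] at hun
    exact Set.notMem_empty (proj Γ UpperHalfPlane.I) (hun ▸ trivial)
  obtain ⟨c, hc⟩ := hT.exists_eq_range hTne
  classical
  obtain ⟨sec, hs, hse⟩ := exists_measurable_piecewise
    (disjointed fun n => (e (c n)).target)
    (fun n => MeasurableSet.disjointed (fun n => (e (c n)).open_target.measurableSet) n)
    (fun n => (e (c n)).target.piecewise (e (c n)).symm fun _ => UpperHalfPlane.I)
    (fun n => ContinuousOn.measurable_piecewise (e (c n)).continuousOn_symm continuousOn_const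
      (e (c n)).open_target.measurableSet)
    (fun i j hij x hx => absurd hx
      (Set.disjoint_iff_inter_eq_empty.1 (disjoint_disjointed _ hij) ▸ Set.notMem_empty x))
  refine ⟨sec, hs, fun x => ?_⟩
  have hx : x ∈ ⋃ n, disjointed (fun n => (e (c n)).target) n := by
    rw [iUnion_disjointed, ← Set.biUnion_range (f := c) (g := fun z => (e z).target), ← hc, hun]
    trivial
  obtain ⟨n, hn⟩ := Set.mem_iUnion.1 hx
  have hn' : x ∈ (e (c n)).target := disjointed_subset (fun n => (e (c n)).target) n hn
  rw [hse n hn, Set.piecewise_eq_of_mem _ _ _ hn', heq (c n)]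
  exact (e (c n)).right_inv hn'

end IsClosedSurfaceGroup

/-! ### Measurability -/

instance : MeasurableSpace UnitTangentPlane := borel _

instance : BorelSpace UnitTangentPlane := ⟨rfl⟩

section Measurable

variable {X : Type*} [MeasurableSpace X]

theorem measurable_of_base_vec {P : X → UnitTangentPlane} (h₁ : Measurable fun x => (P x).base)
    (h₂ : Measurable fun x => (P x).vec) : Measurable P :=
  isClosedEmbedding_base_vec.measurableEmbedding.measurable_comp_iff.1 (h₁.prodMk h₂)

theorem measurable_upperHalfPlane_of_coe {z : X → ℍ} (h : Measurable fun x => (z x : ℂ)) :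
    Measurable z :=
  UpperHalfPlane.measurableEmbedding_coe.measurable_comp_iff.1 h

theorem Measurable.dirTo {z w : X → ℍ} (hz : Measurable z) (hw : Measurable w) :
    Measurable fun x => dirTo (z x) (w x) := by
  refine measurable_of_base_vec hz ?_
  simp only [vec_dirTo, dirVec]
  have h1 : Measurable fun x => (z x : ℂ) := UpperHalfPlane.measurable_coe.comp hz
  have h2 : Measurable fun x => (w x : ℂ) := UpperHalfPlane.measurable_coe.comp hw
  have h3 : Measurable fun x => ((z x).im : ℂ) :=
    Complex.measurable_ofReal.comp (Complex.measurable_im.comp h1)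
  have h4 : Measurable fun x => (starRingEnd ℂ) (z x : ℂ) :=
    Complex.continuous_conj.measurable.comp h1
  have h5 : Measurable fun x => (Real.tanh (dist (z x) (w x) / 2) : ℂ) :=
    Complex.measurable_ofReal.comp (by
      simp only [Real.tanh_eq_sinh_div_cosh]
      have := (hz.dist hw).div_const 2
      exact (Real.measurable_sinh.comp this).div (Real.measurable_cosh.comp this))
  refine Measurable.ite (measurableSet_eq_fun hw hz) (h3.const_mul _) ?_
  exact ((h3.const_mul _).mul ((h2.sub h1).div (h2.sub h4))).div h5

/-- The branch of the square root in `frameDen` is not continuous, but it is Borel, which is all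
that the selection of geodesics needs. -/
theorem measurable_frame_apply {p : X → UnitTangentPlane} (hp : Measurable p) (i j : Fin 2) :
    Measurable fun x => frame (p x) i j := by
  have h1 : Measurable fun x => ((p x).base : ℂ) :=
    UpperHalfPlane.measurable_coe.comp (continuous_base.measurable.comp hp)
  have h2 : Measurable fun x => (p x).vec := continuous_vec.measurable.comp hp
  have h3 : Measurable fun x => frameDen (p x) := (h2.const_div _).pow_const _
  fin_cases i <;> fin_cases j
  · exact Complex.measurable_im.comp (h1.mul h3)
  · exact Complex.measurable_re.comp (h1.mul h3)
  · exact Complex.measurable_im.comp h3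
  · exact Complex.measurable_re.comp h3

theorem Measurable.joinLine {p q : X → UnitTangentPlane} (hp : Measurable p) (hq : Measurable q) :
    Measurable fun x => joinLine (p x) (q x) := by
  have hd : Measurable fun x => endDet (p x) (q x) :=
    ((measurable_frame_apply hp 0 0).mul (measurable_frame_apply hq 1 0)).sub
      ((measurable_frame_apply hp 1 0).mul (measurable_frame_apply hq 0 0))
  have hs : Measurable fun x => ((SignType.sign (endDet (p x) (q x)) : ℝ)) := by
    have : (fun x => ((SignType.sign (endDet (p x) (q x)) : ℝ))) = fun x =>
        if 0 < endDet (p x) (q x) then 1 else if endDet (p x) (q x) < 0 then -1 else 0 := by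
      funext x
      rw [sign_apply]
      split_ifs <;> simp
    rw [this]
    exact Measurable.ite (measurableSet_lt measurable_const hd) measurable_const
      (Measurable.ite (measurableSet_lt hd measurable_const) measurable_const measurable_const)
  have hl : Measurable fun x => (√|endDet (p x) (q x)|)⁻¹ := (hd.abs.sqrt).inv
  have hS : MeasurableSet {x | endDet (p x) (q x) ≠ 0} := (measurableSet_eq_fun hd measurable_const).compl
  have hden : Measurable fun x => (((√|endDet (p x) (q x)|)⁻¹ * frame (p x) 1 0 : ℝ) : ℂ) * Complex.I +
      (((√|endDet (p x) (q x)|)⁻¹ * SignType.sign (endDet (p x) (q x)) * frame (q x) 1 0 : ℝ) : ℂ) :=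
    ((Complex.measurable_ofReal.comp (hl.mul (measurable_frame_apply hp 1 0))).mul_const _).add
      (Complex.measurable_ofReal.comp ((hl.mul hs).mul (measurable_frame_apply hq 1 0)))
  have hnum : Measurable fun x => (((√|endDet (p x) (q x)|)⁻¹ * frame (p x) 0 0 : ℝ) : ℂ) * Complex.I +
      (((√|endDet (p x) (q x)|)⁻¹ * SignType.sign (endDet (p x) (q x)) * frame (q x) 0 0 : ℝ) : ℂ) :=
    ((Complex.measurable_ofReal.comp (hl.mul (measurable_frame_apply hp 0 0))).mul_const _).add
      (Complex.measurable_ofReal.comp ((hl.mul hs).mul (measurable_frame_apply hq 0 0)))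
  classical
  refine measurable_of_base_vec (measurable_upperHalfPlane_of_coe ?_) ?_
  · have hI := @Measurable.ite _ _ _ _ _ _ (fun x => endDet (p x) (q x) ≠ 0)
      (fun _ => Classical.propDecidable _) hS (hnum.div hden)
      (UpperHalfPlane.measurable_coe.comp (continuous_base.measurable.comp hp))
    convert hI using 2 with x
    rw [HypSurface.joinLine]
    by_cases h : endDet (p x) (q x) ≠ 0
    · rw [dif_pos h, if_pos h, base_smul, coe_smul_eq]
      rfl
    · rw [dif_neg h, if_neg h]
      rfl
  · have hI := @Measurable.ite _ _ _ _ _ _ (fun x => endDet (p x) (q x) ≠ 0)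
      (fun _ => Classical.propDecidable _) hS
      ((hden.pow_const 2).const_div Complex.I) (continuous_vec.measurable.comp hp)
    convert hI using 2 with x
    rw [HypSurface.joinLine]
    by_cases h : endDet (p x) (q x) ≠ 0
    · rw [dif_pos h, if_pos h, vec_smul]
      rfl
    · rw [dif_neg h, if_neg h]
      rfl

end Measurable

end HypSurface
end

noncomputable section

namespace HypSurface

open UnitTangentPlane

/-! ### Tracking -/

theorem tendsto_dist_div_of_dist_le {M : Type*} [PseudoMetricSpace M] {x y w : ℕ → M} {C : ℝ}
    (hC : ∀ n, dist (x n) (y n) ≤ C)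
    (h : Tendsto (fun n : ℕ => dist (y n) (w n) / n) atTop (𝓝 0)) :
    Tendsto (fun n : ℕ => dist (x n) (w n) / n) atTop (𝓝 0) := by
  have h1 : Tendsto (fun n : ℕ => C / n + dist (y n) (w n) / n) atTop (𝓝 (0 + 0)) :=
    (tendsto_const_div_atTop_nhds_zero_nat C).add h
  rw [add_zero] at h1
  refine squeeze_zero (fun n => by positivity) (fun n => ?_) h1
  rw [← add_div]
  gcongr
  exact (dist_triangle _ _ _).trans (add_le_add_left (hC n) _)

theorem tendsto_dist_div_triangle {M : Type*} [PseudoMetricSpace M] {x y w : ℕ → M}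
    (h₁ : Tendsto (fun n : ℕ => dist (x n) (y n) / n) atTop (𝓝 0))
    (h₂ : Tendsto (fun n : ℕ => dist (y n) (w n) / n) atTop (𝓝 0)) :
    Tendsto (fun n : ℕ => dist (x n) (w n) / n) atTop (𝓝 0) := by
  have h1 := h₁.add h₂
  rw [add_zero] at h1
  refine squeeze_zero (fun n => by positivity) (fun n => ?_) h1
  rw [← add_div]
  gcongr
  exact dist_triangle _ _ _

theorem tendsto_dist_div_comm {M : Type*} [PseudoMetricSpace M] {x y : ℕ → M}
    (h : Tendsto (fun n : ℕ => dist (x n) (y n) / n) atTop (𝓝 0)) :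
    Tendsto (fun n : ℕ => dist (y n) (x n) / n) atTop (𝓝 0) :=
  h.congr fun n => by rw [dist_comm]

theorem tracks_unique {F : ℍ ≃ₜ ℍ} {s : ℝ} (hs : 0 < s) {z : ℍ} {p q : UnitTangentPlane}
    (hp : Tracks F s z p) (hq : Tracks F s z q) : ∃ t, q = planeFlow t p :=
  exists_eq_planeFlow hs (tendsto_dist_div_triangle (tendsto_dist_div_comm hp.1) hq.1)
    (tendsto_dist_div_triangle (tendsto_dist_div_comm hp.2) hq.2)

theorem iterate_apply_symm_iterate (F : ℍ ≃ₜ ℍ) (n : ℕ) (z : ℍ) : F^[n] (F.symm^[n] z) = z :=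
  (Function.LeftInverse.iterate F.apply_symm_apply n) z

theorem dist_iterate_succ_le {F : ℍ ≃ₜ ℍ} {C : ℝ} (hC : ∀ z, dist z (F z) ≤ C) (n : ℕ) (z : ℍ) :
    dist (F^[n] z) (F^[n + 1] z) ≤ C := by
  rw [Function.iterate_succ_apply']; exact hC _

theorem dist_symm_le {F : ℍ ≃ₜ ℍ} {C : ℝ} (hC : ∀ z, dist z (F z) ≤ C) (z : ℍ) :
    dist z (F.symm z) ≤ C := by
  simpa [dist_comm] using hC (F.symm z)

/-- Replacing `z` by `F z` shifts the orbit by one index, a displacement bounded by `C` that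
disappears after division by `n`. -/
theorem Tracks.apply {F : ℍ ≃ₜ ℍ} {C : ℝ} (hC : ∀ z, dist z (F z) ≤ C) {s : ℝ} {z : ℍ}
    {p : UnitTangentPlane} (h : Tracks F s z p) : Tracks F s (F z) p := by
  constructor
  · refine tendsto_dist_div_of_dist_le (C := C) (fun n => ?_) h.1
    rw [← Function.iterate_succ_apply, dist_comm]
    exact dist_iterate_succ_le hC n z
  · refine tendsto_dist_div_of_dist_le (C := C) (fun n => ?_) h.2
    have hc : Function.Commute F F.symm := fun w => by simp
    rw [← (hc.iterate_right n).eq z, dist_comm]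
    exact hC _

theorem linePos_div_tendsto {F : ℍ ≃ₜ ℍ} {s : ℝ} {z : ℍ} {p : UnitTangentPlane}
    (h : Tracks F s z p) : Tendsto (fun n : ℕ => linePos p (F^[n] z) / n) atTop (𝓝 s) := by
  rw [tendsto_iff_dist_tendsto_zero]
  refine squeeze_zero' (.of_forall fun n => dist_nonneg) ?_ h.1
  filter_upwards [eventually_gt_atTop 0] with n hn
  have hn0 : (0 : ℝ) < n := by exact_mod_cast hn
  rw [Real.dist_eq, div_sub' hn0.ne', abs_div, abs_of_pos hn0]
  gcongr
  have := abs_linePos_sub_le p (F^[n] z) (geodesicLine p (n * s))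
  rwa [linePos_geodesicLine] at this

/-! ### Existence of tracking geodesics almost everywhere -/

section Lift

variable {Γ : Subgroup SL(2, ℝ)} {f : Surface Γ ≃ₜ Surface Γ} {F : ℍ ≃ₜ ℍ}

namespace IsPreferredLift

theorem iterate_smul (hF : IsPreferredLift Γ f F) (n : ℕ) (g : Γ) (z : ℍ) :
    F^[n] (g • z) = g • F^[n] z :=
  Function.Commute.iterate_left (f := F) (g := (g • ·)) (hF.2 g) n z

theorem symm_smul (hF : IsPreferredLift Γ f F) (g : Γ) (z : ℍ) :
    F.symm (g • z) = g • F.symm z := by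
  rw [Homeomorph.symm_apply_eq, hF.2, Homeomorph.apply_symm_apply]

theorem symm_iterate_smul (hF : IsPreferredLift Γ f F) (n : ℕ) (g : Γ) (z : ℍ) :
    F.symm^[n] (g • z) = g • F.symm^[n] z :=
  Function.Commute.iterate_left (f := F.symm) (g := (g • ·)) (hF.symm_smul g) n z

theorem proj_symm (hF : IsPreferredLift Γ f F) (z : ℍ) : proj Γ (F.symm z) = f.symm (proj Γ z) := by
  rw [Homeomorph.eq_symm_apply, ← hF.1, Homeomorph.apply_symm_apply]

theorem proj_symm_iterate (hF : IsPreferredLift Γ f F) (n : ℕ) (z : ℍ) :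
    proj Γ (F.symm^[n] z) = f.symm^[n] (proj Γ z) :=
  (Function.Semiconj.iterate_right (f := proj Γ) (ga := F.symm) (gb := f.symm) hF.proj_symm n) z

theorem tracks_smul (hF : IsPreferredLift Γ f F) {s : ℝ} {z : ℍ} {p : UnitTangentPlane} (g : Γ)
    (h : Tracks F s z p) : Tracks F s (g • z) (g • p) := by
  have e (t : ℝ) : geodesicLine (g • p) t = g • geodesicLine p t :=
    geodesicLine_smul (g : SL(2, ℝ)) p t
  have e' (z w : ℍ) : dist (g • z) (g • w) = dist z w := dist_smul (g : SL(2, ℝ)) z w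
  simpa only [Tracks, hF.iterate_smul, hF.symm_iterate_smul, e, e'] using h

end IsPreferredLift

theorem tracks_joinLine {s : ℝ} {z : ℍ} {p q : UnitTangentPlane}
    (hs : 0 < s) (hp : Tendsto (fun n : ℕ => dist (F^[n] z) (geodesicLine p (n * s)) / n) atTop (𝓝 0))
    (hq : Tendsto (fun n : ℕ => dist (F.symm^[n] z) (geodesicLine q (n * s)) / n) atTop (𝓝 0))
    (hd : endDet p q ≠ 0) : Tracks F s z (joinLine p q) := by
  obtain ⟨K, hK⟩ := exists_dist_joinLine_le hd
  refine ⟨tendsto_dist_div_triangle hp ?_, tendsto_dist_div_triangle hq ?_⟩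
  · exact squeeze_zero (fun n => by positivity)
      (fun n => by gcongr; exact (hK (n * s) (by positivity)).1)
      (tendsto_const_div_atTop_nhds_zero_nat K)
  · exact squeeze_zero (fun n => by positivity)
      (fun n => by gcongr; exact (hK (n * s) (by positivity)).2)
      (tendsto_const_div_atTop_nhds_zero_nat K)

/-- The geodesics tracked by the forward and by the backward orbit of almost every point
are different: this is the only place where the existence of tracking geodesics
uses the invariant measure. -/
theorem ae_ne_of_tendsto {μ : Measure (Surface Γ)} [IsProbabilityMeasure μ]
    (hf : MeasurePreserving f μ μ) (hF : IsPreferredLift Γ f F) {C : ℝ}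
    (hC : ∀ z, dist z (F z) ≤ C) {s : ℝ} (hs : 0 < s) {sec : Surface Γ → ℍ} (hsec : Measurable sec)
    (hproj : ∀ x, proj Γ (sec x) = x) {P Q : Surface Γ → UnitTangentPlane} (hP : Measurable P)
    (hQ : Measurable Q)
    (hlim : ∀ᵐ x ∂μ, Tendsto (fun n : ℕ => dist (sec x) (F^[n] (sec x)) / n) atTop (𝓝 s) ∧
      Tendsto (fun n : ℕ => dist (sec x) (F.symm^[n] (sec x)) / n) atTop (𝓝 s) ∧
      Tendsto (fun n : ℕ => dist (F^[n] (sec x)) (geodesicLine (P x) (n * s)) / n) atTop (𝓝 0) ∧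
      Tendsto (fun n : ℕ => dist (F.symm^[n] (sec x)) (geodesicLine (Q x) (n * s)) / n)
        atTop (𝓝 0)) : ∀ᵐ x ∂μ, P x ≠ Q x := by
  have hC0 : 0 ≤ C := dist_nonneg.trans (hC UpperHalfPlane.I)
  let L : ℕ → Surface Γ → ℝ := fun n x => dist (sec x) (F^[n] (sec x))
  -- The rotation distance does not depend on the lift, because `F` commutes with `Γ`.
  have hLlift (n : ℕ) (z : ℍ) : L n (proj Γ z) = dist z (F^[n] z) := by
    obtain ⟨g, hg⟩ := exists_smul_eq_of_proj_eq (hproj (proj Γ z))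
    simp only [L, hg, hF.iterate_smul]
    exact dist_smul (g : SL(2, ℝ)) _ _
  have hLm (n : ℕ) : Measurable (L n) :=
    hsec.dist ((F.continuous.iterate n).measurable.comp hsec)
  have hLb (n : ℕ) (x : Surface Γ) : L n x ≤ n * C := by
    have := dist_le_range_sum_of_dist_le (f := fun k => F^[k] (sec x)) (d := fun _ => C) n
      (fun {k} _ => dist_iterate_succ_le hC k _)
    simpa using this
  have hL0 (n : ℕ) (x : Surface Γ) : 0 ≤ L n x := dist_nonneg
  have hLd (n : ℕ) (x : Surface Γ) : |L n x / n| ≤ C := by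
    rw [abs_of_nonneg (div_nonneg (hL0 n x) n.cast_nonneg)]
    rcases n.eq_zero_or_pos with rfl | hn
    · simpa using hC0
    · rw [div_le_iff₀ (by exact_mod_cast hn), mul_comm]; exact hLb n x
  have hLi (n : ℕ) : Integrable (fun x => L n x / n) μ :=
    .of_bound ((hLm n).div_const _).aestronglyMeasurable C (.of_forall (hLd n))
  have hLt : Tendsto (fun n : ℕ => ∫ x, L n x / n ∂μ) atTop (𝓝 s) := by
    have := tendsto_integral_of_dominated_convergence (μ := μ) (F := fun n x => L n x / (n : ℝ))
      (f := fun _ => s) (fun _ => C) (fun n => ((hLm n).div_const _).aestronglyMeasurable)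
      (integrable_const _) (fun n => .of_forall (hLd n)) (hlim.mono fun x hx => hx.1)
    simpa using this
  have hfs (n : ℕ) : MeasurePreserving (f.symm^[n]) μ μ :=
    (hf.symm f.toMeasurableEquiv).iterate n
  -- This is the triangle defect of the points at times `-n`, `0`, `n`, divided by `n`. Written with
  -- `L` and `f.symm^[n]`, its integral is computed by invariance and tends to `s + s - 2 * s = 0`.
  let h : ℕ → Surface Γ → ℝ := fun n x =>
    L n x / n + L n (f.symm^[n] x) / n - 2 * (L (2 * n) (f.symm^[n] x) / (2 * n : ℕ))
  have hb (n : ℕ) (x : Surface Γ) : L n (f.symm^[n] x) = dist (sec x) (F.symm^[n] (sec x)) := by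
    conv_lhs => rw [← hproj x, ← hF.proj_symm_iterate, hLlift, iterate_apply_symm_iterate]
    rw [dist_comm]
  have hc (n : ℕ) (x : Surface Γ) :
      L (2 * n) (f.symm^[n] x) = dist (F^[n] (sec x)) (F.symm^[n] (sec x)) := by
    conv_lhs => rw [← hproj x, ← hF.proj_symm_iterate, hLlift, two_mul, Function.iterate_add_apply,
      iterate_apply_symm_iterate]
    rw [dist_comm]
  have hh (n : ℕ) (x : Surface Γ) : h n x = (dist (sec x) (F^[n] (sec x))) / n +
      dist (sec x) (F.symm^[n] (sec x)) / n -
      dist (F^[n] (sec x)) (F.symm^[n] (sec x)) / n := by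
    simp only [h, hb, hc]
    push_cast
    rw [mul_div_assoc', mul_div_mul_left _ _ (two_ne_zero)]
  have hh0 (n : ℕ) (x : Surface Γ) : 0 ≤ h n x := by
    rw [hh, ← add_div, ← sub_div]
    exact div_nonneg (sub_nonneg.2 (dist_triangle_left _ _ _)) n.cast_nonneg
  have hhb (n : ℕ) (x : Surface Γ) : |h n x| ≤ 2 * C := by
    rw [abs_of_nonneg (hh0 n x)]
    have h1 := abs_le.1 (hLd n x)
    have h2 := abs_le.1 (hLd n (f.symm^[n] x))
    have h3 : 0 ≤ L (2 * n) (f.symm^[n] x) / (2 * n : ℕ) := div_nonneg (hL0 _ _) (Nat.cast_nonneg _)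
    simp only [h]
    linarith
  have hcomp (m n : ℕ) : Integrable (fun x => L m (f.symm^[n] x) / m) μ :=
    ((hfs n).integrable_comp (hLi m).aestronglyMeasurable).2 (hLi m)
  have hcompi (m n : ℕ) : ∫ x, L m (f.symm^[n] x) / m ∂μ = ∫ x, L m x / m ∂μ := by
    rw [← integral_map (φ := f.symm^[n]) (f := fun x => L m x / m) (hfs n).measurable.aemeasurable
      ((hLm m).div_const _).aestronglyMeasurable, (hfs n).map_eq]
  have hhm (n : ℕ) : Measurable (h n) :=
    (((hLm n).div_const _).add (((hLm n).comp (hfs n).measurable).div_const _)).sub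
      ((((hLm (2 * n)).comp (hfs n).measurable).div_const _).const_mul _)
  have hint : Tendsto (fun n => ∫ x, h n x ∂μ) atTop (𝓝 0) := by
    have e (n : ℕ) : ∫ x, h n x ∂μ = ∫ x, L n x / n ∂μ + ∫ x, L n x / n ∂μ -
        2 * ∫ x, L (2 * n) x / (2 * n : ℕ) ∂μ := by
      simp only [h]
      have hi : Integrable (fun x => L n x / n + L n (f.symm^[n] x) / n) μ :=
        (hLi n).add (hcomp n n)
      rw [integral_sub hi ((hcomp (2 * n) n).const_mul 2),
        integral_add (hLi n) (hcomp n n), integral_const_mul, hcompi, hcompi]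
    simp only [e]
    have h2 : Tendsto (fun n : ℕ => 2 * n) atTop atTop :=
      tendsto_id.const_mul_atTop' two_pos
    have := (hLt.add hLt).sub ((hLt.comp h2).const_mul 2)
    rw [show s + s - 2 * s = 0 by ring] at this
    exact this
  let B : Set (Surface Γ) := {x | P x = Q x}
  have hB : MeasurableSet B := measurableSet_eq_fun hP hQ
  -- On `B` both half orbits follow one ray at the same speed, so their points at time `n` are
  -- `o(n)` apart and the defect tends to `2 * s`. As it is nonnegative with integral tending to
  -- zero, `B` is null.
  have hBlim : Tendsto (fun n => ∫ x in B, h n x ∂μ) atTop (𝓝 (∫ x in B, 2 * s ∂μ)) := by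
    refine tendsto_integral_of_dominated_convergence (fun _ => 2 * C)
      (fun n => (hhm n).aestronglyMeasurable) (integrable_const _)
      (fun n => .of_forall (hhb n)) ?_
    filter_upwards [ae_restrict_mem hB, ae_restrict_of_ae hlim] with x hx ⟨h1, h2, h3, h4⟩
    have hx' : P x = Q x := hx
    rw [← hx'] at h4
    have h5 := tendsto_dist_div_triangle h3 (tendsto_dist_div_comm h4)
    have := (h1.add h2).sub h5
    simp only [hh]
    rwa [sub_zero, ← two_mul] at this
  have hle : ∫ x in B, 2 * s ∂μ ≤ 0 := by
    refine le_of_tendsto_of_tendsto' hBlim hint fun n => ?_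
    exact setIntegral_le_integral
      (.of_bound (hhm n).aestronglyMeasurable (2 * C) (.of_forall (hhb n)))
      (.of_forall (hh0 n))
  rw [setIntegral_const, smul_eq_mul] at hle
  have hμB : μ.real B = 0 :=
    le_antisymm (nonpos_of_mul_nonpos_left hle (by positivity)) measureReal_nonneg
  rw [measureReal_eq_zero_iff] at hμB
  exact measure_eq_zero_iff_ae_notMem.1 hμB

/-- Almost every point has a normalized tracking geodesic, which depends measurably on the point. -/
theorem exists_measurable_tracking (hΓ : IsClosedSurfaceGroup Γ) {μ : Measure (Surface Γ)}
    [IsProbabilityMeasure μ] (hf : MeasurePreserving f μ μ) (hF : IsPreferredLift Γ f F) {C : ℝ}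
    (hC : ∀ z, dist z (F z) ≤ C) {s : ℝ} (hs : 0 < s)
    (hspeed : ∀ᵐ x ∂μ, HasRotationSpeed Γ F x s) :
    ∃ (sec : Surface Γ → ℍ) (E : Surface Γ → UnitTangentPlane), Measurable sec ∧ Measurable E ∧
      (∀ x, proj Γ (sec x) = x) ∧
      ∀ᵐ x ∂μ, Tracks F s (sec x) (E x) ∧ linePos (E x) (sec x) = 0 := by
  obtain ⟨sec, hsec, hproj⟩ := hΓ.exists_measurable_section
  have hforward : ∀ᵐ x ∂μ, Tendsto (fun n : ℕ => dist (sec x) (F^[n] (sec x)) / n) atTop (𝓝 s) :=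
    hspeed.mono fun x hx => (hx _ (hproj x)).1
  have hbackward : ∀ᵐ x ∂μ,
      Tendsto (fun n : ℕ => dist (sec x) (F.symm^[n] (sec x)) / n) atTop (𝓝 s) :=
    hspeed.mono fun x hx => by
      have := (hx _ (hproj x)).2
      simpa only [rotationDist, iterate_apply_symm_iterate, dist_comm] using this
  have hjump (z : ℍ) (n : ℕ) := dist_iterate_succ_le hC n z
  have hjump' (z : ℍ) (n : ℕ) := dist_iterate_succ_le (dist_symm_le hC) n z
  obtain ⟨P, hP, hPlim⟩ := measurable_limit_of_tendsto_metrizable_ae (μ := μ) (L := atTop)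
    (f := fun (n : ℕ) x => dirTo (sec x) (F^[n] (sec x)))
    (fun n => (Measurable.dirTo hsec ((F.continuous.iterate n).measurable.comp hsec)).aemeasurable)
    (hforward.mono fun x hx => by
      obtain ⟨p, -, hp⟩ := exists_tendsto_dirTo (x := fun n => F^[n] (sec x)) (hjump _) hs hx
      exact ⟨p, hp⟩)
  obtain ⟨Q, hQ, hQlim⟩ := measurable_limit_of_tendsto_metrizable_ae (μ := μ) (L := atTop)
    (f := fun (n : ℕ) x => dirTo (sec x) (F.symm^[n] (sec x)))
    (fun n => (Measurable.dirTo hsec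
      ((F.symm.continuous.iterate n).measurable.comp hsec)).aemeasurable)
    (hbackward.mono fun x hx => by
      obtain ⟨p, -, hp⟩ := exists_tendsto_dirTo (x := fun n => F.symm^[n] (sec x)) (hjump' _) hs hx
      exact ⟨p, hp⟩)
  have hlim : ∀ᵐ x ∂μ, Tendsto (fun n : ℕ => dist (sec x) (F^[n] (sec x)) / n) atTop (𝓝 s) ∧
      Tendsto (fun n : ℕ => dist (sec x) (F.symm^[n] (sec x)) / n) atTop (𝓝 s) ∧
      Tendsto (fun n : ℕ => dist (F^[n] (sec x)) (geodesicLine (P x) (n * s)) / n) atTop (𝓝 0) ∧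
      Tendsto (fun n : ℕ => dist (F.symm^[n] (sec x)) (geodesicLine (Q x) (n * s)) / n)
        atTop (𝓝 0) := by
    filter_upwards [hforward, hbackward, hPlim, hQlim] with x h1 h2 h3 h4
    exact ⟨h1, h2, tendsto_dist_geodesicLine_div (x := fun n => F^[n] (sec x)) (hjump _) hs h1 h3,
      tendsto_dist_geodesicLine_div (x := fun n => F.symm^[n] (sec x)) (hjump' _) hs h2 h4⟩
  refine ⟨sec, fun x => joinLine (P x) (Q x), hsec, hP.joinLine hQ, hproj, ?_⟩
  filter_upwards [hlim, ae_ne_of_tendsto hf hF hC hs hsec hproj hP hQ hlim, hPlim, hQlim]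
    with x ⟨_, _, h3, h4⟩ hne h5 h6
  have hb : ∀ {p : UnitTangentPlane} {w : ℕ → ℍ},
      Tendsto (fun n => dirTo (sec x) (w n)) atTop (𝓝 p) → p.base = sec x := fun {p w} h =>
    tendsto_nhds_unique ((continuous_base.tendsto p).comp h)
      (tendsto_const_nhds.congr fun n => (base_dirTo _ _).symm)
  have hbP := hb h5
  have hbQ := hb h6
  have hd : endDet (P x) (Q x) ≠ 0 := fun h => hne (eq_of_endDet_eq_zero (hbP.trans hbQ.symm) h)
  refine ⟨tracks_joinLine hs h3 h4 hd, ?_⟩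
  have := linePos_joinLine (hbP.trans hbQ.symm) hd
  rwa [hbP] at this

end Lift

end HypSurface
end

noncomputable section

/-! ### Time averages along sequences of times -/

/-- For a given `T`, the index `⌊s⁻¹ * T⌋₊` has sampling time within `o(T)` of `T`, and a bounded
integrand contributes only `o(T)` over the gap. The times `a n` need not be monotone. -/
theorem tendsto_inv_mul_integral_of_tendsto_nat {G : ℝ → ℝ} (hG : Continuous G) {B : ℝ}
    (hB : ∀ t, |G t| ≤ B) {a : ℕ → ℝ} {s L : ℝ} (hs : 0 < s)
    (ha : Tendsto (fun n : ℕ => a n / n) atTop (𝓝 s))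
    (hL : Tendsto (fun n : ℕ => (∫ t in (0 : ℝ)..a n, G t) / n) atTop (𝓝 L)) :
    Tendsto (fun T : ℝ => T⁻¹ * ∫ t in (0 : ℝ)..T, G t) atTop (𝓝 (s⁻¹ * L)) := by
  have hfl : Tendsto (fun T : ℝ => ⌊s⁻¹ * T⌋₊) atTop atTop :=
    tendsto_nat_floor_atTop.comp (tendsto_id.const_mul_atTop (inv_pos.2 hs))
  have hq : Tendsto (fun T : ℝ => (⌊s⁻¹ * T⌋₊ : ℝ) / T) atTop (𝓝 s⁻¹) :=
    tendsto_nat_floor_mul_div_atTop (inv_pos.2 hs).le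
  have h1 : Tendsto (fun T : ℝ => ((⌊s⁻¹ * T⌋₊ : ℝ) / T) *
      ((∫ t in (0 : ℝ)..a ⌊s⁻¹ * T⌋₊, G t) / (⌊s⁻¹ * T⌋₊ : ℝ))) atTop (𝓝 (s⁻¹ * L)) :=
    hq.mul (hL.comp hfl)
  have h2 : Tendsto (fun T : ℝ => B * |1 - (⌊s⁻¹ * T⌋₊ : ℝ) / T *
      (a ⌊s⁻¹ * T⌋₊ / (⌊s⁻¹ * T⌋₊ : ℝ))|) atTop (𝓝 0) := by
    have := ((tendsto_const_nhds (x := (1 : ℝ))).sub (hq.mul (ha.comp hfl))).abs.const_mul B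
    rw [inv_mul_cancel₀ hs.ne', sub_self, abs_zero, mul_zero] at this
    exact this
  have hint (b c : ℝ) : IntervalIntegrable G volume b c := hG.intervalIntegrable b c
  have h3 : Tendsto (fun T : ℝ => T⁻¹ * (∫ t in (0 : ℝ)..T, G t) - ((⌊s⁻¹ * T⌋₊ : ℝ) / T) *
      ((∫ t in (0 : ℝ)..a ⌊s⁻¹ * T⌋₊, G t) / (⌊s⁻¹ * T⌋₊ : ℝ))) atTop (𝓝 0) := by
    refine squeeze_zero_norm' ?_ h2
    filter_upwards [hfl.eventually_gt_atTop 0, eventually_gt_atTop 0] with T hn hT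
    have hn0 : ((⌊s⁻¹ * T⌋₊ : ℕ) : ℝ) ≠ 0 := by exact_mod_cast hn.ne'
    set n := ⌊s⁻¹ * T⌋₊
    have e : T⁻¹ * (∫ t in (0 : ℝ)..T, G t) - ((n : ℝ) / T) *
        ((∫ t in (0 : ℝ)..a n, G t) / (n : ℝ)) = T⁻¹ * ∫ t in a n..T, G t := by
      rw [← intervalIntegral.integral_interval_sub_left (hint 0 T) (hint 0 (a n))]
      field_simp
    have e2 : |1 - (n : ℝ) / T * (a n / n)| = T⁻¹ * |T - a n| := by
      rw [← abs_of_pos (inv_pos.2 hT), ← abs_mul]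
      congr 1
      field_simp
    rw [e, e2, norm_mul, Real.norm_of_nonneg (inv_pos.2 hT).le, mul_left_comm]
    gcongr
    exact intervalIntegral.norm_integral_le_of_norm_le_const fun t _ => hB t
  have := h3.add h1
  simpa using this

/-! ### Positive functionals on compact spaces -/

section Compact

variable {X : Type*} [TopologicalSpace X] [CompactSpace X] [T2Space X]
  [MeasurableSpace X] [BorelSpace X]

theorem exists_isFiniteMeasure_integral_eq (l : C(X, ℝ) →ₗ[ℝ] ℝ) (hl : ∀ φ, 0 ≤ φ → 0 ≤ l φ) :
    ∃ ν : Measure X, IsFiniteMeasure ν ∧ ∀ φ : C(X, ℝ), ∫ x, φ x ∂ν = l φ := by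
  let k : CompactlySupportedContinuousMap X ℝ →ₚ[ℝ] ℝ := PositiveLinearMap.mk₀
    { toFun := fun φ => l φ.toContinuousMap
      map_add' := fun φ ψ => l.map_add φ.toContinuousMap ψ.toContinuousMap
      map_smul' := fun c φ => l.map_smul c φ.toContinuousMap }
    (fun φ hφ => hl _ hφ)
  refine ⟨RealRMK.rieszMeasure k, inferInstance, fun φ => ?_⟩
  exact RealRMK.integral_rieszMeasure k (CompactlySupportedContinuousMap.continuousMapEquiv φ)

end Compact

/-! ### Equidistribution for cocycles over ergodic transformations -/

namespace Flow

variable {X : Type*} [TopologicalSpace X]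

/-- The orbit of `v` equidistributes to `ν`, forward and backward. -/
def Equidistributes [MeasurableSpace X] (g : Flow ℝ X) (v : X) (ν : Measure X) : Prop :=
  ∀ φ : C(X, ℝ),
    Tendsto (fun T : ℝ => T⁻¹ * ∫ t in (0 : ℝ)..T, φ (g t v)) atTop (𝓝 (∫ w, φ w ∂ν)) ∧
    Tendsto (fun T : ℝ => T⁻¹ * ∫ t in (-T)..(0 : ℝ), φ (g t v)) atTop (𝓝 (∫ w, φ w ∂ν))

theorem continuous_comp_orbit (g : Flow ℝ X) (v : X) (φ : C(X, ℝ)) :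
    Continuous fun t => φ (g t v) :=
  φ.continuous.comp (g.continuous continuous_id continuous_const)

/-- The integral of a function along the orbit segment of length `T`. -/
def orbitIntegral (g : Flow ℝ X) (φ : C(X, ℝ)) (T : ℝ) (v : X) : ℝ :=
  ∫ t in (0 : ℝ)..T, φ (g t v)

theorem orbitIntegral_add (g : Flow ℝ X) (φ : C(X, ℝ)) (a b : ℝ) (v : X) :
    g.orbitIntegral φ (a + b) v = g.orbitIntegral φ a v + g.orbitIntegral φ b (g a v) := by
  simp only [orbitIntegral, ← g.map_add]
  rw [intervalIntegral.integral_comp_add_right (fun t => φ (g t v)), zero_add, add_comm b a,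
    intervalIntegral.integral_add_adjacent_intervals] <;>
  exact (g.continuous_comp_orbit v φ).intervalIntegrable _ _

theorem orbitIntegral_reverse (g : Flow ℝ X) (φ : C(X, ℝ)) (T : ℝ) (v : X) :
    g.reverse.orbitIntegral φ T v = ∫ t in (-T)..(0 : ℝ), φ (g t v) := by
  simp only [orbitIntegral, reverse_apply]
  rw [intervalIntegral.integral_comp_neg (fun t => φ (g t v)), neg_zero]

/-- The same orbit segment, run from its end point; it lets backward averages be treated as forward
averages of the reversed flow. -/
theorem orbitIntegral_reverse_apply (g : Flow ℝ X) (φ : C(X, ℝ)) (T : ℝ) (v : X) :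
    g.reverse.orbitIntegral φ T (g T v) = g.orbitIntegral φ T v := by
  rw [orbitIntegral_reverse]
  simp only [← g.map_add]
  rw [intervalIntegral.integral_comp_add_right (fun t => φ (g t v)), neg_add_cancel, zero_add]
  rfl

theorem abs_orbitIntegral_le [CompactSpace X] (g : Flow ℝ X) (φ : C(X, ℝ)) {T C : ℝ}
    (hT : |T| ≤ C) (v : X) : |g.orbitIntegral φ T v| ≤ ‖φ‖ * C := by
  have h := intervalIntegral.norm_integral_le_of_norm_le_const (a := 0) (b := T)
    (f := fun t => φ (g t v)) (C := ‖φ‖) fun t _ => φ.norm_coe_le_norm _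
  rw [sub_zero] at h
  exact h.trans (by gcongr)

theorem continuous_orbitIntegral (g : Flow ℝ X) (φ : C(X, ℝ)) :
    Continuous fun p : ℝ × X => g.orbitIntegral φ p.1 p.2 := by
  refine intervalIntegral.continuous_parametric_intervalIntegral_of_continuous
    (f := fun (p : ℝ × X) t => φ (g t p.2)) ?_ continuous_fst
  exact φ.continuous.comp (g.continuous continuous_snd (continuous_snd.comp continuous_fst))

theorem equidistributes_iff [MeasurableSpace X] {g : Flow ℝ X} {v : X} {ν : Measure X} :
    g.Equidistributes v ν ↔ ∀ φ : C(X, ℝ),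
      Tendsto (fun T : ℝ => T⁻¹ * g.orbitIntegral φ T v) atTop (𝓝 (∫ w, φ w ∂ν)) ∧
      Tendsto (fun T : ℝ => T⁻¹ * g.reverse.orbitIntegral φ T v) atTop (𝓝 (∫ w, φ w ∂ν)) := by
  simp only [orbitIntegral_reverse]
  rfl

/-- The support of an invariant measure is invariant. -/
theorem preimage_support [MeasurableSpace X] [OpensMeasurableSpace X] (g : Flow ℝ X) {ν : Measure X}
    (hν : ∀ t, MeasurePreserving (g t) ν ν) (t : ℝ) : g t ⁻¹' ν.support = ν.support := by
  have key (t : ℝ) : ν.support ⊆ g t ⁻¹' ν.support := by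
    intro w hw
    rw [Set.mem_preimage, (nhds_basis_opens _).mem_measureSupport]
    rintro U ⟨hwU, hU⟩
    rw [← (hν t).measure_preimage hU.measurableSet.nullMeasurableSet]
    exact (Measure.mem_support_iff_forall w).1 hw _
      ((hU.preimage (g.continuous continuous_const continuous_id)).mem_nhds hwU)
  refine Set.Subset.antisymm (fun w hw => ?_) (key t)
  have := key (-t) hw
  rwa [Set.mem_preimage, ← g.map_add, neg_add_cancel, g.map_zero_apply] at this

section Averages

variable [CompactSpace X]

theorem tendsto_average_shift (g : Flow ℝ X) (φ : C(X, ℝ)) (v : X) (a : ℝ) {L : ℝ}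
    (h : Tendsto (fun T : ℝ => T⁻¹ * g.orbitIntegral φ T v) atTop (𝓝 L)) :
    Tendsto (fun T : ℝ => T⁻¹ * g.orbitIntegral φ T (g a v)) atTop (𝓝 L) := by
  have e (T : ℝ) : T⁻¹ * g.orbitIntegral φ T (g a v) = T⁻¹ * g.orbitIntegral φ T v +
      T⁻¹ * (g.orbitIntegral φ a (g T v) - g.orbitIntegral φ a v) := by
    have h1 := g.orbitIntegral_add φ a T v
    have h2 := g.orbitIntegral_add φ T a v
    rw [add_comm T a] at h2
    rw [← mul_add]
    congr 1
    linarith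
  simp only [e]
  have h0 : Tendsto (fun T : ℝ => T⁻¹ * (g.orbitIntegral φ a (g T v) - g.orbitIntegral φ a v))
      atTop (𝓝 0) := by
    have h1 : Tendsto (fun T : ℝ => |T⁻¹| * (‖φ‖ * |a| + ‖φ‖ * |a|)) atTop (𝓝 0) := by
      have := (tendsto_inv_atTop_zero (𝕜 := ℝ)).abs.mul_const (‖φ‖ * |a| + ‖φ‖ * |a|)
      rwa [abs_zero, zero_mul] at this
    refine squeeze_zero_norm (fun T => ?_) h1
    rw [Real.norm_eq_abs, abs_mul]
    gcongr
    exact (abs_sub _ _).trans (add_le_add (g.abs_orbitIntegral_le φ le_rfl _)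
      (g.abs_orbitIntegral_le φ le_rfl _))
  simpa using h.add h0

variable [MeasurableSpace X]

theorem Equidistributes.shift {g : Flow ℝ X} {v : X} {ν : Measure X} (h : g.Equidistributes v ν)
    (a : ℝ) : g.Equidistributes (g a v) ν := by
  rw [equidistributes_iff] at h ⊢
  refine fun φ => ⟨g.tendsto_average_shift φ v a (h φ).1, ?_⟩
  have := g.reverse.tendsto_average_shift φ v (-a) (h φ).2
  rwa [reverse_apply, neg_neg] at this

/-- Averages and integrals are 1-Lipschitz in the uniform norm, so countably many test functions
suffice and one null set serves all of them. -/
theorem tendsto_average_of_denseRange [OpensMeasurableSpace X] (g : Flow ℝ X) {v : X}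
    {ν : Measure X} [IsProbabilityMeasure ν]
    {u : ℕ → C(X, ℝ)} (hu : DenseRange u)
    (h : ∀ k, Tendsto (fun T : ℝ => T⁻¹ * g.orbitIntegral (u k) T v) atTop (𝓝 (∫ w, u k w ∂ν)))
    (φ : C(X, ℝ)) :
    Tendsto (fun T : ℝ => T⁻¹ * g.orbitIntegral φ T v) atTop (𝓝 (∫ w, φ w ∂ν)) := by
  have hint (ψ : C(X, ℝ)) : Integrable ψ ν :=
    .of_bound ψ.continuous.measurable.aestronglyMeasurable ‖ψ‖ (.of_forall ψ.norm_coe_le_norm)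
  rw [Metric.tendsto_nhds]
  intro ε hε
  obtain ⟨k, hk⟩ := hu.exists_dist_lt φ (by positivity : 0 < ε / 4)
  rw [dist_eq_norm] at hk
  filter_upwards [Metric.tendsto_nhds.1 (h k) (ε / 4) (by positivity), eventually_gt_atTop 0]
    with T h1 hT
  have h2 : |T⁻¹ * g.orbitIntegral φ T v - T⁻¹ * g.orbitIntegral (u k) T v| ≤ ε / 4 := by
    have e : g.orbitIntegral φ T v - g.orbitIntegral (u k) T v =
        g.orbitIntegral (φ - u k) T v := by
      simp only [orbitIntegral, ContinuousMap.sub_apply]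
      rw [intervalIntegral.integral_sub] <;>
      exact (g.continuous_comp_orbit v _).intervalIntegrable _ _
    rw [← mul_sub, e, abs_mul, abs_of_pos (inv_pos.2 hT), inv_mul_le_iff₀ hT]
    refine (g.abs_orbitIntegral_le _ (abs_of_pos hT).le v).trans ?_
    rw [mul_comm]
    gcongr
  have h3 : |∫ w, u k w ∂ν - ∫ w, φ w ∂ν| ≤ ε / 4 := by
    rw [← integral_sub (hint _) (hint _)]
    have h4 := norm_integral_le_of_norm_le_const (μ := ν) (f := fun w => u k w - φ w) (C := ε / 4)
      (.of_forall fun w => by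
        have := (φ - u k).norm_coe_le_norm w
        rw [ContinuousMap.sub_apply] at this
        rw [norm_sub_rev]
        exact this.trans hk.le)
    rwa [probReal_univ, mul_one] at h4
  rw [Real.dist_eq] at h1 ⊢
  have h4 := abs_le.1 h2
  have h5 := abs_le.1 h3
  have h6 := abs_lt.1 h1
  rw [abs_lt]
  constructor <;> linarith

/-- The support of `ν` is contained in the closure of every orbit which equidistributes to `ν`. -/
theorem Equidistributes.support_subset [T2Space X] [OpensMeasurableSpace X] {g : Flow ℝ X} {v : X}
    {ν : Measure X} [IsProbabilityMeasure ν] (h : g.Equidistributes v ν) :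
    ν.support ⊆ closure (Set.range fun t => g t v) := by
  intro w hw
  by_contra hwK
  -- A Urysohn function vanishing on the orbit has zero averages, but its integral is positive if it
  -- equals one at a point of the support.
  obtain ⟨φ, h0, h1, h01⟩ := exists_continuous_zero_one_of_isClosed
    (isClosed_closure (s := Set.range fun t => g t v)) (isClosed_singleton (x := w))
    (Set.disjoint_singleton_right.2 hwK)
  have hφ0 (t : ℝ) : φ (g t v) = 0 := h0 (subset_closure ⟨t, rfl⟩)
  have hint : ∫ w, φ w ∂ν = 0 := by
    refine tendsto_nhds_unique (h φ).1 ?_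
    simp [hφ0]
  rw [integral_eq_zero_iff_of_nonneg (fun x => (h01 x).1)
    (.of_bound φ.continuous.measurable.aestronglyMeasurable ‖φ‖
      (.of_forall φ.norm_coe_le_norm))] at hint
  have hpos := (Measure.mem_support_iff_forall w).1 hw {x | φ x ≠ 0}
    ((isOpen_ne_fun φ.continuous continuous_const).mem_nhds (by
      change φ w ≠ 0
      rw [h1 rfl]; simp))
  exact hpos.ne' hint

end Averages

end Flow
end

noncomputable section

/-! ### The limit measure of a cocycle with values in a flow -/

namespace Flow

/-- `T` may be negative, so the signed integral is compared with that over the full symmetric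
interval. -/
theorem orbitIntegral_le {X : Type*} [TopologicalSpace X] (g : Flow ℝ X)
    {φ : C(X, ℝ)} (hφ : 0 ≤ φ) {T C : ℝ} (hT : |T| ≤ C) (w : X) :
    g.orbitIntegral φ T w ≤ ∫ t in Set.Icc (-C) C, φ (g t w) := by
  have h := intervalIntegral.norm_integral_le_integral_norm_uIoc (μ := volume) (a := 0) (b := T)
    (f := fun t => φ (g t w))
  refine (le_abs_self _).trans (h.trans ?_)
  have hn : (fun t => ‖φ (g t w)‖) = fun t => φ (g t w) :=
    funext fun t => Real.norm_of_nonneg (hφ _)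
  rw [hn]
  refine setIntegral_mono_set ((g.continuous_comp_orbit w φ).integrableOn_Icc)
    (.of_forall fun t => hφ _) (LE.le.eventuallyLE ?_)
  intro t ht
  have := abs_le.1 hT
  rcases Set.mem_uIoc.1 ht with h | h <;> constructor <;> linarith [h.1, h.2]

variable {S X : Type*} [MeasurableSpace S] {μ : Measure S} {f : S ≃ᵐ S}
  [TopologicalSpace X] [MeasurableSpace X] {g : Flow ℝ X} {v : S → X} {τ : S → ℝ} {C s : ℝ}

/-- Orbit segments of bounded length, with their starting points distributed according to `μ`. -/
def segmentMeasure (g : Flow ℝ X) (v : S → X) (C : ℝ) (μ : Measure S) : Measure X :=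
  (μ.prod (volume.restrict (Set.Icc (-C) C))).map fun p => g p.2 (v p.1)

theorem isFiniteMeasure_segmentMeasure [IsFiniteMeasure μ] : IsFiniteMeasure (segmentMeasure g v C μ) := by
  have : IsFiniteMeasure (volume.restrict (Set.Icc (-C) C)) := ⟨by simp⟩
  unfold segmentMeasure
  infer_instance

variable [BorelSpace X]

theorem measurable_orbitIntegral_comp (g : Flow ℝ X) (φ : C(X, ℝ)) (hv : Measurable v)
    (hτ : Measurable τ) : Measurable fun x => g.orbitIntegral φ (τ x) (v x) :=
  (g.continuous_orbitIntegral φ).measurable.comp (hτ.prodMk hv)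

/-- Why backward and forward averages have the same limit: over `f.symm` the reversed flow has
cocycle `τ ∘ f.symm`, and after the substitution `y = f x` it runs through the segment from `v x` to
`v (f x)` in the other direction. -/
theorem integral_reverse_eq (hf : MeasurePreserving f μ μ) (hv : Measurable v) (hτ : Measurable τ)
    (hcoc : ∀ᵐ x ∂μ, v (f x) = g (τ x) (v x)) (φ : C(X, ℝ)) :
    ∫ y, g.reverse.orbitIntegral φ (τ (f.symm y)) (v y) ∂μ =
      ∫ y, g.orbitIntegral φ (τ y) (v y) ∂μ := by
  have h := integral_map (μ := μ) (φ := f) (f := fun y => g.reverse.orbitIntegral φ (τ (f.symm y)) (v y))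
    hf.measurable.aemeasurable
    (g.reverse.measurable_orbitIntegral_comp φ hv (hτ.comp f.symm.measurable)).aestronglyMeasurable
  rw [hf.map_eq] at h
  rw [h]
  refine integral_congr_ae ?_
  filter_upwards [hcoc] with x hx
  simp only [MeasurableEquiv.symm_apply_apply]
  rw [hx, orbitIntegral_reverse_apply]

theorem measurable_segment (g : Flow ℝ X) (hv : Measurable v) :
    Measurable fun p : S × ℝ => g p.2 (v p.1) :=
  (g.continuous continuous_fst continuous_snd).measurable.comp
    (measurable_snd.prodMk (hv.comp measurable_fst))

theorem segmentMeasure_eq_zero (hv : Measurable v) {A : Set X} (hA : MeasurableSet A)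
    (hinv : ∀ t, g t ⁻¹' A = A) (h : ∀ᵐ x ∂μ, v x ∉ A) : segmentMeasure g v C μ A = 0 := by
  rw [segmentMeasure, Measure.map_apply (measurable_segment g hv) hA]
  have e : (fun p : S × ℝ => g p.2 (v p.1)) ⁻¹' A = (v ⁻¹' A) ×ˢ Set.univ := by
    ext ⟨x, t⟩
    have : v x ∈ g t ⁻¹' A ↔ v x ∈ A := by rw [hinv t]
    simpa using this
  rw [e, Measure.prod_prod, show μ (v ⁻¹' A) = 0 from measure_eq_zero_iff_ae_notMem.2 h, zero_mul]

variable [IsProbabilityMeasure μ] [CompactSpace X]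

theorem integrable_orbitIntegral_comp (g : Flow ℝ X) (φ : C(X, ℝ)) (hv : Measurable v)
    (hτ : Measurable τ) (hC : ∀ x, |τ x| ≤ C) :
    Integrable (fun x => g.orbitIntegral φ (τ x) (v x)) μ :=
  .of_bound (g.measurable_orbitIntegral_comp φ hv hτ).aestronglyMeasurable (‖φ‖ * C)
    (.of_forall fun x => g.abs_orbitIntegral_le φ (hC x) _)

/-- Time averages along the orbits of a flow, sampled by a cocycle over an ergodic
transformation. -/
theorem ae_tendsto_average (hf : Ergodic f μ) (hv : Measurable v) (hτ : Measurable τ)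
    (hC : ∀ x, |τ x| ≤ C) (hcoc : ∀ᵐ x ∂μ, v (f x) = g (τ x) (v x)) (hs : 0 < s)
    (hτs : ∫ x, τ x ∂μ = s) (φ : C(X, ℝ)) :
    ∀ᵐ x ∂μ, Tendsto (fun T : ℝ => T⁻¹ * g.orbitIntegral φ T (v x)) atTop
      (𝓝 (s⁻¹ * ∫ y, g.orbitIntegral φ (τ y) (v y) ∂μ)) := by
  have horb : ∀ᵐ x ∂μ, ∀ n : ℕ, v (f (f^[n] x)) = g (τ (f^[n] x)) (v (f^[n] x)) :=
    ae_all_iff.2 fun n => (hf.toMeasurePreserving.iterate n).quasiMeasurePreserving.ae hcoc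
  filter_upwards [horb, hf.ae_tendsto_birkhoffSum_div hτ hC,
    hf.ae_tendsto_birkhoffSum_div (g.measurable_orbitIntegral_comp φ hv hτ)
      (fun x => g.abs_orbitIntegral_le φ (hC x) (v x))] with x hx h1 h2
  -- The segments between consecutive `v (f^[n] x)` concatenate, with signs, into one segment of the
  -- orbit of `v x`, so both Birkhoff theorems speak of the integral along it at the sampling times.
  have key (n : ℕ) : v (f^[n] x) = g (birkhoffSum f τ n x) (v x) ∧
      birkhoffSum f (fun y => g.orbitIntegral φ (τ y) (v y)) n x =
        g.orbitIntegral φ (birkhoffSum f τ n x) (v x) := by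
    induction n with
    | zero => simp [orbitIntegral, g.map_zero_apply]
    | succ n ih =>
      rw [birkhoffSum_succ, birkhoffSum_succ, g.orbitIntegral_add, ← ih.1, ih.2,
        Function.iterate_succ_apply', hx n, add_comm, g.map_add, ← ih.1]
      exact ⟨rfl, rfl⟩
  rw [hτs] at h1
  simp only [(key _).2] at h2
  exact tendsto_inv_mul_integral_of_tendsto_nat (g.continuous_comp_orbit (v x) φ)
    (fun t => φ.norm_coe_le_norm _) hs h1 h2

theorem integral_orbitIntegral_le (hv : Measurable v) (hτ : Measurable τ)
    (hC : ∀ x, |τ x| ≤ C) {φ : C(X, ℝ)} (hφ : 0 ≤ φ) :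
    ∫ x, g.orbitIntegral φ (τ x) (v x) ∂μ ≤ ∫ w, φ w ∂(segmentMeasure g v C μ) := by
  have hm := measurable_segment g hv
  have : IsFiniteMeasure (volume.restrict (Set.Icc (-C) C)) := ⟨by simp⟩
  have hi : Integrable (fun p : S × ℝ => φ (g p.2 (v p.1)))
      (μ.prod (volume.restrict (Set.Icc (-C) C))) :=
    .of_bound (φ.continuous.measurable.comp hm).aestronglyMeasurable ‖φ‖
      (.of_forall fun p => φ.norm_coe_le_norm _)
  rw [segmentMeasure, integral_map hm.aemeasurable φ.continuous.measurable.aestronglyMeasurable,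
    integral_prod _ hi]
  exact integral_mono (g.integrable_orbitIntegral_comp φ hv hτ hC) hi.integral_prod_left
    fun x => g.orbitIntegral_le hφ (hC x) _

variable [T2Space X] [SecondCountableTopology X]

/-- The dichotomy also records on which side `v x` lies; applied to the support of `ν`, this places
`v x` in it. -/
theorem exists_measure_of_cocycle (hf : Ergodic f μ) (hv : Measurable v) (hτ : Measurable τ)
    (hC : ∀ x, |τ x| ≤ C) (hcoc : ∀ᵐ x ∂μ, v (f x) = g (τ x) (v x)) (hs : 0 < s)
    (hτs : ∫ x, τ x ∂μ = s) :
    ∃ ν : Measure X, IsProbabilityMeasure ν ∧ (∀ᵐ x ∂μ, g.Equidistributes (v x) ν) ∧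
      (∀ t, MeasurePreserving (g t) ν ν) ∧
      ∀ A, MeasurableSet A → (∀ t, g t ⁻¹' A = A) →
        (ν A = 0 ∧ ∀ᵐ x ∂μ, v x ∉ A) ∨ (ν Aᶜ = 0 ∧ ∀ᵐ x ∂μ, v x ∈ A) := by
  let _ := TopologicalSpace.metrizableSpaceMetric X
  have hfwd (φ : C(X, ℝ)) := ae_tendsto_average hf hv hτ hC hcoc hs hτs φ
  have hbwd (φ : C(X, ℝ)) : ∀ᵐ x ∂μ,
      Tendsto (fun T : ℝ => T⁻¹ * g.reverse.orbitIntegral φ T (v x)) atTop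
        (𝓝 (s⁻¹ * ∫ y, g.orbitIntegral φ (τ y) (v y) ∂μ)) := by
    rw [← integral_reverse_eq hf.toMeasurePreserving hv hτ hcoc φ]
    refine ae_tendsto_average (f := f.symm) (τ := fun y => τ (f.symm y)) hf.symm hv
      (hτ.comp f.symm.measurable) (fun x => hC _) ?_ hs ?_ φ
    · filter_upwards [hf.symm.toMeasurePreserving.quasiMeasurePreserving.ae hcoc] with x hx
      rw [MeasurableEquiv.apply_symm_apply] at hx
      rw [hx, reverse_apply, ← g.map_add, neg_add_cancel, g.map_zero_apply]
    · rw [← hτs, ← integral_map (φ := f.symm) (f := τ) f.symm.measurable.aemeasurable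
        hτ.aestronglyMeasurable, hf.symm.toMeasurePreserving.map_eq]
  let l : C(X, ℝ) →ₗ[ℝ] ℝ :=
    { toFun := fun φ => s⁻¹ * ∫ y, g.orbitIntegral φ (τ y) (v y) ∂μ
      map_add' := fun φ ψ => by
        have e (y : S) : g.orbitIntegral (φ + ψ) (τ y) (v y) =
            g.orbitIntegral φ (τ y) (v y) + g.orbitIntegral ψ (τ y) (v y) := by
          simp only [orbitIntegral, ContinuousMap.add_apply]
          exact intervalIntegral.integral_add
            ((g.continuous_comp_orbit _ φ).intervalIntegrable _ _)
            ((g.continuous_comp_orbit _ ψ).intervalIntegrable _ _)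
        simp only [e]
        rw [integral_add (g.integrable_orbitIntegral_comp φ hv hτ hC)
          (g.integrable_orbitIntegral_comp ψ hv hτ hC), mul_add]
      map_smul' := fun c φ => by
        have e (y : S) : g.orbitIntegral (c • φ) (τ y) (v y) =
            c * g.orbitIntegral φ (τ y) (v y) := by
          simp only [orbitIntegral, ContinuousMap.smul_apply, smul_eq_mul]
          exact intervalIntegral.integral_const_mul _ _
        simp only [e, integral_const_mul, RingHom.id_apply, smul_eq_mul]
        ring }
  -- The integrand of `l` can be negative where `τ` is; positivity comes from `l φ` being a limit of
  -- time averages.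
  have hl (φ : C(X, ℝ)) (hφ : 0 ≤ φ) : 0 ≤ l φ := by
    obtain ⟨x, hx⟩ := (hfwd φ).exists
    refine ge_of_tendsto hx ?_
    filter_upwards [eventually_ge_atTop 0] with T hT
    exact mul_nonneg (inv_nonneg.2 hT)
      (intervalIntegral.integral_nonneg hT fun t _ => hφ _)
  obtain ⟨ν, hνfin, hν⟩ := exists_isFiniteMeasure_integral_eq l hl
  have hνp : IsProbabilityMeasure ν := by
    have h1 := hν 1
    have e (y : S) : g.orbitIntegral 1 (τ y) (v y) = τ y := by simp [orbitIntegral]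
    have h2 : l 1 = 1 := by
      change s⁻¹ * ∫ y, g.orbitIntegral 1 (τ y) (v y) ∂μ = 1
      simp only [e]
      rw [hτs, inv_mul_cancel₀ hs.ne']
    rw [h2] at h1
    simp only [ContinuousMap.one_apply, integral_const, smul_eq_mul, mul_one] at h1
    exact ⟨by rw [← ENNReal.toReal_eq_one_iff]; exact h1⟩
  have hequi : ∀ᵐ x ∂μ, g.Equidistributes (v x) ν := by
    have : Nonempty X := ⟨v (hfwd 0).exists.choose⟩
    obtain ⟨u, hu⟩ := TopologicalSpace.exists_dense_seq C(X, ℝ)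
    filter_upwards [ae_all_iff.2 fun k => hfwd (u k), ae_all_iff.2 fun k => hbwd (u k)]
      with x h1 h2
    refine equidistributes_iff.2 fun φ => ⟨?_, ?_⟩
    · refine g.tendsto_average_of_denseRange hu (fun k => ?_) φ
      rw [hν]; exact h1 k
    · refine g.reverse.tendsto_average_of_denseRange hu (fun k => ?_) φ
      rw [hν]; exact h2 k
  have hcont (t : ℝ) : Continuous (g t) := g.continuous continuous_const continuous_id
  have hpres (t : ℝ) : MeasurePreserving (g t) ν ν := by
    refine ⟨(hcont t).measurable, ?_⟩
    have := Measure.isFiniteMeasure_map ν (g t)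
    refine ext_of_forall_integral_eq_of_IsFiniteMeasure fun φ => ?_
    rw [integral_map (hcont t).measurable.aemeasurable
      φ.continuous.measurable.aestronglyMeasurable]
    obtain ⟨x, hx⟩ := hequi.exists
    have h1 := ((hx.shift t) φ.toContinuousMap).1
    have h2 := (hx (φ.toContinuousMap.comp ⟨g t, hcont t⟩)).1
    refine tendsto_nhds_unique h2 (h1.congr fun T => ?_)
    -- Averaging `φ ∘ g t` along an orbit is averaging `φ` along the shifted orbit, which
    -- equidistributes to the same `ν`.
    simp only [ContinuousMap.comp_apply, ContinuousMap.coe_mk, ← g.map_add, add_comm]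
  have hfinρ : IsFiniteMeasure (segmentMeasure g v C μ) := isFiniteMeasure_segmentMeasure
  have hint (m : Measure X) [IsFiniteMeasure m] (φ : C(X, ℝ)) : Integrable φ m :=
    .of_bound φ.continuous.measurable.aestronglyMeasurable ‖φ‖ (.of_forall φ.norm_coe_le_norm)
  -- `ν` is dominated by a multiple of the measure on orbit segments
  have hnull (A : Set X) (hA : segmentMeasure g v C μ A = 0) : ν A = 0 := by
    let ρ := segmentMeasure g v C μ
    let l' : C(X, ℝ) →ₗ[ℝ] ℝ :=
      { toFun := fun φ => s⁻¹ * ∫ w, φ w ∂ρ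
        map_add' := fun φ ψ => by
          simp only [ContinuousMap.add_apply]
          rw [integral_add (hint ρ φ) (hint ρ ψ), mul_add]
        map_smul' := fun c φ => by
          simp only [ContinuousMap.smul_apply, smul_eq_mul, integral_const_mul, RingHom.id_apply]
          ring }
    -- The difference of the two functionals is positive, hence is itself a measure `σ'`, and `ν +
    -- σ'` is a multiple of `ρ`.
    obtain ⟨σ', hσfin, hσ⟩ := exists_isFiniteMeasure_integral_eq (l' - l) (fun φ hφ => by
      rw [LinearMap.sub_apply, sub_nonneg]
      exact mul_le_mul_of_nonneg_left (integral_orbitIntegral_le hv hτ hC hφ) (inv_pos.2 hs).le)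
    have hsum : ν + σ' = (ENNReal.ofReal s⁻¹) • ρ := by
      have : IsFiniteMeasure ((ENNReal.ofReal s⁻¹) • ρ) := Measure.smul_finite ρ ENNReal.ofReal_ne_top
      refine ext_of_forall_integral_eq_of_IsFiniteMeasure fun φ => ?_
      have h1 := hν φ.toContinuousMap
      have h2 := hσ φ.toContinuousMap
      rw [integral_add_measure (f := fun w => φ w) (hint ν φ.toContinuousMap)
          (hint σ' φ.toContinuousMap),
        integral_smul_measure, ENNReal.toReal_ofReal (inv_pos.2 hs).le, smul_eq_mul]
      rw [LinearMap.sub_apply] at h2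
      change ∫ w, φ w ∂ν = _ at h1
      change ∫ w, φ w ∂σ' = s⁻¹ * ∫ w, φ w ∂ρ - _ at h2
      rw [h1, h2]
      ring
    have h0 : (ν + σ') A = 0 := by
      rw [hsum, Measure.smul_apply, show ρ A = 0 from hA, smul_zero]
    exact le_antisymm ((Measure.le_add_right le_rfl A).trans h0.le) zero_le
  refine ⟨ν, hνp, hequi, hpres, fun A hA hinv => ?_⟩
  have hB : f ⁻¹' (v ⁻¹' A) =ᵐ[μ] v ⁻¹' A := by
    filter_upwards [hcoc] with x hx
    have : v x ∈ g (τ x) ⁻¹' A ↔ v x ∈ A := by rw [hinv]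
    refine propext ?_
    change v (f x) ∈ A ↔ v x ∈ A
    rw [hx]
    exact this
  rcases hf.quasiErgodic.ae_empty_or_univ₀ (hv hA).nullMeasurableSet hB with h | h
  · have h' : ∀ᵐ x ∂μ, v x ∉ A := measure_eq_zero_iff_ae_notMem.1 (ae_eq_empty.1 h)
    exact .inl ⟨hnull A (segmentMeasure_eq_zero hv hA hinv h'), h'⟩
  · have h' : ∀ᵐ x ∂μ, v x ∈ A := eventuallyEq_univ.1 h
    refine .inr ⟨hnull _ (segmentMeasure_eq_zero hv hA.compl (fun t => ?_) ?_), h'⟩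
    · rw [Set.preimage_compl, hinv]
    · exact h'.mono fun x hx => not_not.2 hx

end Flow
end

noncomputable section

namespace HypSurface

open UnitTangentPlane

/-! ### The geodesics tracked by the orbits of a surface homeomorphism -/

/-- The geodesic flow on `T¹S` as a flow. -/
def surfaceFlow (Γ : Subgroup SL(2, ℝ)) : Flow ℝ (UnitTangent Γ) where
  toFun := geodesicFlow Γ
  cont' := continuous_geodesicFlow
  map_add' := geodesicFlow_add
  map_zero' := geodesicFlow_zero

theorem Measurable.linePos {X : Type*} [MeasurableSpace X] {p : X → UnitTangentPlane} {z : X → ℍ}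
    (hp : Measurable p) (hz : Measurable z) : Measurable fun x => linePos (p x) (z x) := by
  have h (t : ℝ) : Measurable fun x => Real.cosh (dist (z x) (geodesicLine (p x) t)) :=
    Real.measurable_cosh.comp (hz.dist ((continuous_geodesicLine.comp
      (continuous_id.prodMk continuous_const)).measurable.comp hp))
  unfold HypSurface.linePos
  exact ((((h (-1)).const_mul _).sub ((h 1).const_mul _)).div
    (((h 1).const_mul _).sub ((h (-1)).const_mul _))).log.div_const 2

section Cocycle

variable {Γ : Subgroup SL(2, ℝ)} {f : Surface Γ ≃ₜ Surface Γ} {F : ℍ ≃ₜ ℍ} {C s : ℝ}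
  {sec : Surface Γ → ℍ} {E : Surface Γ → UnitTangentPlane}

/-- The displacement of a point along its tracking geodesic. -/
def displacement (F : ℍ ≃ₜ ℍ) (sec : Surface Γ → ℍ) (E : Surface Γ → UnitTangentPlane)
    (x : Surface Γ) : ℝ :=
  linePos (E x) (F (sec x)) - linePos (E x) (sec x)

/-- The geodesic of `E x` also tracks `F (sec x)`, so after the deck transformation relating the two
lifts it agrees with that of `E (f x)` up to a time. The normalization `linePos = 0` identifies this
time as the displacement. -/
theorem exists_eq_planeFlow_displacement (hF : IsPreferredLift Γ f F)
    (hC : ∀ z, dist z (F z) ≤ C) (hs : 0 < s) (hproj : ∀ x, proj Γ (sec x) = x) {x : Surface Γ}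
    (h₁ : Tracks F s (sec x) (E x) ∧ linePos (E x) (sec x) = 0)
    (h₂ : Tracks F s (sec (f x)) (E (f x)) ∧ linePos (E (f x)) (sec (f x)) = 0) :
    ∃ g : Γ, sec (f x) = g • F (sec x) ∧
      E (f x) = planeFlow (displacement F sec E x) (g • E x) := by
  obtain ⟨g, hg⟩ := exists_smul_eq_of_proj_eq
    (show proj Γ (sec (f x)) = proj Γ (F (sec x)) by rw [hproj, hF.1, hproj])
  obtain ⟨t, ht⟩ := tracks_unique hs (hF.tracks_smul g (h₁.1.apply hC)) (hg ▸ h₂.1)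
  refine ⟨g, hg, ?_⟩
  have h3 : linePos (g • E x) (g • F (sec x)) = linePos (E x) (F (sec x)) :=
    linePos_smul (g : SL(2, ℝ)) _ _
  have h4 := h₂.2
  rw [ht, hg, linePos_planeFlow, h3] at h4
  rw [ht, displacement, h₁.2, sub_zero, ← sub_eq_zero.1 h4]

theorem exists_eq_planeFlow_birkhoffSum (hF : IsPreferredLift Γ f F)
    (hC : ∀ z, dist z (F z) ≤ C) (hs : 0 < s) (hproj : ∀ x, proj Γ (sec x) = x) {x : Surface Γ}
    (h : ∀ n : ℕ, Tracks F s (sec (f^[n] x)) (E (f^[n] x)) ∧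
      linePos (E (f^[n] x)) (sec (f^[n] x)) = 0) (n : ℕ) :
    ∃ g : Γ, sec (f^[n] x) = g • F^[n] (sec x) ∧
      E (f^[n] x) = planeFlow (birkhoffSum f (displacement F sec E) n x) (g • E x) := by
  induction n with
  | zero => exact ⟨1, by simp, by simp [planeFlow_zero]⟩
  | succ n ih =>
    obtain ⟨g, h1, h2⟩ := ih
    have h3 := h (n + 1)
    rw [Function.iterate_succ_apply'] at h3
    obtain ⟨g', h4, h5⟩ := exists_eq_planeFlow_displacement hF hC hs hproj (h n) h3
    refine ⟨g' * g, ?_, ?_⟩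
    · rw [Function.iterate_succ_apply', Function.iterate_succ_apply', h4, h1, hF.2, mul_smul]
    · rw [Function.iterate_succ_apply', h5, birkhoffSum_succ, add_comm, planeFlow_add, mul_smul]
      congr 1
      rw [h2]
      exact (planeFlow_smul _ (g' : SL(2, ℝ)) _).symm

/-- The displacements telescope to the position of `F^[n] (sec x)` along the geodesic of `E x`,
which advances at speed `s` by tracking. -/
theorem tendsto_birkhoffSum_displacement (hF : IsPreferredLift Γ f F)
    (hC : ∀ z, dist z (F z) ≤ C) (hs : 0 < s) (hproj : ∀ x, proj Γ (sec x) = x) {x : Surface Γ}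
    (h : ∀ n : ℕ, Tracks F s (sec (f^[n] x)) (E (f^[n] x)) ∧
      linePos (E (f^[n] x)) (sec (f^[n] x)) = 0) :
    Tendsto (fun n : ℕ => birkhoffSum f (displacement F sec E) n x / n) atTop (𝓝 s) := by
  refine (linePos_div_tendsto (h 0).1).congr fun n => ?_
  obtain ⟨g, h1, h2⟩ := exists_eq_planeFlow_birkhoffSum hF hC hs hproj h n
  have h3 := (h n).2
  have h4 : linePos (g • E x) (g • F^[n] (sec x)) = linePos (E x) (F^[n] (sec x)) :=
    linePos_smul (g : SL(2, ℝ)) _ _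
  rw [h2, h1, linePos_planeFlow, h4] at h3
  rw [← sub_eq_zero.1 h3]
  rfl

/-- All tracking geodesics of a point are obtained from one of them by the geodesic flow. -/
theorem eq_geodesicFlow_of_isTrackingGeodesic {x : Surface Γ} {z : ℍ} (hz : proj Γ z = x)
    {p : UnitTangentPlane} (hs : 0 < s) (hx : HasRotationSpeed Γ F x s) (hp : Tracks F s z p)
    {v : UnitTangent Γ} (hv : IsTrackingGeodesic Γ F x v) :
    ∃ t, v = surfaceFlow Γ t (tproj Γ p) := by
  obtain ⟨s', -, hx', h⟩ := hv
  obtain rfl : s = s' := tendsto_nhds_unique (hx z hz).1 (hx' z hz).1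
  obtain ⟨q, rfl, hq⟩ := h z hz
  obtain ⟨t, rfl⟩ := tracks_unique hs hp hq
  exact ⟨t, rfl⟩

theorem isNormalizedTrackingGeodesic_tproj (hF : IsPreferredLift Γ f F) {x : Surface Γ} {z : ℍ}
    (hz : proj Γ z = x) {p : UnitTangentPlane} (hs : 0 < s) (hx : HasRotationSpeed Γ F x s)
    (hp : Tracks F s z p) (hpz : linePos p z = 0) :
    IsNormalizedTrackingGeodesic Γ F x (tproj Γ p) := by
  refine ⟨⟨s, hs, hx, fun w hw => ?_⟩, s, z, p, hx, hz, rfl, hp, ?_⟩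
  · obtain ⟨g, rfl⟩ := exists_smul_eq_of_proj_eq (hw.trans hz.symm)
    exact ⟨g • p, tproj_smul g p, hF.tracks_smul g hp⟩
  · rw [← dist_geodesicLine_linePos, hpz]

end Cocycle

end HypSurface
end

/-! ### Assembly of the theorem -/

theorem theorem1p9 (Γ : Subgroup SL(2, ℝ)) (hΓ : IsClosedSurfaceGroup Γ)
    (f : Surface Γ ≃ₜ Surface Γ) (hf : IsIsotopicToId f)
    (μ : Measure (Surface Γ)) (hμ : IsErgodicWithPositiveSpeed Γ f (preferredLift hΓ hf) μ) :
    ∃ ν : Measure (UnitTangent Γ), IsProbabilityMeasure ν ∧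
      -- almost every point has a normalized tracking geodesic, and its tracking geodesics
      -- equidistribute to `ν`
      (∀ᵐ x ∂μ,
        (∃ v, IsNormalizedTrackingGeodesic Γ (preferredLift hΓ hf) x v) ∧
        ∀ v, IsTrackingGeodesic Γ (preferredLift hΓ hf) x v → Equidistributes Γ v ν) ∧
      IsFlowInvariant Γ ν ∧ IsFlowErgodic Γ ν ∧
      -- the support of `ν` is the closure of the orbit of almost every tracking geodesic
      (∀ᵐ x ∂μ, ∀ v, IsTrackingGeodesic Γ (preferredLift hΓ hf) x v →
        ν.support = closure (Set.range fun t : ℝ => geodesicFlow Γ t v)) := by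
  obtain ⟨hprob, herg, s, hs, hspeed⟩ := hμ
  have hF := isPreferredLift_preferredLift hΓ hf
  set F := preferredLift hΓ hf
  have : T2Space (UnitTangent Γ) := hΓ.t2Space_unitTangent
  have : CompactSpace (UnitTangent Γ) := hΓ.compactSpace_unitTangent
  obtain ⟨C, hC⟩ := hΓ.exists_dist_le F.continuous hF.2
  obtain ⟨sec, E, hsec, hE, hproj, hgood⟩ :=
    exists_measurable_tracking hΓ herg.toMeasurePreserving hF hC hs hspeed
  have hv : Measurable fun x => tproj Γ (E x) :=
    isOpenQuotientMap_tproj.continuous.measurable.comp hE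
  have hτ : Measurable (displacement F sec E) :=
    (hE.linePos (F.continuous.measurable.comp hsec)).sub (hE.linePos hsec)
  have hτC (x : Surface Γ) : |displacement F sec E x| ≤ C :=
    (abs_linePos_sub_le _ _ _).trans ((dist_comm _ _).trans_le (hC _))
  have horb : ∀ᵐ x ∂μ, ∀ n : ℕ, Tracks F s (sec (f^[n] x)) (E (f^[n] x)) ∧
      linePos (E (f^[n] x)) (sec (f^[n] x)) = 0 :=
    ae_all_iff.2 fun n => (herg.toMeasurePreserving.iterate n).quasiMeasurePreserving.ae hgood
  have hcoc : ∀ᵐ x ∂μ, tproj Γ (E (f x)) =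
      surfaceFlow Γ (displacement F sec E x) (tproj Γ (E x)) := by
    filter_upwards [horb] with x hx
    obtain ⟨g, -, h2⟩ := exists_eq_planeFlow_displacement (x := x) hF hC hs hproj (hx 0) (hx 1)
    rw [h2, ← tproj_smul g (E x)]
    rfl
  -- At a single good point the Birkhoff averages converge both to the mean and to `s`.
  have hτs : ∫ x, displacement F sec E x ∂μ = s := by
    obtain ⟨x, h1, h2⟩ := (horb.and (herg.ae_tendsto_birkhoffSum_div hτ hτC)).exists
    exact tendsto_nhds_unique h2 (tendsto_birkhoffSum_displacement hF hC hs hproj h1)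
  obtain ⟨ν, hν, hequi, hinv, hdich⟩ := Flow.exists_measure_of_cocycle (f := f.toMeasurableEquiv)
    (g := surfaceFlow Γ) herg hv hτ hτC hcoc hs hτs
  -- The support is an invariant Borel set with null complement, so the first alternative would give
  -- `ν` total mass zero.
  have hsupp : ∀ᵐ x ∂μ, tproj Γ (E x) ∈ ν.support := by
    rcases hdich ν.support Measure.isClosed_support.measurableSet
      ((surfaceFlow Γ).preimage_support hinv) with h | h
    · have h1 := measure_add_measure_compl (μ := ν) (s := ν.support)
        Measure.isClosed_support.measurableSet
      rw [h.1, Measure.measure_compl_support, measure_univ, add_zero] at h1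
      exact absurd h1 zero_ne_one
    · exact h.2
  refine ⟨ν, hν, ?_, hinv, fun A hA h => ?_, ?_⟩
  · filter_upwards [hgood, hspeed, hequi] with x h1 h2 h3
    refine ⟨⟨_, isNormalizedTrackingGeodesic_tproj hF (hproj x) hs h2 h1.1 h1.2⟩, fun v hv => ?_⟩
    obtain ⟨t, rfl⟩ := eq_geodesicFlow_of_isTrackingGeodesic (hproj x) hs h2 h1.1 hv
    exact h3.shift t
  · exact (hdich A hA h).imp And.left And.left
  · filter_upwards [hgood, hspeed, hequi, hsupp] with x h1 h2 h3 h4 v hv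
    obtain ⟨t, rfl⟩ := eq_geodesicFlow_of_isTrackingGeodesic (hproj x) hs h2 h1.1 hv
    refine Set.Subset.antisymm (h3.shift t).support_subset
      (closure_minimal ?_ Measure.isClosed_support)
    rintro _ ⟨r, rfl⟩
    have h5 := (surfaceFlow Γ).preimage_support hinv (r + t)
    have h6 := h5.ge h4
    rw [Set.mem_preimage, (surfaceFlow Γ).map_add] at h6
    exact h6
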